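/- Let $\mathcal F=(\mathcal X_n,K_n,\pi_n)_{n\ge1}$ be a family of irreducible Markov chains on countable sets, with transition matrices $K_n$ and stationary distributions $\pi_n$, and let $\mathcal F_c$ be the family of continuous time chains with transition matrices $H_{n,t}=e^{-t(I-K_n)}$. Put $$d^{(c)}_{n,\mathrm{TV}}(t)=\sup_{x\in\mathcal X_n,\,A\subset\mathcal X_n}\{H_{n,t}(x,A)-\pi_n(A)\},\qquad d^{(c)}_{n,H}(t)=\sup_{x\in\mathcal X_n}\Big(\tfrac12\sum_{y}\big(\sqrt{H_{n,t}(x,y)}-\sqrt{\pi_n(y)}\big)^2\Big)^{1/2}.$$ $\mathcal F_c$ has a cutoff in total variation (resp. in the Hellinger distance) if there are $t_n>0$ such that, for $d_n=d^{(c)}_{n,\mathrm{TV}}$ (resp. $d_n=d^{(c)}_{n,H}$), $d_n(at_n)\to0$ for all $a>1$ and $d_n(at_n)\to1$ for all $a\in(0,1)$. For a sequence $\mathcal P=(p_n)_{n\ge1}$ of positive reals with $q_n=p_1+\dots+p_n$, let $\mathcal F^{\mathcal P}$ be the family whose $n$-th chain is the product of the first $n$ chains of $\mathcal F$: its state space is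 $\mathcal X_1\times\dots\times\mathcal X_n$, its stationary distribution $\pi_1\times\dots\times\pi_n$ and its transition matrix $\sum_{i=1}^n\frac{p_i}{q_n}\,I_1\otimes\dots\otimes I_{i-1}\otimes K_i\otimes I_{i+1}\otimes\dots\otimes I_n$. Let $\mathcal F^{\mathcal P}_c$ be the associated continuous time family. **Theorem.** Neither of the statements "$\mathcal F_c$ has a cutoff" and "$\mathcal F_c^{\mathcal P}$ has a cutoff" implies the other, in total variation as well as in the Hellinger distance. Explicitly: (1) For $n\ge1$ let $\mathcal F$ have as its $(2n-1)$-th chain the Ehrenfest chain on $\{0,\dots,n\}$, with $K(j,j+1)=\frac{n-j}n$, $K(j+1,j)=\frac{j+1}n$ for $0\le j<n$ and $\pi(j)=2^{-n}\binom nj$, and as its $2n$-th chain the walk on $\{0,\dots,n\}$ with $K(j,j+1)=K(j+1,j)=K(0,0)=K(n,n)=\frac12$ for $0\le j<n$ and $\pi(j)=\frac1{n+1}$. Let $r\in(0,1)$, $p_{2n-1}=r^{n-1}$ and $p_{2n}=1$. Then $\mathcal F_c$ has no cutoff and $\mathcal F_c^{\mathcal P}$ has a cutoff, in total variation and in the Hellinger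 distance. (2) For $n\ge1$ and $0<a<b$ with $a+b<\frac12$ let $L_n(a,b)$ be the chain on $\{0,\dots,2n\}$ with $K(j,j+1)=1-a$ for $j\notin\{n,2n\}$, $K(0,0)=a$, $K(j,j-1)=a$ for $1\le j\le 2n$, $K(n,n+1)=b$, $K(n,2n)=1-a-b$, $K(2n,n)=c$, $K(2n,2n)=1-a-c$, where $c=\frac{(1-a-b)a^n}{b(1-a)^{n-1}}$ is the value that makes $K$ reversible, and with its stationary distribution (for $n=1$, transitions between the same two states are added up). For $1\le i\le n$ let $p_{n,i}>0$, $0<a_{n,i}<b_{n,i}$, $a_{n,i}+b_{n,i}<\frac12$, and suppose that $$\max_{1\le i\le n}a_{n,i}=O(n^{-2}),\qquad \sum_{i=1}^na_{n,i}=o(1/n),\qquad \frac1{Cn}\le b_{n,i}\le\frac Cn\ \text{ for some } C>1,\qquad \frac{\max_{1\le i\le n} p_{n,i}}{\min_{1\le i\le n} p_{n,i}}\to1 .$$ Such arrays exist. Let $\alpha\ge1$, $q_n=\sum_{i=1}^np_{n,i}$, $\hat p_n=\min_{1\le i\le n} p_{n,i}$ and $r_n=(q_nn/\hat p_n)e^{-n^\alpha}$.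 List the pairs $(n,i)$, $1\le i\le n$, row by row, as $(1,1),(2,1),(2,2),(3,1),\dots$; let $\mathcal F$ be the corresponding sequence of chains $L_n(a_{n,i},b_{n,i})$ and $\mathcal U$ the corresponding sequence of weights $p_{n,i}r_n/q_n$. Then $\mathcal F_c$ has a cutoff and $\mathcal F_c^{\mathcal U}$ has no cutoff, in total variation and in the Hellinger distance. -/

import Mathlib

open Filter Topology

namespace ProductCutoff

noncomputable section

/-- The data `(𝒳, K, π)` of a Markov chain: state space, transition matrix, distribution. -/
structure Chain where
  /-- state space -/
  X : Type
  /-- transition matrix -/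
  K : X → X → ℝ
  /-- stationary distribution -/
  stat : X → ℝ

namespace Chain

open Classical in
/-- The entries `K^m(x,y)` of the powers of the transition matrix. -/
def pow (C : Chain) : ℕ → C.X → C.X → ℝ
  | 0 => fun x y => if x = y then 1 else 0
  | m + 1 => fun x y => ∑' z, C.K x z * pow C m z y

/-- `C` is an irreducible Markov chain on a countable set, with stationary distribution
`C.stat`. -/
structure IsIrreducibleMarkov (C : Chain) : Prop where
  countable : Countable C.X
  K_nonneg : ∀ x y, 0 ≤ C.K x y
  K_sum : ∀ x, HasSum (C.K x) 1
  irreducible : ∀ x y, ∃ m, 0 < C.pow m x y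
  stat_nonneg : ∀ x, 0 ≤ C.stat x
  stat_sum : HasSum C.stat 1
  stationary : ∀ y, HasSum (fun x => C.stat x * C.K x y) (C.stat y)

/-- The entries of `H_t = e^{-t(I-K)}`, the transition matrices of the associated continuous time
chain (the discrete time chain run at the jump times of a rate one Poisson process). -/
def H (C : Chain) (t : ℝ) (x y : C.X) : ℝ :=
  ∑' m : ℕ, Real.exp (-t) * t ^ m / (m.factorial : ℝ) * C.pow m x y

/-- Maximum total variation distance of the continuous time chain at time `t`. -/
def dTV (C : Chain) (t : ℝ) : ℝ :=
  ⨆ x : C.X, ⨆ A : Set C.X, ((∑' y : A, C.H t x y) - ∑' y : A, C.stat y)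

/-- Maximum Hellinger distance of the continuous time chain at time `t`. -/
def dH (C : Chain) (t : ℝ) : ℝ :=
  ⨆ x : C.X, Real.sqrt (1 / 2 * ∑' y, (Real.sqrt (C.H t x y) - Real.sqrt (C.stat y)) ^ 2)

end Chain

open Classical in
/-- The product of the chains `C 0, …, C (n-1)` according to the probability vector `w`, with
transition matrix `∑ i, w i • (I ⊗ ⋯ ⊗ I ⊗ K_i ⊗ I ⊗ ⋯ ⊗ I)`. -/
def prodChain {n : ℕ} (C : Fin n → Chain) (w : Fin n → ℝ) : Chain where
  X := ∀ i, (C i).X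
  K := fun x y => ∑ i, w i *
    ((C i).K (x i) (y i) * ∏ j ∈ Finset.univ.erase i, (if x j = y j then 1 else 0))
  stat := fun x => ∏ i, (C i).stat (x i)

/-- The family `ℱ^𝒫`. Families are indexed from `0`: the entry with index `n` of `ℱ^𝒫` is the
product of the entries `0, …, n` of `ℱ` according to `(p_0/q_n, …, p_n/q_n)`, where
`q_n = p_0 + ⋯ + p_n`. -/
def prodFamily (F : ℕ → Chain) (p : ℕ → ℝ) (n : ℕ) : Chain :=
  prodChain (fun i : Fin (n + 1) => F i)
    (fun i : Fin (n + 1) => p i / ∑ j ∈ Finset.range (n + 1), p j)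

/-- Cutoff, in continuous time, of a sequence of distances `d n t`. -/
def HasCutoff (d : ℕ → ℝ → ℝ) : Prop :=
  ∃ t : ℕ → ℝ, (∀ n, 0 < t n) ∧
    (∀ a : ℝ, 1 < a → Tendsto (fun n => d n (a * t n)) atTop (𝓝 0)) ∧
    (∀ a : ℝ, 0 < a → a < 1 → Tendsto (fun n => d n (a * t n)) atTop (𝓝 1))

/-- `ℱ_c` has a cutoff in the total variation. -/
def CutoffTV (F : ℕ → Chain) : Prop := HasCutoff fun n t => (F n).dTV t

/-- `ℱ_c` has a cutoff in the Hellinger distance. -/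
def CutoffH (F : ℕ → Chain) : Prop := HasCutoff fun n t => (F n).dH t

/-- The Ehrenfest chain on `{0, …, n}`. -/
def ehrenfest (n : ℕ) : Chain where
  X := Fin (n + 1)
  K := fun j k =>
    (if (k : ℕ) = j + 1 then ((n : ℝ) - (j : ℕ)) / n else 0)
      + (if (j : ℕ) = k + 1 then ((j : ℕ) : ℝ) / n else 0)
  stat := fun j => (n.choose j : ℝ) / 2 ^ n

/-- Simple random walk on the path `{0, …, n}` with holding probability `1/2` at both ends. -/
def lazyPath (n : ℕ) : Chain where
  X := Fin (n + 1)
  K := fun j k =>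
    (if (k : ℕ) = j + 1 then 1 / 2 else 0) + (if (j : ℕ) = k + 1 then 1 / 2 else 0)
      + (if (j : ℕ) = 0 ∧ (k : ℕ) = 0 then 1 / 2 else 0)
      + (if (j : ℕ) = n ∧ (k : ℕ) = n then 1 / 2 else 0)
  stat := fun _ => 1 / ((n : ℝ) + 1)

/-- Ehrenfest chains and paths alternating: Ehrenfest on `{0,1}`, path on `{0,1}`, Ehrenfest on
`{0,1,2}`, path on `{0,1,2}`, … -/
def mixedFamily (k : ℕ) : Chain :=
  if Even k then ehrenfest (k / 2 + 1) else lazyPath (k / 2 + 1)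

/-- The weights `1, 1, r, 1, r², 1, …`: the `n`-th Ehrenfest chain gets `r ^ (n-1)`, every path
gets `1`. -/
def mixedWeights (r : ℝ) (k : ℕ) : ℝ := if Even k then r ^ (k / 2) else 1

/-- The value of the transition probability from `2n` to `n` that makes the Lacoin chain
reversible, i.e. the solution `c` of `b c (1-a)^(n-1) = (1-a-b) a^n`. -/
def lacoinC (n : ℕ) (a b : ℝ) : ℝ := (1 - a - b) * a ^ n / (b * (1 - a) ^ (n - 1))

/-- Unnormalized reversible measure of the Lacoin chain. -/
def lacoinWeight (n : ℕ) (a b : ℝ) (j : ℕ) : ℝ :=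
  if j ≤ n then ((1 - a) / a) ^ j else (1 - a) ^ (j - 1) * b / a ^ j

/-- The Lacoin chain on `{0, …, 2n}`, `n ≥ 1`: steps to the right have probability `1-a` and steps
to the left (or the loop at `0`) probability `a`, except that from `n` the chain goes to `n+1` with
probability `b` and jumps to `2n` with probability `1-a-b`, and that from `2n` it jumps back to `n`
with probability `c` and stays with probability `1-a-c`. (If `n = 1`, parallel transitions are
added up.) -/
def lacoin (n : ℕ) (a b : ℝ) : Chain where
  X := Fin (2 * n + 1)
  K := fun j k =>
    (if (j : ℕ) ≠ n ∧ (j : ℕ) ≠ 2 * n ∧ (k : ℕ) = j + 1 then 1 - a else 0)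
      + (if (j : ℕ) = k + 1 then a else 0)
      + (if (j : ℕ) = 0 ∧ (k : ℕ) = 0 then a else 0)
      + (if (j : ℕ) = n ∧ (k : ℕ) = n + 1 then b else 0)
      + (if (j : ℕ) = n ∧ (k : ℕ) = 2 * n then 1 - a - b else 0)
      + (if (j : ℕ) = 2 * n ∧ (k : ℕ) = n then lacoinC n a b else 0)
      + (if (j : ℕ) = 2 * n ∧ (k : ℕ) = 2 * n then 1 - a - lacoinC n a b else 0)
  stat := fun j => lacoinWeight n a b j / ∑ i ∈ Finset.range (2 * n + 1), lacoinWeight n a b i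

/-- Smallest entry of row `n` of a triangular array `(p n i)`, `1 ≤ i ≤ n`. -/
def rowMin (p : ℕ → ℕ → ℝ) (n : ℕ) : ℝ := sInf (p n '' Set.Icc 1 n)

/-- Largest entry of row `n` of a triangular array `(p n i)`, `1 ≤ i ≤ n`. -/
def rowMax (p : ℕ → ℕ → ℝ) (n : ℕ) : ℝ := sSup (p n '' Set.Icc 1 n)

/-- Sum of row `n` of a triangular array `(p n i)`, `1 ≤ i ≤ n`. -/
def rowSum (p : ℕ → ℕ → ℝ) (n : ℕ) : ℝ := ∑ i ∈ Finset.Icc 1 n, p n i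

/-- Conditions on the triangular arrays `a`, `b`, `p` (entries `n, i` with `1 ≤ i ≤ n`). -/
structure LacoinArrays (a b p : ℕ → ℕ → ℝ) : Prop where
  p_pos : ∀ n i, 1 ≤ i → i ≤ n → 0 < p n i
  a_pos : ∀ n i, 1 ≤ i → i ≤ n → 0 < a n i
  a_lt_b : ∀ n i, 1 ≤ i → i ≤ n → a n i < b n i
  a_add_b : ∀ n i, 1 ≤ i → i ≤ n → a n i + b n i < 1 / 2
  a_bound : ∃ C : ℝ, ∀ n i, 1 ≤ i → i ≤ n → a n i ≤ C / (n : ℝ) ^ 2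
  a_sum : Tendsto (fun n : ℕ => (n : ℝ) * rowSum a n) atTop (𝓝 0)
  b_bound : ∃ C : ℝ, 1 < C ∧ ∀ n i, 1 ≤ i → i ≤ n →
    1 / (C * n) ≤ b n i ∧ b n i ≤ C / n
  p_ratio : Tendsto (fun n => rowMax p n / rowMin p n) atTop (𝓝 1)

/-- If `k = n(n+1)/2 + i` with `0 ≤ i ≤ n`, then `triRow k = n + 1`: the (1-based) row of position
`k` when a triangular array is listed row by row. -/
def triRow (k : ℕ) : ℕ := Nat.findGreatest (fun n => n * (n + 1) / 2 ≤ k) k + 1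

/-- If `k = n(n+1)/2 + i` with `0 ≤ i ≤ n`, then `triCol k = i + 1`. -/
def triCol (k : ℕ) : ℕ := k - (triRow k - 1) * triRow k / 2 + 1

/-- The Lacoin chains `(n, i)`, `1 ≤ i ≤ n`, listed row by row. -/
def lacoinFamily (a b : ℕ → ℕ → ℝ) (k : ℕ) : Chain :=
  lacoin (triRow k) (a (triRow k) (triCol k)) (b (triRow k) (triCol k))

/-- `r_n = (q_n n / p̂_n) exp(-n^α)`, where `q_n` and `p̂_n` are the sum and the minimum of row `n`
of `p`. -/
def lacoinR (p : ℕ → ℕ → ℝ) (α : ℝ) (n : ℕ) : ℝ :=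
  rowSum p n * n / rowMin p n * Real.exp (-(n : ℝ) ^ α)

/-- The weight `p_{n,i} r_n / q_n` of the chain `(n, i)`, listed row by row. -/
def lacoinWeights (p : ℕ → ℕ → ℝ) (α : ℝ) (k : ℕ) : ℝ :=
  p (triRow k) (triCol k) * lacoinR p α (triRow k) / rowSum p (triRow k)

end

end ProductCutoff

/-! Everything passes through the Hellinger affinity ∑_y √(H_t(x,y) π(y)) and its minimum m(t) over
the starting states x. The Hellinger distance is √(1 - m), and the total variation distance lies
between 1 - m and √(1 - m²). Hence either cutoff means that m switches abruptly from 0 to 1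
(`cutoffTV_iff`, `cutoffH_iff`), and both distances are treated at once. The semigroup of a product
chain is the tensor product of the factor semigroups, each run at its own speed w_i, so m(t) = ∏
m_i(w_i t) (`minAff_prodChain`). Both counterexamples become estimates of such products.

Ehrenfest chains and paths: the path relaxes gradually on the time scale n², which excludes a cutoff
along the odd indices. In the product, the Ehrenfest chains are slowed down geometrically, so the
last one is by far the slowest component and dictates a cutoff at (n/4) log n divided by its weight.
The deficits of the earlier Ehrenfest chains are dominated by a geometric series, and all paths have
mixed long before, because r^(-m) beats every polynomial. The affinity of the Ehrenfest chain is
explicit (`minAff_ehrenfest`): the chain is a projection of the walk on the hypercube, which is a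
product of two-point chains.

Lacoin chains: from 0 the chain drifts to n in about n steps and then almost surely jumps to 2n,
where nearly all stationary mass sits. With probability of order b, which is of order 1/n, it walks
through n+1, …, 2n instead and needs a further time n. One chain hardly notices this detour and has
a cutoff at time n (`cutoffAff_family`). The n independent chains of row n do notice it: with a
probability bounded away from 0 and 1 at least one of them is still on its detour during the window
between n and 2n. The weights place row n on the time scale e^(n^α), and all earlier rows together
cost only a bounded factor. At the end of row n the affinity is therefore bounded away from 0 after
6/5 e^(n^α) (`exists_le_prod_minAff`) and away from 1 before 9/5 e^(n^α) (`exists_prod_minAff_le`);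
these ranges overlap too much for a cutoff. -/

namespace ProductCutoff
noncomputable section

/-! ### Hellinger affinity and its comparison with both distances. -/

namespace Chain

/-- Hellinger affinity of `H_t(x, ·)` and the stationary distribution. -/
def aff (C : Chain) (t : ℝ) (x : C.X) : ℝ := ∑' y, √(C.H t x y) * √(C.stat y)

/-- Smallest Hellinger affinity at time `t`. -/
def minAff (C : Chain) (t : ℝ) : ℝ := ⨅ x, C.aff t x

/-- Total variation distance of `H_t(x, ·)` and the stationary distribution. -/
def tv (C : Chain) (t : ℝ) (x : C.X) : ℝ := 1 / 2 * ∑' y, |C.H t x y - C.stat y|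

/-- The state space is finite, and `H_t(x, ·)` and the stationary distribution are probability
distributions on it. -/
structure HasLaws (C : Chain) : Prop where
  finite : Finite C.X
  H_nonneg : ∀ t, 0 ≤ t → ∀ x y, 0 ≤ C.H t x y
  H_sum : ∀ t, 0 ≤ t → ∀ x, ∑' y, C.H t x y = 1
  stat_nonneg : ∀ x, 0 ≤ C.stat x
  stat_sum : ∑' x, C.stat x = 1

end Chain

section Distances

variable {ι : Type*} [Fintype ι] {μ ν : ι → ℝ}

lemma half_sum_sq_sqrt_sub (hμ : ∀ i, 0 ≤ μ i) (hν : ∀ i, 0 ≤ ν i) (hμ1 : ∑ i, μ i = 1)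
    (hν1 : ∑ i, ν i = 1) :
    1 / 2 * ∑ i, (√(μ i) - √(ν i)) ^ 2 = 1 - ∑ i, √(μ i) * √(ν i) := by
  have : ∀ i, (√(μ i) - √(ν i)) ^ 2 = μ i + ν i - 2 * (√(μ i) * √(ν i)) := fun i => by
    rw [sub_sq, Real.sq_sqrt (hμ i), Real.sq_sqrt (hν i)]; ring
  simp only [this, Finset.sum_sub_distrib, Finset.sum_add_distrib, hμ1, hν1, ← Finset.mul_sum]
  ring

lemma affinity_le_one (hμ : ∀ i, 0 ≤ μ i) (hν : ∀ i, 0 ≤ ν i) (hμ1 : ∑ i, μ i = 1)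
    (hν1 : ∑ i, ν i = 1) : ∑ i, √(μ i) * √(ν i) ≤ 1 := by
  have h := half_sum_sq_sqrt_sub hμ hν hμ1 hν1
  have : 0 ≤ ∑ i, (√(μ i) - √(ν i)) ^ 2 := Finset.sum_nonneg fun _ _ => sq_nonneg _
  linarith

/-- Pointwise, (√μ - √ν)² ≤ |√μ - √ν| (√μ + √ν) = |μ - ν|. -/
lemma one_sub_affinity_le (hμ : ∀ i, 0 ≤ μ i) (hν : ∀ i, 0 ≤ ν i) (hμ1 : ∑ i, μ i = 1)
    (hν1 : ∑ i, ν i = 1) : 1 - ∑ i, √(μ i) * √(ν i) ≤ 1 / 2 * ∑ i, |μ i - ν i| := by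
  rw [← half_sum_sq_sqrt_sub hμ hν hμ1 hν1]
  gcongr with i
  have h : μ i - ν i = (√(μ i) - √(ν i)) * (√(μ i) + √(ν i)) := by
    linear_combination -Real.sq_sqrt (hμ i) + Real.sq_sqrt (hν i)
  rw [h, abs_mul, abs_of_nonneg (add_nonneg (Real.sqrt_nonneg _) (Real.sqrt_nonneg _)), ← sq_abs,
    sq]
  gcongr
  have h1 := Real.sqrt_nonneg (μ i)
  have h2 := Real.sqrt_nonneg (ν i)
  exact abs_le.2 ⟨by linarith, by linarith⟩

/-- Cauchy–Schwarz for |μ - ν| = |√μ - √ν| (√μ + √ν); with affinity A, the two sums of squares are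
2(1 - A) and 2(1 + A). -/
lemma half_l1_le_sqrt (hμ : ∀ i, 0 ≤ μ i) (hν : ∀ i, 0 ≤ ν i) (hμ1 : ∑ i, μ i = 1)
    (hν1 : ∑ i, ν i = 1) :
    1 / 2 * ∑ i, |μ i - ν i| ≤ √(1 - (∑ i, √(μ i) * √(ν i)) ^ 2) := by
  apply Real.le_sqrt_of_sq_le
  have hm := half_sum_sq_sqrt_sub hμ hν hμ1 hν1
  have hp : ∑ i, (√(μ i) + √(ν i)) ^ 2 = 2 * (1 + ∑ i, √(μ i) * √(ν i)) := by
    have : ∀ i, (√(μ i) + √(ν i)) ^ 2 = μ i + ν i + 2 * (√(μ i) * √(ν i)) := fun i => by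
      rw [add_sq, Real.sq_sqrt (hμ i), Real.sq_sqrt (hν i)]; ring
    simp only [this, Finset.sum_add_distrib, hμ1, hν1, ← Finset.mul_sum]
    ring
  have hcs := Finset.sum_mul_sq_le_sq_mul_sq Finset.univ (fun i => |√(μ i) - √(ν i)|)
    (fun i => √(μ i) + √(ν i))
  have he : ∀ i, |√(μ i) - √(ν i)| * (√(μ i) + √(ν i)) = |μ i - ν i| := fun i => by
    have h : μ i - ν i = (√(μ i) - √(ν i)) * (√(μ i) + √(ν i)) := by
      linear_combination -Real.sq_sqrt (hμ i) + Real.sq_sqrt (hν i)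
    rw [h, abs_mul, abs_of_nonneg (add_nonneg (Real.sqrt_nonneg (μ i)) (Real.sqrt_nonneg (ν i)))]
  simp only [he, sq_abs] at hcs
  rw [hp] at hcs
  have : ∑ i, (√(μ i) - √(ν i)) ^ 2 = 2 * (1 - ∑ i, √(μ i) * √(ν i)) := by linarith
  rw [this] at hcs
  nlinarith

lemma sum_sub_le_half_l1 (hμ1 : ∑ i, μ i = 1) (hν1 : ∑ i, ν i = 1) (s : Finset ι) :
    ∑ i ∈ s, (μ i - ν i) ≤ 1 / 2 * ∑ i, |μ i - ν i| := by
  classical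
  have h1 : ∑ i ∈ s, (μ i - ν i) ≤ ∑ i, (|μ i - ν i| + (μ i - ν i)) / 2 := by
    calc ∑ i ∈ s, (μ i - ν i) ≤ ∑ i ∈ s, (|μ i - ν i| + (μ i - ν i)) / 2 :=
          Finset.sum_le_sum fun i _ => by linarith [le_abs_self (μ i - ν i)]
      _ ≤ _ := Finset.sum_le_sum_of_subset_of_nonneg (Finset.subset_univ _)
          fun i _ _ => by linarith [neg_abs_le (μ i - ν i)]
  have h2 : ∑ i, (μ i - ν i) = 0 := by rw [Finset.sum_sub_distrib, hμ1, hν1, sub_self]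
  rw [← Finset.sum_div, Finset.sum_add_distrib, h2] at h1
  linarith

lemma exists_sum_sub_eq_half_l1 (hμ1 : ∑ i, μ i = 1) (hν1 : ∑ i, ν i = 1) :
    ∃ s : Finset ι, ∑ i ∈ s, (μ i - ν i) = 1 / 2 * ∑ i, |μ i - ν i| := by
  classical
  refine ⟨Finset.univ.filter fun i => 0 ≤ μ i - ν i, ?_⟩
  have h : ∀ i, (if 0 ≤ μ i - ν i then μ i - ν i else 0) = 1 / 2 * (|μ i - ν i| + (μ i - ν i)) := by
    intro i
    split_ifs with h
    · rw [abs_of_nonneg h]; ring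
    · rw [abs_of_neg (not_le.1 h)]; ring
  rw [Finset.sum_filter, Finset.sum_congr rfl fun i _ => h i, ← Finset.mul_sum,
    Finset.sum_add_distrib, Finset.sum_sub_distrib, hμ1, hν1]
  ring

end Distances

namespace Chain.HasLaws

variable {C : Chain} {t : ℝ}

lemma nonempty (h : C.HasLaws) : Nonempty C.X := by
  by_contra hn
  rw [not_nonempty_iff] at hn
  simpa using h.stat_sum

lemma aff_nonneg (C : Chain) (t : ℝ) (x : C.X) : 0 ≤ C.aff t x :=
  tsum_nonneg fun _ => by positivity

lemma aff_le_one (h : C.HasLaws) (ht : 0 ≤ t) (x : C.X) : C.aff t x ≤ 1 := by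
  have := h.finite
  have := Fintype.ofFinite C.X
  have h1 := h.H_sum t ht x
  have h2 := h.stat_sum
  rw [tsum_fintype] at h1 h2
  rw [aff, tsum_fintype]
  exact affinity_le_one (h.H_nonneg t ht x) h.stat_nonneg h1 h2

lemma one_sub_aff_le_tv (h : C.HasLaws) (ht : 0 ≤ t) (x : C.X) : 1 - C.aff t x ≤ C.tv t x := by
  have := h.finite
  have := Fintype.ofFinite C.X
  have h1 := h.H_sum t ht x
  have h2 := h.stat_sum
  rw [tsum_fintype] at h1 h2
  rw [aff, tv, tsum_fintype, tsum_fintype]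
  exact one_sub_affinity_le (h.H_nonneg t ht x) h.stat_nonneg h1 h2

lemma tv_le_sqrt (h : C.HasLaws) (ht : 0 ≤ t) (x : C.X) : C.tv t x ≤ √(1 - C.aff t x ^ 2) := by
  have := h.finite
  have := Fintype.ofFinite C.X
  have h1 := h.H_sum t ht x
  have h2 := h.stat_sum
  rw [tsum_fintype] at h1 h2
  rw [aff, tv, tsum_fintype, tsum_fintype]
  exact half_l1_le_sqrt (h.H_nonneg t ht x) h.stat_nonneg h1 h2

lemma exists_minAff_eq (h : C.HasLaws) (t : ℝ) : ∃ x, C.minAff t = C.aff t x := by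
  have := h.finite
  have := h.nonempty
  obtain ⟨x, hx⟩ := Finite.exists_min (C.aff t)
  exact ⟨x, le_antisymm (ciInf_le (Set.finite_range _).bddBelow x) (le_ciInf hx)⟩

lemma minAff_le (h : C.HasLaws) (t : ℝ) (x : C.X) : C.minAff t ≤ C.aff t x := by
  have := h.finite
  exact ciInf_le (Set.finite_range _).bddBelow x

lemma le_minAff (h : C.HasLaws) {c : ℝ} (hc : ∀ x, c ≤ C.aff t x) : c ≤ C.minAff t := by
  obtain ⟨x, hx⟩ := h.exists_minAff_eq t
  exact hx ▸ hc x

lemma minAff_nonneg (h : C.HasLaws) (t : ℝ) : 0 ≤ C.minAff t :=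
  h.le_minAff fun x => aff_nonneg C t x

lemma minAff_le_one (h : C.HasLaws) (ht : 0 ≤ t) : C.minAff t ≤ 1 := by
  obtain ⟨x, hx⟩ := h.exists_minAff_eq t
  exact hx ▸ h.aff_le_one ht x

lemma one_sub_le_minAff (h : C.HasLaws) (ht : 0 ≤ t) {c : ℝ} (hc : ∀ x, C.tv t x ≤ c) :
    1 - c ≤ C.minAff t :=
  h.le_minAff fun x => by linarith [h.one_sub_aff_le_tv ht x, hc x]

lemma dH_sq (h : C.HasLaws) (ht : 0 ≤ t) : C.dH t ^ 2 = 1 - C.minAff t := by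
  have := h.finite
  have := h.nonempty
  have := Fintype.ofFinite C.X
  have h2 := h.stat_sum
  have he : ∀ x, 1 / 2 * ∑' y, (√(C.H t x y) - √(C.stat y)) ^ 2 = 1 - C.aff t x := by
    intro x
    have h1 := h.H_sum t ht x
    rw [tsum_fintype] at h1 h2
    rw [aff, tsum_fintype, tsum_fintype]
    exact half_sum_sq_sqrt_sub (h.H_nonneg t ht x) h.stat_nonneg h1 h2
  obtain ⟨x, hx⟩ := h.exists_minAff_eq t
  have hd : C.dH t = √(1 - C.minAff t) := by
    simp only [dH, he]
    apply le_antisymm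
    · exact ciSup_le fun y => Real.sqrt_le_sqrt (by linarith [h.minAff_le t y])
    · rw [hx]
      exact le_ciSup (f := fun y => √(1 - C.aff t y)) (Set.finite_range _).bddAbove x
  rw [hd, Real.sq_sqrt (by linarith [h.minAff_le_one ht])]

lemma dH_nonneg (C : Chain) (t : ℝ) : 0 ≤ C.dH t := Real.iSup_nonneg fun _ => Real.sqrt_nonneg _

lemma iSup_eq_tv (h : C.HasLaws) (ht : 0 ≤ t) (x : C.X) :
    ⨆ A : Set C.X, ((∑' y : A, C.H t x y) - ∑' y : A, C.stat y) = C.tv t x := by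
  classical
  have := h.finite
  have := Fintype.ofFinite C.X
  have h1 := h.H_sum t ht x
  have h2 := h.stat_sum
  rw [tsum_fintype] at h1 h2
  have hA : ∀ A : Set C.X, (∑' y : A, C.H t x y) - ∑' y : A, C.stat y
      = ∑ y ∈ A.toFinset, (C.H t x y - C.stat y) := by
    intro A
    rw [tsum_fintype, tsum_fintype, Finset.sum_sub_distrib, ← Finset.sum_coe_sort A.toFinset,
      ← Finset.sum_coe_sort A.toFinset]
    congr 1
    · exact Fintype.sum_equiv (Equiv.subtypeEquivRight (by simp)) _ _ (by intro y; rfl)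
    · exact Fintype.sum_equiv (Equiv.subtypeEquivRight (by simp)) _ _ (by intro y; rfl)
  simp only [hA]
  rw [tv, tsum_fintype]
  apply le_antisymm
  · exact ciSup_le fun A => sum_sub_le_half_l1 h1 h2 _
  · obtain ⟨s, hs⟩ := exists_sum_sub_eq_half_l1 h1 h2
    rw [← hs]
    have := le_ciSup (f := fun A : Set C.X => ∑ y ∈ A.toFinset, (C.H t x y - C.stat y))
      (Set.finite_range _).bddAbove (s : Set C.X)
    simpa using this

lemma tv_le_dTV (h : C.HasLaws) (ht : 0 ≤ t) (x : C.X) : C.tv t x ≤ C.dTV t := by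
  have := h.finite
  simp only [dTV, h.iSup_eq_tv ht]
  exact le_ciSup (Set.finite_range _).bddAbove x

lemma one_sub_minAff_le_dTV (h : C.HasLaws) (ht : 0 ≤ t) : 1 - C.minAff t ≤ C.dTV t := by
  obtain ⟨x, hx⟩ := h.exists_minAff_eq t
  exact hx ▸ (h.one_sub_aff_le_tv ht x).trans (h.tv_le_dTV ht x)

lemma dTV_le (h : C.HasLaws) (ht : 0 ≤ t) : C.dTV t ≤ √(1 - C.minAff t ^ 2) := by
  have := h.nonempty
  simp only [dTV, h.iSup_eq_tv ht]
  refine ciSup_le fun x => (h.tv_le_sqrt ht x).trans (Real.sqrt_le_sqrt ?_)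
  have := h.minAff_le t x
  have := h.minAff_nonneg t
  gcongr

end Chain.HasLaws

/-- Cutoff in terms of the smallest Hellinger affinities. -/
def CutoffAff (F : ℕ → Chain) : Prop :=
  ∃ t : ℕ → ℝ, (∀ n, 0 < t n) ∧
    (∀ a : ℝ, 1 < a → Tendsto (fun n => (F n).minAff (a * t n)) atTop (𝓝 1)) ∧
    (∀ a : ℝ, 0 < a → a < 1 → Tendsto (fun n => (F n).minAff (a * t n)) atTop (𝓝 0))

variable {F : ℕ → Chain}

lemma tendsto_dTV_zero_iff (hF : ∀ n, (F n).HasLaws) {s : ℕ → ℝ} (hs : ∀ n, 0 ≤ s n) :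
    Tendsto (fun n => (F n).dTV (s n)) atTop (𝓝 0) ↔
      Tendsto (fun n => (F n).minAff (s n)) atTop (𝓝 1) := by
  constructor
  · intro h
    have h' := h.const_sub 1
    rw [sub_zero] at h'
    refine tendsto_of_tendsto_of_tendsto_of_le_of_le h' tendsto_const_nhds (fun n => ?_)
      fun n => (hF n).minAff_le_one (hs n)
    have := (hF n).one_sub_minAff_le_dTV (hs n)
    simp only
    linarith
  · intro h
    have h' := ((h.pow 2).const_sub 1).sqrt
    norm_num at h'
    refine tendsto_of_tendsto_of_tendsto_of_le_of_le tendsto_const_nhds h' (fun n => ?_)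
      fun n => (hF n).dTV_le (hs n)
    have := (hF n).one_sub_minAff_le_dTV (hs n)
    have := (hF n).minAff_le_one (hs n)
    simp only
    linarith

/-- The lower bound 1 - m ≤ d is useless for deducing m → 0 from d → 1; that direction squares d ≤
√(1 - m²) into m² ≤ 1 - d². -/
lemma tendsto_dTV_one_iff (hF : ∀ n, (F n).HasLaws) {s : ℕ → ℝ} (hs : ∀ n, 0 ≤ s n) :
    Tendsto (fun n => (F n).dTV (s n)) atTop (𝓝 1) ↔
      Tendsto (fun n => (F n).minAff (s n)) atTop (𝓝 0) := by
  constructor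
  · intro h
    have h' := ((h.pow 2).const_sub 1).sqrt
    norm_num at h'
    refine tendsto_of_tendsto_of_tendsto_of_le_of_le tendsto_const_nhds h' (fun n => ?_)
      fun n => ?_
    · exact (hF n).minAff_nonneg _
    · apply Real.le_sqrt_of_sq_le
      have h1 := (hF n).one_sub_minAff_le_dTV (hs n)
      have h2 := (hF n).minAff_le_one (hs n)
      have h0 := (hF n).minAff_nonneg (s n)
      have h3 := (hF n).dTV_le (hs n)
      have h4 : (F n).dTV (s n) ^ 2 ≤ √(1 - (F n).minAff (s n) ^ 2) ^ 2 := by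
        gcongr
        linarith
      rw [Real.sq_sqrt (by nlinarith)] at h4
      linarith
  · intro h
    have h' := h.const_sub 1
    rw [sub_zero] at h'
    refine tendsto_of_tendsto_of_tendsto_of_le_of_le h' tendsto_const_nhds
      (fun n => (hF n).one_sub_minAff_le_dTV (hs n)) fun n => ((hF n).dTV_le (hs n)).trans ?_
    exact Real.sqrt_le_iff.2 ⟨zero_le_one, by nlinarith [(hF n).minAff_nonneg (s n)]⟩

lemma tendsto_dH_iff (hF : ∀ n, (F n).HasLaws) {s : ℕ → ℝ} (hs : ∀ n, 0 ≤ s n) {d : ℝ}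
    (hd : 0 ≤ d) :
    Tendsto (fun n => (F n).dH (s n)) atTop (𝓝 d) ↔
      Tendsto (fun n => (F n).minAff (s n)) atTop (𝓝 (1 - d ^ 2)) := by
  have h1 : ∀ n, (F n).minAff (s n) = 1 - (F n).dH (s n) ^ 2 := fun n => by
    rw [(hF n).dH_sq (hs n)]; ring
  have h2 : ∀ n, (F n).dH (s n) = √(1 - (F n).minAff (s n)) := fun n => by
    rw [← (hF n).dH_sq (hs n), Real.sqrt_sq (Chain.HasLaws.dH_nonneg _ _)]
  constructor
  · intro h
    simp only [h1]
    exact (h.pow 2).const_sub 1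
  · intro h
    simp only [h2]
    have := (h.const_sub 1).sqrt
    rwa [sub_sub_cancel, Real.sqrt_sq hd] at this

lemma cutoffTV_iff (hF : ∀ n, (F n).HasLaws) : CutoffTV F ↔ CutoffAff F := by
  refine exists_congr fun t => and_congr_right fun ht => and_congr ?_ ?_
  · refine forall_congr' fun a => imp_congr_right fun ha => tendsto_dTV_zero_iff hF fun n => ?_
    have := ht n
    positivity
  · refine forall_congr' fun a => imp_congr_right fun ha => imp_congr_right fun _ =>
      tendsto_dTV_one_iff hF fun n => ?_
    have := ht n
    positivity

lemma cutoffH_iff (hF : ∀ n, (F n).HasLaws) : CutoffH F ↔ CutoffAff F := by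
  refine exists_congr fun t => and_congr_right fun ht => and_congr ?_ ?_
  · refine forall_congr' fun a => imp_congr_right fun ha => ?_
    rw [tendsto_dH_iff hF (fun n => by have := ht n; positivity) le_rfl]
    norm_num
  · refine forall_congr' fun a => imp_congr_right fun ha => imp_congr_right fun _ => ?_
    rw [tendsto_dH_iff hF (fun n => by have := ht n; positivity) zero_le_one]
    norm_num

end
end ProductCutoff

namespace ProductCutoff
noncomputable section

/-! ### Averages over the Poisson number of jumps. -/

section Poisson

lemma hasSum_of_eq {f g : ℕ → ℝ} {a b : ℝ} (h : HasSum f a) (hf : ∀ n, g n = f n) (ha : b = a) :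
    HasSum g b := by
  rw [funext hf, ha]
  exact h

lemma hasSum_poisson_geometric (t ρ : ℝ) :
    HasSum (fun m : ℕ => Real.exp (-t) * t ^ m / (m.factorial : ℝ) * ρ ^ m)
      (Real.exp (-t * (1 - ρ))) := by
  have h := (NormedSpace.expSeries_div_hasSum_exp (t * ρ)).mul_left (Real.exp (-t))
  rw [← Real.exp_eq_exp_ℝ, ← Real.exp_add] at h
  refine hasSum_of_eq h (fun m => ?_) ?_
  · rw [mul_pow]
    ring
  · congr 1
    ring

lemma hasSum_poisson (t : ℝ) :
    HasSum (fun m : ℕ => Real.exp (-t) * t ^ m / (m.factorial : ℝ)) 1 := by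
  simpa using hasSum_poisson_geometric t 1

lemma hasSum_poisson_mul_nat (t : ℝ) :
    HasSum (fun m : ℕ => Real.exp (-t) * t ^ m / (m.factorial : ℝ) * m) t := by
  rw [← hasSum_nat_add_iff' 1]
  refine hasSum_of_eq ((hasSum_poisson t).mul_right t) (fun m => ?_) ?_
  · rw [Nat.factorial_succ]
    push_cast
    field_simp
    ring
  · simp

/-- Discrete time bounds of the form "geometric plus linear plus constant" in the number of steps
are transferred to continuous time by this average. -/
lemma hasSum_poisson_affine (t α ρ β γ : ℝ) :
    HasSum (fun m : ℕ => Real.exp (-t) * t ^ m / (m.factorial : ℝ) * (α * ρ ^ m + β * m + γ))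
      (α * Real.exp (-t * (1 - ρ)) + β * t + γ) := by
  refine hasSum_of_eq ((((hasSum_poisson_geometric t ρ).mul_left α).add
    ((hasSum_poisson_mul_nat t).mul_left β)).add ((hasSum_poisson t).mul_left γ)) (fun m => ?_) ?_
  · ring
  · ring

end Poisson

namespace Chain

variable {C : Chain}

/-! ### The continuous time semigroup as a matrix exponential. -/

section Exp

variable [Fintype C.X] [DecidableEq C.X]

lemma pow_eq_matrix_pow (m : ℕ) (x y : C.X) : C.pow m x y = (Matrix.of C.K ^ m) x y := by
  induction m generalizing x with
  | zero => simp [pow, Matrix.one_apply]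
  | succ m ih =>
    rw [pow_succ', Matrix.mul_apply]
    change ∑' z, C.K x z * C.pow m z y = _
    rw [tsum_fintype]
    simp [ih]

open scoped Matrix.Norms.Operator in
lemma hasSum_poisson_mul_pow (t : ℝ) (x y : C.X) :
    HasSum (fun m : ℕ => Real.exp (-t) * t ^ m / (m.factorial : ℝ) * C.pow m x y)
      (Real.exp (-t) * NormedSpace.exp (t • (Matrix.of C.K : Matrix C.X C.X ℝ)) x y) := by
  have h := NormedSpace.exp_series_hasSum_exp' (𝕂 := ℝ) (t • (Matrix.of C.K : Matrix C.X C.X ℝ))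
  have h2 := (h.map (Matrix.entryLinearMap ℝ ℝ x y).toAddMonoidHom
    (LinearMap.continuous_of_finiteDimensional (Matrix.entryLinearMap ℝ ℝ x y))).mul_left
      (Real.exp (-t))
  refine hasSum_of_eq h2 (fun m => ?_) rfl
  simp only [Function.comp, LinearMap.toAddMonoidHom_coe, Matrix.entryLinearMap_apply,
    Matrix.smul_apply, smul_pow, smul_eq_mul, pow_eq_matrix_pow]
  ring

lemma hasSum_H (t : ℝ) (x y : C.X) :
    HasSum (fun m : ℕ => Real.exp (-t) * t ^ m / (m.factorial : ℝ) * C.pow m x y) (C.H t x y) :=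
  (hasSum_poisson_mul_pow t x y).summable.hasSum

lemma H_eq_exp (t : ℝ) (x y : C.X) :
    C.H t x y = Real.exp (-t) * NormedSpace.exp (t • (Matrix.of C.K : Matrix C.X C.X ℝ)) x y :=
  (hasSum_poisson_mul_pow t x y).tsum_eq

lemma H_zero (x y : C.X) : C.H 0 x y = if x = y then 1 else 0 := by
  rw [H_eq_exp]
  simp [Matrix.one_apply]

lemma H_add (s t : ℝ) (x y : C.X) : C.H (s + t) x y = ∑ z, C.H s x z * C.H t z y := by
  simp only [H_eq_exp]
  rw [add_smul, Matrix.exp_add_of_commute _ _ (((Commute.refl _).smul_left s).smul_right t),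
    Matrix.mul_apply, Finset.mul_sum, neg_add, Real.exp_add]
  exact Finset.sum_congr rfl fun z _ => by ring

open scoped Matrix.Norms.Operator in
lemma hasDerivAt_H (t : ℝ) (x y : C.X) :
    HasDerivAt (fun t => C.H t x y) (∑ z, C.K x z * C.H t z y - C.H t x y) t := by
  have h := hasDerivAt_exp_smul_const' (Matrix.of C.K : Matrix C.X C.X ℝ) t
  have h2 := (LinearMap.toContinuousLinearMap
    (Matrix.entryLinearMap ℝ ℝ x y : Matrix C.X C.X ℝ →ₗ[ℝ] ℝ)).hasFDerivAt.comp_hasDerivAt t h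
  have h3 := ((hasDerivAt_neg t).exp).mul h2
  simp only [H_eq_exp]
  refine h3.congr_deriv ?_
  change Real.exp (-t) * -1 * NormedSpace.exp (t • (Matrix.of C.K : Matrix C.X C.X ℝ)) x y
    + Real.exp (-t) * ∑ z, C.K x z * NormedSpace.exp (t • (Matrix.of C.K : Matrix C.X C.X ℝ)) z y
    = _
  rw [Finset.mul_sum, add_comm, mul_neg_one, neg_mul, ← sub_eq_add_neg]
  exact congrArg₂ _ (Finset.sum_congr rfl fun z _ => mul_left_comm _ _ _) rfl

/-- The matrices `H_t` are the only solution of the backward equation. -/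
lemma eq_H_of_hasDerivAt {G : ℝ → C.X → C.X → ℝ}
    (h0 : ∀ x y, G 0 x y = if x = y then 1 else 0)
    (h : ∀ t x y, HasDerivAt (fun t => G t x y) (∑ z, C.K x z * G t z y - G t x y) t)
    (t : ℝ) (x y : C.X) : G t x y = C.H t x y := by
  -- For every solution G the product H(-t) G(t) has derivative zero, because K commutes with its
  -- exponential. Applied to G and to H itself, this shows that both are inverse to H(-t).
  have key : ∀ G : ℝ → C.X → C.X → ℝ, (∀ x y, G 0 x y = if x = y then 1 else 0) →
      (∀ t x y, HasDerivAt (fun t => G t x y) (∑ z, C.K x z * G t z y - G t x y) t) →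
      Matrix.of (C.H (-t)) * Matrix.of (G t) = 1 := by
    intro G h0 h
    ext x y
    have hd : ∀ s, HasDerivAt (fun s => ∑ z, C.H (-s) x z * G s z y) 0 s := by
      intro s
      have hH : ∀ z, HasDerivAt (fun s => C.H (-s) x z)
          (-(∑ w, C.H (-s) x w * C.K w z - C.H (-s) x z)) s := by
        intro z
        have h1 := (hasDerivAt_H (C := C) (-s) x z).comp s (hasDerivAt_neg s)
        have hc : ∑ w, C.K x w * C.H (-s) w z = ∑ w, C.H (-s) x w * C.K w z := by
          have hcomm : Commute (Matrix.of C.K)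
              (NormedSpace.exp ((-s) • (Matrix.of C.K : Matrix C.X C.X ℝ))) := by
            open scoped Matrix.Norms.Operator in
            exact ((Commute.refl (Matrix.of C.K : Matrix C.X C.X ℝ)).smul_right (-s)).exp_right
          have := congrFun (congrFun hcomm.eq x) z
          rw [Matrix.mul_apply, Matrix.mul_apply] at this
          simp only [H_eq_exp]
          calc _ = Real.exp (- -s) * ∑ w, (Matrix.of C.K) x w *
                (NormedSpace.exp ((-s) • (Matrix.of C.K : Matrix C.X C.X ℝ))) w z := by
                rw [Finset.mul_sum]
                exact Finset.sum_congr rfl fun w _ => by rw [Matrix.of_apply]; ring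
            _ = _ := by
                rw [this, Finset.mul_sum]
                exact Finset.sum_congr rfl fun w _ => by rw [Matrix.of_apply]; ring
        rw [hc] at h1
        exact h1.congr_deriv (by ring)
      have h2 := HasDerivAt.fun_sum fun z (_ : z ∈ Finset.univ) => (hH z).mul (h s z y)
      refine h2.congr_deriv ?_
      have e1 : ∑ z, (∑ w, C.H (-s) x w * C.K w z) * G s z y
          = ∑ z, C.H (-s) x z * ∑ w, C.K z w * G s w y := by
        simp only [Finset.sum_mul, Finset.mul_sum]
        rw [Finset.sum_comm]
        exact Finset.sum_congr rfl fun w _ => Finset.sum_congr rfl fun z _ => by ring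
      have e2 : ∀ z, -(∑ w, C.H (-s) x w * C.K w z - C.H (-s) x z) * G s z y
          + C.H (-s) x z * (∑ w, C.K z w * G s w y - G s z y)
          = C.H (-s) x z * (∑ w, C.K z w * G s w y)
            - (∑ w, C.H (-s) x w * C.K w z) * G s z y := fun z => by ring
      rw [Finset.sum_congr rfl fun z _ => e2 z, Finset.sum_sub_distrib, e1, sub_self]
    have hc := is_const_of_deriv_eq_zero (fun s => (hd s).differentiableAt)
      (fun s => (hd s).deriv) t 0
    rw [Matrix.mul_apply]
    simp only [Matrix.of_apply]
    rw [hc]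
    simp [H_zero, h0, Matrix.one_apply]
  have hG := key G h0 h
  have hH := key C.H H_zero hasDerivAt_H
  have := (mul_eq_one_comm.1 hG).symm
  have e : Matrix.of (G t) = Matrix.of (C.H t) := by
    calc Matrix.of (G t) = (Matrix.of (C.H t) * Matrix.of (C.H (-t))) * Matrix.of (G t) := by
          rw [mul_eq_one_comm.1 hH, one_mul]
      _ = Matrix.of (C.H t) := by rw [mul_assoc, hG, mul_one]
  exact congrFun (congrFun e x) y

end Exp

/-! ### Convergence to the stationary distribution. -/

namespace IsIrreducibleMarkov

variable (h : C.IsIrreducibleMarkov)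
include h

lemma nonempty : Nonempty C.X := by
  by_contra hn
  rw [not_nonempty_iff] at hn
  exact zero_ne_one (hasSum_empty.unique h.stat_sum)

variable [Fintype C.X]

lemma sum_K (x : C.X) : ∑ y, C.K x y = 1 := (hasSum_fintype _).unique (h.K_sum x)

lemma sum_stat : ∑ y, C.stat y = 1 := (hasSum_fintype _).unique h.stat_sum

lemma sum_stat_mul_K (y : C.X) : ∑ x, C.stat x * C.K x y = C.stat y :=
  (hasSum_fintype _).unique (h.stationary y)

lemma stat_le_one (x : C.X) : C.stat x ≤ 1 :=
  h.sum_stat ▸ Finset.single_le_sum (fun y _ => h.stat_nonneg y) (Finset.mem_univ x)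

omit h in
lemma pow_succ_apply (m : ℕ) (x y : C.X) : C.pow (m + 1) x y = ∑ z, C.K x z * C.pow m z y :=
  tsum_fintype _

lemma pow_nonneg (m : ℕ) (x y : C.X) : 0 ≤ C.pow m x y := by
  induction m generalizing x with
  | zero => rw [pow]; positivity
  | succ m ih =>
    rw [pow_succ_apply]
    exact Finset.sum_nonneg fun z _ => mul_nonneg (h.K_nonneg _ _) (ih z)

lemma sum_pow (m : ℕ) (x : C.X) : ∑ y, C.pow m x y = 1 := by
  classical
  induction m generalizing x with
  | zero => simp [pow]
  | succ m ih =>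
    simp only [pow_succ_apply]
    rw [Finset.sum_comm]
    simp only [← Finset.mul_sum, ih, mul_one, h.sum_K]

lemma pow_le_one (m : ℕ) (x y : C.X) : C.pow m x y ≤ 1 :=
  h.sum_pow m x ▸ Finset.single_le_sum (fun z _ => h.pow_nonneg m x z) (Finset.mem_univ y)

lemma sum_stat_mul_pow (m : ℕ) (y : C.X) : ∑ x, C.stat x * C.pow m x y = C.stat y := by
  classical
  induction m with
  | zero => simp [pow]
  | succ m ih =>
    simp only [pow_succ_apply, Finset.mul_sum]
    rw [Finset.sum_comm]
    simp only [← mul_assoc, ← Finset.sum_mul, h.sum_stat_mul_K, ih]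

lemma H_nonneg {t : ℝ} (ht : 0 ≤ t) (x y : C.X) : 0 ≤ C.H t x y :=
  tsum_nonneg fun m => mul_nonneg (by positivity) (h.pow_nonneg m x y)

lemma sum_H (t : ℝ) (x : C.X) : ∑ y, C.H t x y = 1 := by
  classical
  have h1 := hasSum_sum fun y (_ : y ∈ Finset.univ) => hasSum_H (C := C) t x y
  simp only [← Finset.mul_sum, h.sum_pow, mul_one] at h1
  exact h1.unique (hasSum_poisson t)

lemma sum_stat_mul_H (t : ℝ) (y : C.X) : ∑ x, C.stat x * C.H t x y = C.stat y := by
  classical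
  have h1 := hasSum_sum fun x (_ : x ∈ Finset.univ) =>
    (hasSum_H (C := C) t x y).mul_left (C.stat x)
  simp only [mul_left_comm (C.stat _), ← Finset.mul_sum, h.sum_stat_mul_pow] at h1
  have h2 := (hasSum_poisson t).mul_right (C.stat y)
  rw [one_mul] at h2
  exact h1.unique h2

omit [Fintype C.X] in
lemma hasLaws [Finite C.X] : C.HasLaws := by
  have := Fintype.ofFinite C.X
  exact ⟨inferInstance, fun t ht => h.H_nonneg ht, fun t _ x => by rw [tsum_fintype, h.sum_H],
    h.stat_nonneg, h.stat_sum.tsum_eq⟩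

lemma H_pos {t : ℝ} (ht : 0 < t) (x y : C.X) : 0 < C.H t x y := by
  classical
  obtain ⟨m, hm⟩ := h.irreducible x y
  refine lt_of_lt_of_le ?_ ((hasSum_H t x y).summable.le_tsum m fun k _ =>
    mul_nonneg (by positivity) (h.pow_nonneg k x y))
  positivity

/-- In π(z) = ∑ π(x) K^m(x,z), the terms with x ≠ z contribute at most 1 - π(z). Hence π(z)(1 -
K^m(z,z)) ≤ 1 - π(z) ≤ δ, and π(z) ≥ 1/2. -/
lemma one_sub_pow_self_le (m : ℕ) {z : C.X} {δ : ℝ} (hδ : δ ≤ 1 / 2) (hz : 1 - δ ≤ C.stat z) :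
    1 - C.pow m z z ≤ 2 * δ := by
  classical
  have h1 := h.sum_stat_mul_pow m z
  have h2 := h.sum_stat
  rw [← Finset.add_sum_erase _ _ (Finset.mem_univ z)] at h1 h2
  have h3 : ∑ x ∈ Finset.univ.erase z, C.stat x * C.pow m x z
      ≤ ∑ x ∈ Finset.univ.erase z, C.stat x :=
    Finset.sum_le_sum fun x _ => mul_le_of_le_one_right (h.stat_nonneg x) (h.pow_le_one m x z)
  have h4 := h.pow_le_one m z z
  have h5 := h.stat_le_one z
  nlinarith

/-- Doeblin contraction of the total variation distance. -/
lemma tv_add_le {s t η : ℝ} (z x : C.X) (hs : 0 ≤ s)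
    (hη : ∀ w, 1 - η ≤ C.H s w z) : C.tv (t + s) x ≤ η * C.tv t x := by
  classical
  rw [tv, tv, tsum_fintype, tsum_fintype]
  -- The signed measure H_t(x,·) - π has total mass zero, so subtracting from H_s(w,y) a quantity
  -- independent of w changes nothing. Removing the common mass 1 - η at z leaves nonnegative rows
  -- of mass η.
  have hd : ∀ y, C.H (t + s) x y - C.stat y = ∑ w, (C.H t x w - C.stat w) *
      (C.H s w y - if y = z then 1 - η else 0) := by
    intro y
    simp only [mul_sub, sub_mul, Finset.sum_sub_distrib]
    rw [H_add, h.sum_stat_mul_H, ← Finset.sum_mul, ← Finset.sum_mul, h.sum_H, h.sum_stat]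
    ring
  have hw : ∀ w y, 0 ≤ C.H s w y - if y = z then 1 - η else 0 := by
    intro w y
    split_ifs with hy
    · rw [hy]; linarith [hη w]
    · linarith [h.H_nonneg hs w y]
  have h1 : ∑ y, |C.H (t + s) x y - C.stat y| ≤ ∑ y, ∑ w, |C.H t x w - C.stat w| *
      (C.H s w y - if y = z then 1 - η else 0) := by
    refine Finset.sum_le_sum fun y _ => ?_
    rw [hd]
    refine (Finset.abs_sum_le_sum_abs _ _).trans (Finset.sum_le_sum fun w _ => ?_)
    rw [abs_mul, abs_of_nonneg (hw w y)]
  rw [Finset.sum_comm] at h1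
  simp only [← Finset.mul_sum, Finset.sum_sub_distrib, h.sum_H, Finset.sum_ite_eq',
    Finset.mem_univ, if_true, sub_sub_cancel, ← Finset.sum_mul] at h1
  linarith

lemma tv_antitone {s t : ℝ} (hst : s ≤ t) (x : C.X) : C.tv t x ≤ C.tv s x := by
  have := h.tv_add_le (η := 1) (t := s) x x (sub_nonneg.2 hst)
    fun w => by simpa using h.H_nonneg (sub_nonneg.2 hst) w x
  simpa using this

lemma tv_le_one {t : ℝ} (ht : 0 ≤ t) (x : C.X) : C.tv t x ≤ 1 :=
  (h.hasLaws.tv_le_sqrt ht x).trans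
    (Real.sqrt_le_iff.2 ⟨zero_le_one, by nlinarith [HasLaws.aff_nonneg C t x]⟩)

lemma tv_add_mul_le {s t η : ℝ} (z x : C.X) (hs : 0 ≤ s) (hη0 : 0 ≤ η)
    (hη : ∀ w, 1 - η ≤ C.H s w z) (k : ℕ) : C.tv (t + k * s) x ≤ η ^ k * C.tv t x := by
  induction k with
  | zero => simp
  | succ k ih =>
    have h1 := h.tv_add_le (t := t + k * s) z x hs hη
    rw [Nat.cast_succ, add_one_mul, ← add_assoc, pow_succ']
    refine h1.trans ?_
    rw [mul_assoc]
    exact mul_le_mul_of_nonneg_left ih hη0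

/-- H_1 has positive entries, so the least entry of one column is a Doeblin constant. No rate is
needed: this serves the finitely many chains in the first rows of the triangular array. -/
lemma exists_tv_le {ε : ℝ} (hε : 0 < ε) : ∃ T, 0 ≤ T ∧ ∀ t, T ≤ t → ∀ x, C.tv t x ≤ ε := by
  have := h.nonempty
  obtain ⟨z⟩ := h.nonempty
  obtain ⟨w, hw⟩ := Finite.exists_min fun w => C.H 1 w z
  have hpos := h.H_pos one_pos w z
  have hle : C.H 1 w z ≤ 1 := (Finset.single_le_sum
    (fun y _ => h.H_nonneg zero_le_one w y) (Finset.mem_univ z)).trans_eq (h.sum_H 1 w)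
  obtain ⟨k, hk⟩ := exists_pow_lt_of_lt_one hε (show 1 - C.H 1 w z < 1 by linarith)
  refine ⟨k, by positivity, fun t ht x => (h.tv_antitone ht x).trans ?_⟩
  have h1 := h.tv_add_mul_le (t := 0) z x zero_le_one (η := 1 - C.H 1 w z) (by linarith)
    (fun v => by rw [sub_sub_cancel]; exact hw v) k
  rw [zero_add, mul_one] at h1
  have h2 := h.tv_le_one le_rfl x
  refine h1.trans ((mul_le_of_le_one_right ?_ h2).trans hk.le)
  exact _root_.pow_nonneg (by linarith) k

lemma tv_le_of_concentrated {t α β : ℝ} (ht : 0 ≤ t) (z x : C.X) (h1 : 1 - α ≤ C.H t x z)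
    (h2 : 1 - β ≤ C.stat z) : C.tv t x ≤ α + β := by
  classical
  rw [tv, tsum_fintype, ← Finset.add_sum_erase _ _ (Finset.mem_univ z)]
  have h3 : ∑ y ∈ Finset.univ.erase z, |C.H t x y - C.stat y|
      ≤ ∑ y ∈ Finset.univ.erase z, (C.H t x y + C.stat y) :=
    Finset.sum_le_sum fun y _ => abs_le.2
      ⟨by linarith [h.H_nonneg ht x y, h.stat_nonneg y],
        by linarith [h.H_nonneg ht x y, h.stat_nonneg y]⟩
  have h4 := h.sum_H t x
  have h5 := h.sum_stat
  rw [← Finset.add_sum_erase _ _ (Finset.mem_univ z)] at h4 h5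
  rw [Finset.sum_add_distrib] at h3
  have h6 : 0 ≤ ∑ y ∈ Finset.univ.erase z, C.H t x y :=
    Finset.sum_nonneg fun y _ => h.H_nonneg ht x y
  have h7 : 0 ≤ ∑ y ∈ Finset.univ.erase z, C.stat y :=
    Finset.sum_nonneg fun y _ => h.stat_nonneg y
  have h8 : |C.H t x z - C.stat z| ≤ α + β := abs_le.2 ⟨by linarith, by linarith⟩
  linarith

omit h in
lemma H_le_of_pow_le {t α ρ β γ : ℝ} (ht : 0 ≤ t) {x y : C.X}
    (hp : ∀ m, C.pow m x y ≤ α * ρ ^ m + β * m + γ) :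
    C.H t x y ≤ α * Real.exp (-t * (1 - ρ)) + β * t + γ := by
  classical
  exact hasSum_le (fun m => mul_le_mul_of_nonneg_left (hp m) (by positivity)) (hasSum_H t x y)
    (hasSum_poisson_affine t α ρ β γ)

omit h in
lemma one_sub_H_le_of_pow {t α ρ β γ : ℝ} (ht : 0 ≤ t) {x y : C.X}
    (hp : ∀ m, 1 - C.pow m x y ≤ α * ρ ^ m + β * m + γ) :
    1 - C.H t x y ≤ α * Real.exp (-t * (1 - ρ)) + β * t + γ := by
  classical
  have h1 := (hasSum_poisson t).sub (hasSum_H t x y)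
  refine hasSum_le (fun m => ?_) h1 (hasSum_poisson_affine t α ρ β γ)
  rw [← mul_one_sub]
  exact mul_le_mul_of_nonneg_left (hp m) (by positivity)

end IsIrreducibleMarkov
end Chain
end
end ProductCutoff

namespace ProductCutoff
noncomputable section

/-! ### Semigroup and affinity of a product chain. -/

section Product

variable {n : ℕ} {C : Fin n → Chain} {w : Fin n → ℝ}

instance prodChainFintype [∀ i, Fintype (C i).X] : Fintype (prodChain C w).X :=
  inferInstanceAs (Fintype (∀ i, (C i).X))

instance prodChainDecidableEq [∀ i, DecidableEq (C i).X] : DecidableEq (prodChain C w).X :=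
  inferInstanceAs (DecidableEq (∀ i, (C i).X))

lemma sum_prod_pi [∀ i, Fintype (C i).X] (f : ∀ i, (C i).X → ℝ) :
    ∑ x : (prodChain C w).X, ∏ i, f i (x i) = ∏ i, ∑ z, f i z := by
  classical
  rw [Finset.prod_univ_sum, Fintype.piFinset_univ]
  rfl

/-- The indicators kill every y that differs from x outside coordinate i, so only updates of x at i
survive. -/
lemma sum_prodChain_K [∀ i, Fintype (C i).X] (x : ∀ i, (C i).X) (G : (∀ i, (C i).X) → ℝ) :
    ∑ y : (prodChain C w).X, (prodChain C w).K x y * G y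
      = ∑ i, w i * ∑ z, (C i).K (x i) z * G (Function.update x i z) := by
  classical
  simp only [prodChain, Finset.sum_mul]
  rw [Finset.sum_comm]
  refine Finset.sum_congr rfl fun i _ => ?_
  rw [Finset.mul_sum]
  refine (Finset.sum_of_injOn (fun z => Function.update x i z)
    (Function.update_injective x i).injOn (fun _ _ => Finset.mem_univ _) ?_ ?_).symm
  · intro y _ hy
    have hne : ∃ j ∈ Finset.univ.erase i, x j ≠ y j := by
      by_contra! hall
      refine hy ⟨y i, Finset.mem_coe.2 (Finset.mem_univ _), ?_⟩
      funext j
      by_cases hj : j = i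
      · subst hj; simp
      · simp only [Function.update_of_ne hj]
        exact hall j (Finset.mem_erase.2 ⟨hj, Finset.mem_univ _⟩)
    obtain ⟨j, hj, hxy⟩ := hne
    rw [Finset.prod_eq_zero hj (if_neg hxy)]
    ring
  · intro z _
    rw [Finset.prod_eq_one]
    · simp only [Function.update_self]
      ring
    · intro j hj
      rw [if_pos]
      rw [Function.update_of_ne (Finset.ne_of_mem_erase hj)]

/-- The product of the factor semigroups solves the backward equation of the product chain, whose
solution is unique. -/
lemma H_prodChain [∀ i, Finite (C i).X] (hw : ∑ i, w i = 1) (t : ℝ) (x y : ∀ i, (C i).X) :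
    (prodChain C w).H t x y = ∏ i, (C i).H (w i * t) (x i) (y i) := by
  classical
  have := fun i => Fintype.ofFinite (C i).X
  symm
  refine Chain.eq_H_of_hasDerivAt (C := prodChain C w)
    (G := fun t x y => ∏ i, (C i).H (w i * t) (x i) (y i)) ?_ ?_ t x y
  · intro x y
    simp only [mul_zero, Chain.H_zero]
    split_ifs with hxy
    · exact Finset.prod_eq_one fun i _ => if_pos (congrFun hxy i)
    · obtain ⟨i, hi⟩ := Function.ne_iff.1 hxy
      exact Finset.prod_eq_zero (Finset.mem_univ i) (if_neg hi)
  · intro t (x : ∀ i, (C i).X) (y : ∀ i, (C i).X)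
    have hi : ∀ i ∈ Finset.univ, HasDerivAt (fun t => (C i).H (w i * t) (x i) (y i))
        ((∑ z, (C i).K (x i) z * (C i).H (w i * t) z (y i) - (C i).H (w i * t) (x i) (y i)) * w i)
        t := by
      intro i _
      have h1 : HasDerivAt (fun t => w i * t) (w i) t := by
        simpa using (hasDerivAt_id t).const_mul (w i)
      exact (Chain.hasDerivAt_H (C := C i) (w i * t) (x i) (y i)).comp t h1
    refine (HasDerivAt.fun_finsetProd hi).congr_deriv ?_
    have h2 := sum_prodChain_K (w := w) x (fun z => ∏ i, (C i).H (w i * t) (z i) (y i))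
    rw [h2]
    -- The weights sum to 1, so the loss term splits over the coordinates and the equation can be
    -- checked for each i separately.
    have h3 : ∏ i, (C i).H (w i * t) (x i) (y i)
        = ∑ i, w i * ∏ i, (C i).H (w i * t) (x i) (y i) := by
      rw [← Finset.sum_mul, hw, one_mul]
    rw [h3, ← Finset.sum_sub_distrib]
    refine Finset.sum_congr rfl fun i _ => ?_
    have h4 : ∀ z, ∏ j, (C j).H (w j * t) (Function.update x i z j) (y j)
        = (C i).H (w i * t) z (y i)
          * ∏ j ∈ Finset.univ.erase i, (C j).H (w j * t) (x j) (y j) := by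
      intro z
      rw [← Finset.mul_prod_erase _ _ (Finset.mem_univ i), Function.update_self]
      congr 1
      refine Finset.prod_congr rfl fun j hj => ?_
      rw [Function.update_of_ne (Finset.ne_of_mem_erase hj)]
    simp only [h4, ← mul_assoc, ← Finset.sum_mul]
    rw [← Finset.mul_prod_erase _ _ (Finset.mem_univ i), smul_eq_mul]
    ring

lemma hasLaws_prodChain (hC : ∀ i, (C i).HasLaws) (hw0 : ∀ i, 0 ≤ w i) (hw : ∑ i, w i = 1) :
    (prodChain C w).HasLaws := by
  have := fun i => (hC i).finite
  have := fun i => Fintype.ofFinite (C i).X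
  refine ⟨inferInstance, fun t ht x y => ?_, fun t ht x => ?_,
    fun x => ?_, ?_⟩
  · refine le_of_le_of_eq ?_ (H_prodChain hw t x y).symm
    exact Finset.prod_nonneg fun i _ => (hC i).H_nonneg _ (mul_nonneg (hw0 i) ht) _ _
  · rw [tsum_fintype]
    refine (Finset.sum_congr rfl fun y _ => H_prodChain hw t x y).trans ?_
    refine (sum_prod_pi (fun i z => (C i).H (w i * t) (x i) z)).trans ?_
    refine Finset.prod_eq_one fun i _ => ?_
    rw [← (hC i).H_sum _ (mul_nonneg (hw0 i) ht) (x i), tsum_fintype]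
  · change 0 ≤ ∏ i, (C i).stat (x i)
    exact Finset.prod_nonneg fun i _ => (hC i).stat_nonneg (x i)
  · rw [tsum_fintype]
    refine (sum_prod_pi (fun i => (C i).stat)).trans (Finset.prod_eq_one fun i _ => ?_)
    rw [← (hC i).stat_sum, tsum_fintype]

lemma aff_prodChain (hC : ∀ i, (C i).HasLaws) (hw0 : ∀ i, 0 ≤ w i) (hw : ∑ i, w i = 1) {t : ℝ}
    (ht : 0 ≤ t) (x : ∀ i, (C i).X) :
    (prodChain C w).aff t x = ∏ i, (C i).aff (w i * t) (x i) := by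
  have := fun i => (hC i).finite
  have := fun i => Fintype.ofFinite (C i).X
  simp only [Chain.aff, tsum_fintype]
  rw [← sum_prod_pi (w := w) (fun i z => √((C i).H (w i * t) (x i) z) * √((C i).stat z))]
  refine Finset.sum_congr rfl fun y _ => ?_
  rw [Finset.prod_mul_distrib]
  refine congrArg₂ _ ?_ ?_
  · refine (congrArg Real.sqrt (H_prodChain hw t x y)).trans ?_
    exact Real.sqrt_prod _ fun i _ => (hC i).H_nonneg _ (mul_nonneg (hw0 i) ht) _ _
  · change √(∏ i, (C i).stat (y i)) = _
    exact Real.sqrt_prod _ fun i _ => (hC i).stat_nonneg _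

/-- The affinity is a product of nonnegative functions of separate coordinates, so it is minimised
coordinate by coordinate. -/
lemma minAff_prodChain (hC : ∀ i, (C i).HasLaws) (hw0 : ∀ i, 0 ≤ w i) (hw : ∑ i, w i = 1) {t : ℝ}
    (ht : 0 ≤ t) : (prodChain C w).minAff t = ∏ i, (C i).minAff (w i * t) := by
  have hP := hasLaws_prodChain hC hw0 hw
  apply le_antisymm
  · choose x hx using fun i => (hC i).exists_minAff_eq (w i * t)
    simp only [hx]
    rw [← aff_prodChain hC hw0 hw ht]
    exact hP.minAff_le t x
  · refine hP.le_minAff fun x => ?_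
    refine le_of_le_of_eq ?_ (aff_prodChain hC hw0 hw ht x).symm
    exact Finset.prod_le_prod (fun i _ => (hC i).minAff_nonneg _) fun i _ => (hC i).minAff_le _ _

end Product

section ProductFamily

variable {F : ℕ → Chain} {p : ℕ → ℝ}

lemma hasLaws_prodFamily (hF : ∀ k, (F k).HasLaws) (hp : ∀ k, 0 < p k) (n : ℕ) :
    (prodFamily F p n).HasLaws := by
  have hq : 0 < ∑ j ∈ Finset.range (n + 1), p j :=
    Finset.sum_pos (fun j _ => hp j) (by simp)
  refine hasLaws_prodChain (fun i => hF i) (fun i => (div_pos (hp i) hq).le) ?_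
  rw [← Finset.sum_div, Fin.sum_univ_eq_sum_range p, div_self hq.ne']

lemma minAff_prodFamily (hF : ∀ k, (F k).HasLaws) (hp : ∀ k, 0 < p k) (n : ℕ) {t : ℝ}
    (ht : 0 ≤ t) : (prodFamily F p n).minAff t
      = ∏ k ∈ Finset.range (n + 1),
        (F k).minAff (p k * (t / ∑ j ∈ Finset.range (n + 1), p j)) := by
  have hq : 0 < ∑ j ∈ Finset.range (n + 1), p j :=
    Finset.sum_pos (fun j _ => hp j) (by simp)
  rw [prodFamily, minAff_prodChain (fun i => hF i) (fun i => (div_pos (hp i) hq).le) _ ht,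
    ← Fin.prod_univ_eq_prod_range]
  · refine Finset.prod_congr rfl fun i _ => ?_
    rw [div_mul_eq_mul_div, mul_div_assoc]
  · rw [← Finset.sum_div, Fin.sum_univ_eq_sum_range p, div_self hq.ne']

lemma one_sub_sum_le_prod {ι : Type*} (s : Finset ι) (f g : ι → ℝ) (hf0 : ∀ i ∈ s, 0 ≤ f i)
    (hf1 : ∀ i ∈ s, f i ≤ 1) (hg : ∀ i ∈ s, 1 - g i ≤ f i) :
    1 - ∑ i ∈ s, g i ≤ ∏ i ∈ s, f i := by
  classical
  induction s using Finset.induction_on with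
  | empty => simp
  | insert a s ha ih =>
    rw [Finset.prod_insert ha, Finset.sum_insert ha]
    have h1 := ih (fun i hi => hf0 i (by simp [hi])) (fun i hi => hf1 i (by simp [hi]))
      (fun i hi => hg i (by simp [hi]))
    have h2 : ∏ i ∈ s, f i ≤ 1 := Finset.prod_le_one (fun i hi => hf0 i (by simp [hi]))
      fun i hi => hf1 i (by simp [hi])
    have h3 := hf1 a (by simp)
    have h4 := hg a (by simp)
    have h5 : 0 ≤ ∏ i ∈ s, f i := Finset.prod_nonneg fun i hi => hf0 i (by simp [hi])
    nlinarith [mul_nonneg (sub_nonneg.2 h3) (sub_nonneg.2 h2)]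

end ProductFamily

end
end ProductCutoff

namespace ProductCutoff
noncomputable section

/-! ### Irreducibility and reversibility of the concrete chains. -/

section NearestNeighbour

lemma sum_ite_val {N c : ℕ} {P : Prop} [Decidable P] {Q : Fin N → Prop} [DecidablePred Q] (A : ℝ)
    (g : ℕ → ℝ) (hQ : ∀ k, Q k ↔ P ∧ (k : ℕ) = c) (hc : P → c < N) :
    ∑ k : Fin N, (if Q k then A else 0) * g k = if P then A * g c else 0 := by
  split_ifs with hP
  · rw [Finset.sum_eq_single ⟨c, hc hP⟩]
    · rw [if_pos ((hQ _).2 ⟨hP, rfl⟩)]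
    · intro k _ hk
      rw [if_neg, zero_mul]
      exact fun h => hk (Fin.ext ((hQ k).1 h).2)
    · simp
  · refine Finset.sum_eq_zero fun k _ => ?_
    rw [if_neg (fun h => hP ((hQ k).1 h).1), zero_mul]

variable {N : ℕ} {K : Fin (N + 1) → Fin (N + 1) → ℝ} {π : Fin (N + 1) → ℝ}

lemma exists_pow_pos_of_neighbours (hK : ∀ x y, 0 ≤ K x y)
    (hup : ∀ x y : Fin (N + 1), (y : ℕ) = x + 1 → 0 < K x y)
    (hdown : ∀ x y : Fin (N + 1), (x : ℕ) = y + 1 → 0 < K x y) (x y : Fin (N + 1)) :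
    ∃ m, 0 < (Chain.mk (Fin (N + 1)) K π).pow m x y := by
  have hnn : ∀ m x y, 0 ≤ (Chain.mk (Fin (N + 1)) K π).pow m x y := by
    intro m
    induction m with
    | zero => intro x y; rw [Chain.pow]; positivity
    | succ m ih => exact fun x y => tsum_nonneg fun z => mul_nonneg (hK x z) (ih z y)
  have hstep : ∀ m (x z y : Fin (N + 1)), 0 < K x z →
      0 < (Chain.mk (Fin (N + 1)) K π).pow m z y →
      0 < (Chain.mk (Fin (N + 1)) K π).pow (m + 1) x y := by
    intro m x z y h1 h2
    have h3 : (Chain.mk (Fin (N + 1)) K π).pow (m + 1) x y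
        = ∑ w, K x w * (Chain.mk (Fin (N + 1)) K π).pow m w y := tsum_fintype _
    rw [h3]
    exact lt_of_lt_of_le (mul_pos h1 h2) (Finset.single_le_sum
      (f := fun w => K x w * (Chain.mk (Fin (N + 1)) K π).pow m w y)
      (fun w _ => mul_nonneg (hK x w) (hnn m w y)) (Finset.mem_univ z))
  have hrefl : ∀ x, 0 < (Chain.mk (Fin (N + 1)) K π).pow 0 x x := fun x => by simp [Chain.pow]
  rcases le_total (x : ℕ) y with hxy | hxy
  · obtain ⟨d, hd⟩ := Nat.exists_eq_add_of_le hxy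
    clear hxy
    induction d generalizing x with
    | zero =>
      obtain rfl : x = y := Fin.ext (by omega)
      exact ⟨0, hrefl x⟩
    | succ d ih =>
      obtain ⟨m, hm⟩ := ih ⟨x + 1, by omega⟩ (by simp only; omega)
      exact ⟨m + 1, hstep m x _ y (hup _ _ rfl) hm⟩
  · obtain ⟨d, hd⟩ := Nat.exists_eq_add_of_le hxy
    clear hxy
    induction d generalizing x with
    | zero =>
      obtain rfl : x = y := Fin.ext (by omega)
      exact ⟨0, hrefl x⟩
    | succ d ih =>
      obtain ⟨m, hm⟩ := ih ⟨x - 1, by omega⟩ (by simp only; omega)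
      exact ⟨m + 1, hstep m x _ y (hdown _ _ (by simp only; omega)) hm⟩

lemma isIrreducibleMarkov_of_reversible (hK : ∀ x y, 0 ≤ K x y) (hK1 : ∀ x, ∑ y, K x y = 1)
    (hup : ∀ x y : Fin (N + 1), (y : ℕ) = x + 1 → 0 < K x y)
    (hdown : ∀ x y : Fin (N + 1), (x : ℕ) = y + 1 → 0 < K x y) (hπ : ∀ x, 0 ≤ π x)
    (hπ1 : ∑ x, π x = 1) (hrev : ∀ x y, π x * K x y = π y * K y x) :
    (Chain.mk (Fin (N + 1)) K π).IsIrreducibleMarkov where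
  countable := inferInstanceAs (Countable (Fin (N + 1)))
  K_nonneg := hK
  K_sum x := hK1 x ▸ hasSum_fintype (K x)
  irreducible := exists_pow_pos_of_neighbours hK hup hdown
  stat_nonneg := hπ
  stat_sum := hπ1 ▸ hasSum_fintype π
  stationary y := by
    have h : ∑ x, π x * K x y = π y := by
      rw [Finset.sum_congr rfl fun x _ => hrev x y, ← Finset.mul_sum, hK1, mul_one]
    change HasSum (fun x => π x * K x y) (π y)
    rw [← h]
    exact hasSum_fintype _

end NearestNeighbour

section Ehrenfest

variable {n : ℕ}

/-- At the two ends the value of `g` outside the state space (or at the truncated `0 - 1`) has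
coefficient zero, so no case distinction is needed. -/
lemma sum_ehrenfest_K (j : Fin (n + 1)) (g : ℕ → ℝ) :
    ∑ k : Fin (n + 1), (ehrenfest n).K j k * g k
      = ((n : ℝ) - (j : ℕ)) / n * g (j + 1) + ((j : ℕ) : ℝ) / n * g (j - 1) := by
  simp only [ehrenfest, add_mul, Finset.sum_add_distrib]
  have h1 := sum_ite_val (N := n + 1) (c := j + 1) (P := (j : ℕ) < n)
    (Q := fun k => (k : ℕ) = j + 1) (((n : ℝ) - (j : ℕ)) / n) g
    (fun k => ⟨fun h => ⟨by omega, h⟩, fun h => h.2⟩) (by omega)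
  have h2 := sum_ite_val (N := n + 1) (c := j - 1) (P := 0 < (j : ℕ))
    (Q := fun k => (j : ℕ) = k + 1) (((j : ℕ) : ℝ) / n) g
    (fun k => ⟨fun h => ⟨by omega, by omega⟩, fun h => by omega⟩) (by omega)
  refine congrArg₂ (· + ·) (h1.trans ?_) (h2.trans ?_)
  · split_ifs with h
    · rfl
    · have : (j : ℕ) = n := by omega
      rw [this]; simp
  · split_ifs with h
    · rfl
    · have : (j : ℕ) = 0 := by omega
      rw [this]; simp

lemma ehrenfest_isIrreducibleMarkov (hn : 1 ≤ n) : (ehrenfest n).IsIrreducibleMarkov := by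
  have hn' : (0 : ℝ) < n := by exact_mod_cast hn
  have hle : ∀ j : Fin (n + 1), ((j : ℕ) : ℝ) ≤ n := fun j => by
    exact_mod_cast Nat.lt_succ_iff.1 j.2
  have hnn : ∀ x y, 0 ≤ (ehrenfest n).K x y := fun x y =>
    add_nonneg (ite_nonneg (div_nonneg (sub_nonneg.2 (hle x)) hn'.le) le_rfl)
      (ite_nonneg (by positivity) le_rfl)
  refine isIrreducibleMarkov_of_reversible hnn ?_ ?_ ?_ ?_ ?_ ?_
  · intro x
    have h := sum_ehrenfest_K x fun _ => 1
    simp only [mul_one] at h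
    refine h.trans ?_
    field_simp
    ring
  · intro x y hxy
    simp only [if_pos hxy]
    refine add_pos_of_pos_of_nonneg (div_pos (sub_pos.2 ?_) hn') (ite_nonneg (by positivity) le_rfl)
    exact_mod_cast (show (x : ℕ) < n by omega)
  · intro x y hxy
    simp only [if_pos hxy]
    refine add_pos_of_nonneg_of_pos
      (ite_nonneg (div_nonneg (sub_nonneg.2 (hle x)) hn'.le) le_rfl) (div_pos ?_ hn')
    exact_mod_cast (show 0 < (x : ℕ) by omega)
  · intro x
    positivity
  · rw [← Finset.sum_div, Fin.sum_univ_eq_sum_range (fun j => (n.choose j : ℝ)) (n + 1)]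
    have := Nat.sum_range_choose n
    rw [div_eq_one_iff_eq (by positivity)]
    exact_mod_cast this
  · have key : ∀ j : ℕ, j < n →
        (n.choose j : ℝ) / 2 ^ n * (((n : ℝ) - j) / n)
          = (n.choose (j + 1) : ℝ) / 2 ^ n * (((j + 1 : ℕ) : ℝ) / n) := by
      intro j hj
      have h := Nat.choose_succ_right_eq n j
      have h' : (n.choose (j + 1) : ℝ) * ((j + 1 : ℕ) : ℝ) = n.choose j * ((n : ℝ) - j) := by
        rw [← Nat.cast_sub hj.le]
        exact_mod_cast h
      field_simp
      linarith
    intro x y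
    by_cases h1 : (y : ℕ) = x + 1
    · have h2 : ¬ (x : ℕ) = y + 1 := by omega
      simp only [h1, if_true, if_neg (show ¬ (x : ℕ) = x + 1 + 1 by omega), add_zero, zero_add]
      exact key x (by omega)
    · by_cases h2 : (x : ℕ) = y + 1
      · simp only [h2, if_true, if_neg (show ¬ (y : ℕ) = y + 1 + 1 by omega), add_zero, zero_add]
        exact (key y (by omega)).symm
      · simp only [if_neg h1, if_neg h2, add_zero, mul_zero]

end Ehrenfest

section Path

variable {n : ℕ}

lemma sum_lazyPath_K (j : Fin (n + 1)) (g : ℕ → ℝ) :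
    ∑ k : Fin (n + 1), (lazyPath n).K j k * g k
      = 1 / 2 * (if (j : ℕ) < n then g (j + 1) else g n)
        + 1 / 2 * (if 0 < (j : ℕ) then g (j - 1) else g 0) := by
  simp only [lazyPath, add_mul, Finset.sum_add_distrib]
  have h1 := sum_ite_val (N := n + 1) (c := j + 1) (P := (j : ℕ) < n)
    (Q := fun k => (k : ℕ) = j + 1) (1 / 2) g
    (fun k => ⟨fun h => ⟨by omega, h⟩, fun h => h.2⟩) (by omega)
  have h2 := sum_ite_val (N := n + 1) (c := j - 1) (P := 0 < (j : ℕ))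
    (Q := fun k => (j : ℕ) = k + 1) (1 / 2) g
    (fun k => ⟨fun h => ⟨by omega, by omega⟩, fun h => by omega⟩) (by omega)
  have h3 := sum_ite_val (N := n + 1) (c := 0) (P := (j : ℕ) = 0)
    (Q := fun k => (j : ℕ) = 0 ∧ (k : ℕ) = 0) (1 / 2) g (fun k => Iff.rfl) (by omega)
  have h4 := sum_ite_val (N := n + 1) (c := n) (P := (j : ℕ) = n)
    (Q := fun k => (j : ℕ) = n ∧ (k : ℕ) = n) (1 / 2) g (fun k => Iff.rfl) (by omega)
  refine (congrArg₂ (· + ·) (congrArg₂ (· + ·) (congrArg₂ (· + ·) h1 h2) h3) h4).trans ?_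
  have := j.2
  split_ifs <;> first | omega | ring

lemma lazyPath_isIrreducibleMarkov (n : ℕ) : (lazyPath n).IsIrreducibleMarkov := by
  have hnn : ∀ x y, 0 ≤ (lazyPath n).K x y := fun x y => by
    simp only [lazyPath]
    positivity
  refine isIrreducibleMarkov_of_reversible hnn ?_ ?_ ?_ ?_ ?_ ?_
  · intro x
    have h := sum_lazyPath_K x fun _ => 1
    simp only [mul_one] at h
    refine h.trans ?_
    norm_num
  · intro x y hxy
    simp only [if_pos hxy]
    positivity
  · intro x y hxy
    simp only [if_pos hxy]
    positivity
  · intro x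
    positivity
  · simp only [Finset.sum_const, Finset.card_univ, Fintype.card_fin, nsmul_eq_mul]
    push_cast
    field_simp
  · intro x y
    congr 1
    simp only [and_comm]
    ring

end Path

section Lacoin

variable {n : ℕ} {a b : ℝ}

lemma sum_lacoin_K (hn : 1 ≤ n) (j : Fin (2 * n + 1)) (g : ℕ → ℝ) :
    ∑ k : Fin (2 * n + 1), (lacoin n a b).K j k * g k
      = (if (j : ℕ) ≠ n ∧ (j : ℕ) ≠ 2 * n then (1 - a) * g (j + 1) else 0)
      + (if 0 < (j : ℕ) then a * g (j - 1) else 0)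
      + (if (j : ℕ) = 0 then a * g 0 else 0)
      + (if (j : ℕ) = n then b * g (n + 1) else 0)
      + (if (j : ℕ) = n then (1 - a - b) * g (2 * n) else 0)
      + (if (j : ℕ) = 2 * n then lacoinC n a b * g n else 0)
      + (if (j : ℕ) = 2 * n then (1 - a - lacoinC n a b) * g (2 * n) else 0) := by
  simp only [lacoin, add_mul, Finset.sum_add_distrib]
  refine congrArg₂ (· + ·) (congrArg₂ (· + ·) (congrArg₂ (· + ·) (congrArg₂ (· + ·)
    (congrArg₂ (· + ·) (congrArg₂ (· + ·) ?_ ?_) ?_) ?_) ?_) ?_) ?_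
  · exact sum_ite_val (N := 2 * n + 1) (1 - a) g (fun k => and_assoc.symm) (by omega)
  · exact sum_ite_val (N := 2 * n + 1) a g
      (fun k => ⟨fun h => ⟨by omega, by omega⟩, fun h => by omega⟩) (by omega)
  all_goals exact sum_ite_val (N := 2 * n + 1) _ g (fun k => Iff.rfl) (by omega)

/-- The conditions on the parameters of a Lacoin chain. -/
structure LacoinParams (a b : ℝ) : Prop where
  a_pos : 0 < a
  a_lt_b : a < b
  add_lt : a + b < 1 / 2

namespace LacoinParams

variable (h : LacoinParams a b)
include h

lemma b_pos : 0 < b := h.a_pos.trans h.a_lt_b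

lemma a_lt_quarter : a < 1 / 4 := by linarith [h.a_lt_b, h.add_lt]

lemma lacoinC_nonneg (n : ℕ) : 0 ≤ lacoinC n a b := by
  have h1 := h.a_pos
  have h2 := h.b_pos
  have h3 := h.add_lt
  have h4 : 0 ≤ 1 - a := by linarith
  have h5 : 0 ≤ 1 - a - b := by linarith
  rw [lacoinC]
  positivity

lemma lacoinC_le (hn : 1 ≤ n) : lacoinC n a b ≤ 1 - a := by
  have h1 := h.a_pos
  have h2 := h.b_pos
  have h3 := h.add_lt
  have h4 := h.a_lt_b
  have h5 : 0 < 1 - a := by linarith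
  rw [lacoinC, div_le_iff₀ (by positivity)]
  obtain ⟨m, rfl⟩ := Nat.exists_eq_add_of_le' hn
  rw [Nat.add_sub_cancel, pow_succ']
  -- Since a < 1/2, a ^ m ≤ (1 - a) ^ m; the remaining factor a is absorbed by a < b.
  have h6 : a ^ m ≤ (1 - a) ^ m := pow_le_pow_left₀ h1.le (by linarith) m
  calc (1 - a - b) * (a * a ^ m) ≤ (1 - a) * (b * (1 - a) ^ m) := by
        gcongr
        linarith
    _ = _ := by ring

lemma lacoinWeight_pos (n j : ℕ) : 0 < lacoinWeight n a b j := by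
  have h1 := h.a_pos
  have h2 := h.b_pos
  have h3 : 0 < 1 - a := by linarith [h.add_lt]
  rw [lacoinWeight]
  split_ifs <;> positivity

lemma lacoinWeight_succ {j : ℕ} (hj : j ≠ n) :
    lacoinWeight n a b (j + 1) * a = lacoinWeight n a b j * (1 - a) := by
  have h1 := h.a_pos
  rw [lacoinWeight, lacoinWeight]
  rcases lt_or_gt_of_ne hj with h2 | h2
  · rw [if_pos (by omega), if_pos (by omega), pow_succ]
    field_simp
  · rw [if_neg (by omega), if_neg (by omega)]
    obtain ⟨i, rfl⟩ := Nat.exists_eq_add_of_lt h2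
    simp only [Nat.add_sub_cancel]
    field_simp
    ring

lemma lacoinWeight_succ_mid :
    lacoinWeight n a b (n + 1) * a = lacoinWeight n a b n * b := by
  have h1 := h.a_pos
  rw [lacoinWeight, lacoinWeight, if_neg (by omega), if_pos le_rfl, Nat.add_sub_cancel, div_pow]
  field_simp
  ring

lemma lacoinWeight_last (hn : 1 ≤ n) :
    lacoinWeight n a b (2 * n) * lacoinC n a b = lacoinWeight n a b n * (1 - a - b) := by
  have h1 := h.a_pos
  have h2 := h.b_pos
  have h3 : 0 < 1 - a := by linarith [h.add_lt]
  obtain ⟨m, rfl⟩ := Nat.exists_eq_add_of_le' hn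
  rw [lacoinWeight, lacoinWeight, lacoinC, if_neg (by omega), if_pos le_rfl, div_pow,
    Nat.add_sub_cancel, show 2 * (m + 1) - 1 = m + (m + 1) by omega,
    show 2 * (m + 1) = (m + 1) + (m + 1) by omega, pow_add, pow_add]
  field_simp
  ring

lemma detailed_balance (hn : 1 ≤ n) (j k : Fin (2 * n + 1)) :
    lacoinWeight n a b j * (lacoin n a b).K j k = lacoinWeight n a b k * (lacoin n a b).K k j := by
  wlog hjk : (j : ℕ) ≤ k generalizing j k
  · exact (this k j (by omega)).symm
  rcases hjk.eq_or_lt with hjk | hjk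
  · obtain rfl := Fin.ext hjk
    rfl
  have hk := k.2
  -- For j < k there are three kinds of edges, and balance is checked for each kind separately. For
  -- n = 1 the edges to n + 1 and to 2n coincide, and the separate summands take care of this case
  -- as well.
  have e1 : (lacoin n a b).K j k = (if (j : ℕ) ≠ n ∧ (k : ℕ) = j + 1 then 1 - a else 0)
      + (if (j : ℕ) = n ∧ (k : ℕ) = n + 1 then b else 0)
      + (if (j : ℕ) = n ∧ (k : ℕ) = 2 * n then 1 - a - b else 0) := by
    simp only [lacoin]
    rw [if_neg (show ¬ (j : ℕ) = k + 1 by omega), if_neg (show ¬ ((j : ℕ) = 0 ∧ (k : ℕ) = 0) by omega),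
      if_neg (show ¬ ((j : ℕ) = 2 * n ∧ (k : ℕ) = n) by omega),
      if_neg (show ¬ ((j : ℕ) = 2 * n ∧ (k : ℕ) = 2 * n) by omega)]
    have : ((j : ℕ) ≠ n ∧ (j : ℕ) ≠ 2 * n ∧ (k : ℕ) = j + 1) ↔ ((j : ℕ) ≠ n ∧ (k : ℕ) = j + 1) := by
      omega
    simp only [this]
    ring
  have e2 : (lacoin n a b).K k j = (if (j : ℕ) ≠ n ∧ (k : ℕ) = j + 1 then a else 0)
      + (if (j : ℕ) = n ∧ (k : ℕ) = n + 1 then a else 0)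
      + (if (j : ℕ) = n ∧ (k : ℕ) = 2 * n then lacoinC n a b else 0) := by
    simp only [lacoin]
    rw [if_neg (show ¬ ((k : ℕ) ≠ n ∧ (k : ℕ) ≠ 2 * n ∧ (j : ℕ) = k + 1) by omega),
      if_neg (show ¬ ((k : ℕ) = 0 ∧ (j : ℕ) = 0) by omega),
      if_neg (show ¬ ((k : ℕ) = n ∧ (j : ℕ) = n + 1) by omega),
      if_neg (show ¬ ((k : ℕ) = n ∧ (j : ℕ) = 2 * n) by omega),
      if_neg (show ¬ ((k : ℕ) = 2 * n ∧ (j : ℕ) = 2 * n) by omega)]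
    simp only [and_comm (a := (k : ℕ) = 2 * n)]
    by_cases hj : (j : ℕ) = n
    · simp [hj]
    · simp [hj]
  rw [e1, e2]
  simp only [mul_add, mul_ite, mul_zero]
  refine congrArg₂ (· + ·) (congrArg₂ (· + ·) ?_ ?_) ?_
  · split_ifs with hc
    · rw [hc.2, h.lacoinWeight_succ hc.1]
    · rfl
  · split_ifs with hc
    · rw [hc.2, hc.1, h.lacoinWeight_succ_mid]
    · rfl
  · split_ifs with hc
    · rw [hc.2, hc.1, h.lacoinWeight_last hn]
    · rfl

lemma isIrreducibleMarkov (hn : 1 ≤ n) : (lacoin n a b).IsIrreducibleMarkov := by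
  have h1 := h.a_pos
  have h2 := h.b_pos
  have h3 : 0 < 1 - a := by linarith [h.add_lt]
  have h4 : 0 < 1 - a - b := by linarith [h.add_lt]
  have h5 := h.lacoinC_nonneg n
  have h6 : 0 ≤ 1 - a - lacoinC n a b := by linarith [h.lacoinC_le hn]
  have hW : 0 < ∑ i ∈ Finset.range (2 * n + 1), lacoinWeight n a b i :=
    Finset.sum_pos (fun j _ => h.lacoinWeight_pos n j) (by simp)
  have hnn : ∀ x y, 0 ≤ (lacoin n a b).K x y := fun x y => by
    simp only [lacoin]
    positivity
  refine isIrreducibleMarkov_of_reversible hnn ?_ ?_ ?_ ?_ ?_ ?_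
  · intro x
    have hs := sum_lacoin_K (a := a) (b := b) hn x fun _ => 1
    simp only [mul_one] at hs
    refine hs.trans ?_
    split_ifs <;> first | omega | ring
  · intro x y hxy
    by_cases hx : (x : ℕ) = n
    · simp only [if_pos (show (x : ℕ) = n ∧ (y : ℕ) = n + 1 by omega)]
      positivity
    · simp only [if_pos (show (x : ℕ) ≠ n ∧ (x : ℕ) ≠ 2 * n ∧ (y : ℕ) = x + 1 by omega)]
      positivity
  · intro x y hxy
    simp only [if_pos hxy]
    positivity
  · intro x
    exact div_nonneg (h.lacoinWeight_pos n x).le hW.le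
  · rw [← Finset.sum_div, Fin.sum_univ_eq_sum_range (lacoinWeight n a b) (2 * n + 1),
      div_self hW.ne']
  · intro x y
    have := h.detailed_balance hn x y
    simp only [lacoin] at this
    rw [div_mul_eq_mul_div, this, div_mul_eq_mul_div]

end LacoinParams

end Lacoin

end
end ProductCutoff

namespace ProductCutoff
noncomputable section

/-! ### Projections of chains and their affinities. -/

section Lumping

variable {C D : Chain} [Fintype C.X] [Fintype D.X] {φ : C.X → D.X}

/-- The hypothesis says that K sends functions of φ to functions of φ and acts on them as the kernel
of D; this property is inherited by powers. -/
lemma sum_pow_lump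
    (hK : ∀ x (g : D.X → ℝ), ∑ y, C.K x y * g (φ y) = ∑ k, D.K (φ x) k * g k)
    (m : ℕ) (x : C.X) (g : D.X → ℝ) :
    ∑ y, C.pow m x y * g (φ y) = ∑ k, D.pow m (φ x) k * g k := by
  classical
  induction m generalizing x with
  | zero => simp [Chain.pow]
  | succ m ih =>
    calc ∑ y, C.pow (m + 1) x y * g (φ y)
        = ∑ z, C.K x z * ∑ y, C.pow m z y * g (φ y) := by
          simp only [Chain.IsIrreducibleMarkov.pow_succ_apply, Finset.sum_mul, Finset.mul_sum,
            mul_assoc]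
          exact Finset.sum_comm
      _ = ∑ j, D.K (φ x) j * ∑ k, D.pow m j k * g k := by
          simp only [ih]
          exact hK x fun j => ∑ k, D.pow m j k * g k
      _ = _ := by
          simp only [Chain.IsIrreducibleMarkov.pow_succ_apply, Finset.sum_mul, Finset.mul_sum,
            mul_assoc]
          exact Finset.sum_comm

lemma sum_H_lump
    (hK : ∀ x (g : D.X → ℝ), ∑ y, C.K x y * g (φ y) = ∑ k, D.K (φ x) k * g k)
    (t : ℝ) (x : C.X) (g : D.X → ℝ) :
    ∑ y, C.H t x y * g (φ y) = ∑ k, D.H t (φ x) k * g k := by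
  classical
  have h1 := hasSum_sum fun y (_ : y ∈ Finset.univ) =>
    (Chain.hasSum_H (C := C) t x y).mul_right (g (φ y))
  have h2 := hasSum_sum fun k (_ : k ∈ Finset.univ) =>
    (Chain.hasSum_H (C := D) t (φ x) k).mul_right (g k)
  simp only [mul_assoc, ← Finset.mul_sum, sum_pow_lump hK] at h1 h2
  exact h1.unique h2

variable [DecidableEq D.X]

lemma sum_H_fibre (hK : ∀ x (g : D.X → ℝ), ∑ y, C.K x y * g (φ y) = ∑ k, D.K (φ x) k * g k)
    (t : ℝ) (x : C.X) (k : D.X) : ∑ y with φ y = k, C.H t x y = D.H t (φ x) k := by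
  have h := sum_H_lump hK t x fun j => if j = k then 1 else 0
  simp only [mul_ite, mul_one, mul_zero] at h
  rw [Finset.sum_filter, h]
  simp

/-- The affinity does not decrease when a chain is lumped. -/
lemma aff_le_aff_lump
    (hK : ∀ x (g : D.X → ℝ), ∑ y, C.K x y * g (φ y) = ∑ k, D.K (φ x) k * g k)
    (hs : ∀ k, ∑ y with φ y = k, C.stat y = D.stat k) (hs0 : ∀ y, 0 ≤ C.stat y) {t : ℝ} {x : C.X}
    (hH : ∀ y, 0 ≤ C.H t x y) : C.aff t x ≤ D.aff t (φ x) := by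
  rw [Chain.aff, Chain.aff, tsum_fintype, tsum_fintype, ← Finset.sum_fiberwise Finset.univ φ]
  refine Finset.sum_le_sum fun k _ => ?_
  rw [← sum_H_fibre hK, ← hs]
  exact Real.sum_sqrt_mul_sqrt_le _ hH hs0

/-- Lumping loses affinity only through Cauchy–Schwarz on the fibres. If both laws are constant on a
fibre of N points, equality holds: N √H √π = √(N H) √(N π). -/
lemma aff_lump_eq_aff
    (hK : ∀ x (g : D.X → ℝ), ∑ y, C.K x y * g (φ y) = ∑ k, D.K (φ x) k * g k)
    (hs : ∀ k, ∑ y with φ y = k, C.stat y = D.stat k) {t : ℝ} {x : C.X}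
    (hH : ∀ y z, φ y = φ z → C.H t x y = C.H t x z)
    (hst : ∀ y z, φ y = φ z → C.stat y = C.stat z) : D.aff t (φ x) = C.aff t x := by
  rw [Chain.aff, Chain.aff, tsum_fintype, tsum_fintype, ← Finset.sum_fiberwise Finset.univ φ]
  refine Finset.sum_congr rfl fun k _ => ?_
  rw [← sum_H_fibre hK, ← hs]
  rcases (Finset.univ.filter fun y => φ y = k).eq_empty_or_nonempty with h0 | ⟨z, hz⟩
  · simp [h0]
  · have hz : φ z = k := (Finset.mem_filter.1 hz).2
    have h1 : ∀ y ∈ Finset.univ.filter (fun y => φ y = k), C.H t x y = C.H t x z :=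
      fun y hy => hH y z ((Finset.mem_filter.1 hy).2.trans hz.symm)
    have h2 : ∀ y ∈ Finset.univ.filter (fun y => φ y = k), C.stat y = C.stat z :=
      fun y hy => hst y z ((Finset.mem_filter.1 hy).2.trans hz.symm)
    have h3 : ∑ y with φ y = k, √(C.H t x y) * √(C.stat y)
        = ∑ y with φ y = k, √(C.H t x z) * √(C.stat z) :=
      Finset.sum_congr rfl fun y hy => by rw [h1 y hy, h2 y hy]
    rw [Finset.sum_congr rfl h1, Finset.sum_congr rfl h2, h3]
    simp only [Finset.sum_const, nsmul_eq_mul]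
    rw [Real.sqrt_mul (Nat.cast_nonneg _), Real.sqrt_mul (Nat.cast_nonneg _), mul_mul_mul_comm,
      Real.mul_self_sqrt (Nat.cast_nonneg _)]

end Lumping

/-! ### The two-point chain, the hypercube and the Ehrenfest chain. -/

section Flip

/-- The two-point chain that always changes its state. -/
def flip : Chain where
  X := Bool
  K := fun x y => if x = y then 0 else 1
  stat := fun _ => 1 / 2

instance flipFintype : Fintype flip.X := inferInstanceAs (Fintype Bool)

instance flipDecidableEq : DecidableEq flip.X := inferInstanceAs (DecidableEq Bool)

lemma sum_flip_K (x : Bool) (g : Bool → ℝ) : ∑ z : flip.X, flip.K x z * g z = g (!x) := by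
  change ∑ z : Bool, (if x = z then 0 else 1) * g z = g (!x)
  cases x <;> simp

/-- The eigenvalues are 1 and -1. The idle term `0 * m` gives the right side the shape required by
`hasSum_poisson_affine`. -/
lemma pow_flip (m : ℕ) (x y : Bool) :
    flip.pow m x y = (if x = y then 1 / 2 else -(1 / 2)) * (-1) ^ m + 0 * m + 1 / 2 := by
  induction m generalizing x with
  | zero =>
    have h : flip.pow 0 x y = if x = y then 1 else 0 := by
      simp only [Chain.pow]
      congr
    rw [h]
    split_ifs <;> norm_num
  | succ m ih =>
    have h : flip.pow (m + 1) x y = ∑ z : flip.X, flip.K x z * flip.pow m z y := tsum_fintype _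
    rw [h, sum_flip_K x fun z => flip.pow m z y, ih]
    cases x <;> cases y <;> simp [pow_succ]

lemma H_flip (t : ℝ) (x y : Bool) :
    flip.H t x y = (1 + (if x = y then 1 else -1) * Real.exp (-2 * t)) / 2 := by
  have h1 := Chain.hasSum_H (C := flip) t x y
  have h2 := hasSum_poisson_affine t (if x = y then 1 / 2 else -(1 / 2)) (-1) 0 (1 / 2)
  rw [h1.unique (hasSum_of_eq h2 (fun m => by rw [pow_flip]) rfl),
    show -t * (1 - -1) = -2 * t by ring]
  split_ifs <;> ring

lemma flip_hasLaws : flip.HasLaws := by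
  refine ⟨inferInstance, fun t ht x y => ?_, fun t ht x => ?_, fun x => ?_, ?_⟩
  · have h1 : Real.exp (-2 * t) ≤ 1 := Real.exp_le_one_iff.2 (by linarith)
    have h2 := Real.exp_pos (-2 * t)
    refine le_of_le_of_eq ?_ (H_flip t x y).symm
    split_ifs <;> linarith
  · rw [tsum_fintype]
    refine (Finset.sum_congr rfl fun y _ => H_flip t x y).trans ?_
    refine (Fintype.sum_bool _).trans ?_
    revert x
    intro (x : Bool)
    cases x <;> simp <;> ring
  · change (0 : ℝ) ≤ 1 / 2
    norm_num
  · rw [tsum_fintype]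
    change ∑ y : Bool, (1 / 2 : ℝ) = 1
    simp

/-- The Hellinger affinity at time `t` of the two-point chain. -/
def flipAff (t : ℝ) : ℝ :=
  √((1 + Real.exp (-2 * t)) / 2) * √(1 / 2) + √((1 - Real.exp (-2 * t)) / 2) * √(1 / 2)

lemma aff_flip (t : ℝ) (x : Bool) : flip.aff t x = flipAff t := by
  have h : flip.aff t x = ∑ y : Bool, √(flip.H t x y) * √(1 / 2) := tsum_fintype _
  rw [h, Fintype.sum_bool, H_flip, H_flip, flipAff]
  cases x
  · simp only [if_true, if_neg (show ¬ (false = true) by decide), one_mul, neg_one_mul,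
      ← sub_eq_add_neg]
    ring
  · simp only [if_true, if_neg (show ¬ (true = false) by decide), one_mul, neg_one_mul,
      ← sub_eq_add_neg]

lemma flipAff_nonneg (t : ℝ) : 0 ≤ flipAff t := by rw [flipAff]; positivity

lemma flipAff_le_one {t : ℝ} (ht : 0 ≤ t) : flipAff t ≤ 1 :=
  aff_flip t true ▸ flip_hasLaws.aff_le_one ht true

/-- With u = e^(-2t), this is (√(1+u) + √(1-u))² / 4 = (1 + √(1-u²)) / 2. -/
lemma flipAff_sq {t : ℝ} (ht : 0 ≤ t) :
    flipAff t ^ 2 = (1 + √(1 - Real.exp (-4 * t))) / 2 := by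
  have h1 : Real.exp (-2 * t) ≤ 1 := Real.exp_le_one_iff.2 (by linarith)
  have h2 := Real.exp_pos (-2 * t)
  have hu : Real.exp (-4 * t) = Real.exp (-2 * t) ^ 2 := by
    rw [← Real.exp_nat_mul]
    congr 1
    push_cast
    ring
  rw [flipAff, hu, ← add_mul, mul_pow, Real.sq_sqrt (by norm_num), add_sq,
    Real.sq_sqrt (by linarith), Real.sq_sqrt (by linarith), mul_assoc,
    ← Real.sqrt_mul (by linarith)]
  have h3 : (1 + Real.exp (-2 * t)) / 2 * ((1 - Real.exp (-2 * t)) / 2)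
      = (1 - Real.exp (-2 * t) ^ 2) / 2 ^ 2 := by ring
  rw [h3, Real.sqrt_div' _ (by norm_num), Real.sqrt_sq (by norm_num)]
  ring

lemma le_flipAff_sq {t : ℝ} (ht : 0 ≤ t) : 1 - Real.exp (-4 * t) / 2 ≤ flipAff t ^ 2 := by
  have h1 : Real.exp (-4 * t) ≤ 1 := Real.exp_le_one_iff.2 (by linarith)
  have h2 := Real.exp_pos (-4 * t)
  rw [flipAff_sq ht]
  have h3 : 1 - Real.exp (-4 * t) ≤ √(1 - Real.exp (-4 * t)) :=
    Real.le_sqrt_of_sq_le (by nlinarith)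
  linarith

lemma flipAff_sq_le {t : ℝ} (ht : 0 ≤ t) : flipAff t ^ 2 ≤ 1 - Real.exp (-4 * t) / 4 := by
  have h1 : Real.exp (-4 * t) ≤ 1 := Real.exp_le_one_iff.2 (by linarith)
  have h2 := Real.exp_pos (-4 * t)
  rw [flipAff_sq ht]
  have h3 : √(1 - Real.exp (-4 * t)) ≤ 1 - Real.exp (-4 * t) / 2 :=
    Real.sqrt_le_iff.2 ⟨by linarith, by nlinarith⟩
  linarith

end Flip

section Cube

variable {n : ℕ}

/-- Continuous time random walk on the hypercube. -/
def cube (n : ℕ) : Chain := prodChain (fun _ : Fin n => flip) fun _ => 1 / (n : ℝ)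

instance cubeFintype : Fintype (cube n).X := inferInstanceAs (Fintype (Fin n → Bool))

/-- The number of coordinates equal to `true`. -/
def trues (x : Fin n → Bool) : Fin (n + 1) :=
  ⟨(Finset.univ.filter fun i => x i = true).card,
    Nat.lt_succ_of_le ((Finset.card_le_univ _).trans_eq (Fintype.card_fin n))⟩

lemma trues_update_of_true {x : Fin n → Bool} {i : Fin n} (hi : x i = true) :
    (trues (Function.update x i false) : ℕ) = trues x - 1 := by
  have : (Finset.univ.filter fun j => Function.update x i false j = true)
      = (Finset.univ.filter fun j => x j = true).erase i := by
    ext j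
    by_cases hj : j = i
    · subst hj; simp
    · simp [hj]
  simp only [trues, this]
  exact Finset.card_erase_of_mem (by simp [hi])

lemma trues_update_of_false {x : Fin n → Bool} {i : Fin n} (hi : x i = false) :
    (trues (Function.update x i true) : ℕ) = trues x + 1 := by
  have : (Finset.univ.filter fun j => Function.update x i true j = true)
      = insert i (Finset.univ.filter fun j => x j = true) := by
    ext j
    by_cases hj : j = i
    · subst hj; simp
    · simp [hj]
  simp only [trues, this]
  exact Finset.card_insert_of_notMem (by simp [hi])

instance ehrenfestFintype : Fintype (ehrenfest n).X := inferInstanceAs (Fintype (Fin (n + 1)))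

instance ehrenfestDecidableEq : DecidableEq (ehrenfest n).X :=
  inferInstanceAs (DecidableEq (Fin (n + 1)))

lemma card_filter_not_true (x : Fin n → Bool) :
    (Finset.univ.filter fun i => ¬ x i = true).card = n - (trues x : ℕ) := by
  have h3 : (Finset.univ.filter fun i => x i = true).card = (trues x : ℕ) := rfl
  have := Finset.card_filter_add_card_filter_not (s := (Finset.univ : Finset (Fin n)))
    (fun i => x i = true)
  rw [Finset.card_univ, Fintype.card_fin] at this
  omega

/-- A uniformly chosen coordinate is flipped, so the number of `true` entries goes down with
probability proportional to that number and up otherwise: these are the Ehrenfest transitions. -/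
lemma sum_cube_K (x : Fin n → Bool) (g : ℕ → ℝ) :
    ∑ y : (cube n).X, (cube n).K x y * g (trues y)
      = ∑ k : Fin (n + 1), (ehrenfest n).K (trues x) k * g k := by
  rw [sum_ehrenfest_K]
  have h := sum_prodChain_K (C := fun _ : Fin n => flip) (w := fun _ => 1 / (n : ℝ)) x
    fun y => g (trues y)
  have h2 : ∀ i, ∑ z : flip.X, flip.K (x i) z * g (trues (Function.update x i z))
      = if x i = true then g (trues x - 1) else g (trues x + 1) := by
    intro i
    rw [sum_flip_K (x i) fun z => g (trues (Function.update x i z))]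
    cases hi : x i
    · rw [if_neg (by simp), Bool.not_false, trues_update_of_false hi]
    · rw [if_pos rfl, Bool.not_true, trues_update_of_true hi]
  refine h.trans ((Finset.sum_congr rfl
    fun i _ => congrArg (1 / (n : ℝ) * ·) (h2 i)).trans ?_)
  have h3 : (Finset.univ.filter fun i => x i = true).card = (trues x : ℕ) := rfl
  rw [← Finset.mul_sum, Finset.sum_ite, Finset.sum_const, Finset.sum_const, h3,
    card_filter_not_true, nsmul_eq_mul, nsmul_eq_mul, Nat.cast_sub (Nat.lt_succ_iff.1 (trues x).2)]
  ring

lemma card_fibre (k : Fin (n + 1)) :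
    (Finset.univ.filter fun y : Fin n → Bool => trues y = k).card = n.choose k := by
  have h := Finset.card_powersetCard k (Finset.univ : Finset (Fin n))
  rw [Finset.card_univ, Fintype.card_fin] at h
  rw [← h]
  refine Finset.card_bij' (fun y _ => Finset.univ.filter fun i => y i = true)
    (fun s _ i => decide (i ∈ s)) ?_ ?_ ?_ ?_
  · intro y hy
    rw [Finset.mem_powersetCard]
    exact ⟨Finset.subset_univ _, Fin.ext_iff.1 (Finset.mem_filter.1 hy).2⟩
  · intro s hs
    rw [Finset.mem_powersetCard] at hs
    simp only [Finset.mem_filter, Finset.mem_univ, true_and, Fin.ext_iff, trues,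
      decide_eq_true_eq, Finset.filter_univ_mem, hs.2]
  · intro y _
    funext i
    simp
  · intro s _
    simp

lemma exists_trues_eq (k : Fin (n + 1)) : ∃ x : Fin n → Bool, trues x = k := by
  have h : 0 < (Finset.univ.filter fun y : Fin n → Bool => trues y = k).card := by
    rw [card_fibre]
    exact Nat.choose_pos (Nat.lt_succ_iff.1 k.2)
  obtain ⟨x, hx⟩ := Finset.card_pos.1 h
  exact ⟨x, (Finset.mem_filter.1 hx).2⟩

/-- The projection of the hypercube to the state space of the Ehrenfest chain. -/
def cubeProj (x : (cube n).X) : (ehrenfest n).X := trues x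

lemma sum_cube_K_lump (x : (cube n).X) (g : (ehrenfest n).X → ℝ) :
    ∑ y : (cube n).X, (cube n).K x y * g (cubeProj y)
      = ∑ k, (ehrenfest n).K (cubeProj x) k * g k := by
  have h := sum_cube_K x fun j => g (Fin.ofNat (n + 1) j)
  have hg : ∀ k : Fin (n + 1), g (Fin.ofNat (n + 1) k) = g k := fun k => by
    rw [Fin.ofNat_eq_cast, Fin.cast_val_eq_self]
  simp only [hg] at h
  exact h

lemma stat_cube (y : (cube n).X) : (cube n).stat y = 1 / 2 ^ n := by
  change ∏ _i : Fin n, (1 / 2 : ℝ) = _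
  rw [Finset.prod_const, Finset.card_univ, Fintype.card_fin, div_pow, one_pow]

lemma sum_cube_stat_fibre (k : (ehrenfest n).X) :
    ∑ y : (cube n).X with cubeProj y = k, (cube n).stat y
      = (ehrenfest n).stat k := by
  simp only [stat_cube]
  rw [Finset.sum_const, nsmul_eq_mul, mul_one_div]
  exact congrArg (fun m : ℕ => (m : ℝ) / 2 ^ n) (card_fibre k)

lemma H_cube (hn : 1 ≤ n) (t : ℝ) (x y : (cube n).X) :
    (cube n).H t x y = ∏ i, flip.H (t / n) (x i) (y i) := by
  have h := H_prodChain (C := fun _ : Fin n => flip) (w := fun _ => 1 / (n : ℝ)) ?_ t x y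
  · refine h.trans ?_
    simp only [one_div_mul_eq_div]
  · have : (n : ℝ) ≠ 0 := by positivity
    simp [this]

lemma aff_cube (hn : 1 ≤ n) {t : ℝ} (ht : 0 ≤ t) (x : (cube n).X) :
    (cube n).aff t x = flipAff (t / n) ^ n := by
  have h := aff_prodChain (C := fun _ : Fin n => flip) (w := fun _ => 1 / (n : ℝ))
    (fun _ => flip_hasLaws) (fun _ => by positivity) ?_ ht x
  · refine h.trans ((Finset.prod_congr rfl fun i _ => aff_flip (1 / (n : ℝ) * t) (x i)).trans ?_)
    rw [Finset.prod_const, Finset.card_univ, Fintype.card_fin, one_div_mul_eq_div]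
  · have : (n : ℝ) ≠ 0 := by positivity
    simp [this]

lemma le_aff_ehrenfest (hn : 1 ≤ n) {t : ℝ} (ht : 0 ≤ t) (j : (ehrenfest n).X) :
    flipAff (t / n) ^ n ≤ (ehrenfest n).aff t j := by
  obtain ⟨x, rfl⟩ := exists_trues_eq j
  rw [← aff_cube hn ht x]
  refine aff_le_aff_lump (C := cube n) (D := ehrenfest n) (φ := cubeProj) sum_cube_K_lump
    sum_cube_stat_fibre (fun y => by rw [stat_cube]; positivity) fun y => ?_
  refine le_of_le_of_eq ?_ (H_cube hn t x y).symm
  exact Finset.prod_nonneg fun i _ => flip_hasLaws.H_nonneg _ (by positivity) _ _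

lemma H_cube_zero (hn : 1 ≤ n) (t : ℝ) (y : Fin n → Bool) :
    (cube n).H t (fun _ => false) y = (flip.H (t / n) false true) ^ (trues y : ℕ)
      * (flip.H (t / n) false false) ^ (n - (trues y : ℕ)) := by
  have h1 : ∀ i, flip.H (t / n) false (y i)
      = if y i = true then flip.H (t / n) false true else flip.H (t / n) false false := by
    intro i
    cases y i <;> simp
  have h3 : (Finset.univ.filter fun i => y i = true).card = (trues y : ℕ) := rfl
  refine (H_cube hn t _ y).trans ((Finset.prod_congr rfl fun i _ => h1 i).trans ?_)
  rw [Finset.prod_ite, Finset.prod_const, Finset.prod_const, h3, card_filter_not_true]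

/-- Started from a constant vector, the law on the hypercube depends only on the number of `true`
entries, so the projection loses nothing and the lower bound `le_aff_ehrenfest` is attained. -/
lemma aff_ehrenfest_zero (hn : 1 ≤ n) {t : ℝ} (ht : 0 ≤ t) :
    (ehrenfest n).aff t (trues fun _ : Fin n => false) = flipAff (t / n) ^ n := by
  rw [← aff_cube hn ht fun _ => false]
  refine aff_lump_eq_aff (C := cube n) (D := ehrenfest n) (φ := cubeProj) sum_cube_K_lump
    sum_cube_stat_fibre (fun y z hyz => ?_) fun y z _ => by rw [stat_cube, stat_cube]
  refine (H_cube_zero hn t y).trans (Eq.trans ?_ (H_cube_zero hn t z).symm)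
  rw [show (trues y : ℕ) = trues z from congrArg Fin.val hyz]

lemma ehrenfest_hasLaws (hn : 1 ≤ n) : (ehrenfest n).HasLaws :=
  (ehrenfest_isIrreducibleMarkov hn).hasLaws

lemma minAff_ehrenfest (hn : 1 ≤ n) {t : ℝ} (ht : 0 ≤ t) :
    (ehrenfest n).minAff t = flipAff (t / n) ^ n :=
  le_antisymm (aff_ehrenfest_zero hn ht ▸ (ehrenfest_hasLaws hn).minAff_le t _)
    ((ehrenfest_hasLaws hn).le_minAff fun j => le_aff_ehrenfest hn ht j)

lemma le_minAff_ehrenfest (hn : 1 ≤ n) {t : ℝ} (ht : 0 ≤ t) :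
    1 - n * Real.exp (-4 * (t / n)) ≤ (ehrenfest n).minAff t := by
  have ht' : 0 ≤ t / n := by positivity
  have h0 := flipAff_nonneg (t / n)
  have h1 := flipAff_le_one ht'
  have h2 := le_flipAff_sq ht'
  have h3 : Real.exp (-4 * (t / n)) ≤ 1 := Real.exp_le_one_iff.2 (by linarith)
  have h4 := Real.exp_pos (-4 * (t / n))
  rw [minAff_ehrenfest hn ht]
  have h5 := one_add_mul_le_pow (a := -(Real.exp (-4 * (t / n)) / 2)) (by linarith) n
  -- As the affinity is at most 1, it dominates its square; Bernoulli's inequality then handles the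
  -- n-th power.
  have h6 : 1 + -(Real.exp (-4 * (t / n)) / 2) ≤ flipAff (t / n) := by nlinarith
  have h7 : (1 + -(Real.exp (-4 * (t / n)) / 2)) ^ n ≤ flipAff (t / n) ^ n :=
    pow_le_pow_left₀ (by linarith) h6 n
  have h8 : 0 ≤ n * Real.exp (-4 * (t / n)) := by positivity
  linarith

lemma minAff_ehrenfest_sq_le (hn : 1 ≤ n) {t : ℝ} (ht : 0 ≤ t) :
    (ehrenfest n).minAff t ^ 2 ≤ Real.exp (-(n * Real.exp (-4 * (t / n)) / 4)) := by
  have ht' : 0 ≤ t / n := by positivity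
  rw [minAff_ehrenfest hn ht, ← pow_mul, mul_comm n 2, pow_mul,
    show -(n * Real.exp (-4 * (t / n)) / 4) = n * (-(Real.exp (-4 * (t / n)) / 4)) by ring,
    Real.exp_nat_mul]
  refine pow_le_pow_left₀ (sq_nonneg _) ?_ n
  have h1 := flipAff_sq_le ht'
  have h2 := Real.add_one_le_exp (-(Real.exp (-4 * (t / n)) / 4))
  linarith

end Cube

end
end ProductCutoff

namespace ProductCutoff
noncomputable section

/-! ### Spectral bounds for the path. -/

section Eigen

variable {C : Chain} [Fintype C.X] {f : C.X → ℝ} {c : ℝ}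

lemma sum_pow_mul_eigen (h : ∀ x, ∑ z, C.K x z * f z = c * f x) (m : ℕ) (x : C.X) :
    ∑ z, C.pow m x z * f z = c ^ m * f x := by
  classical
  induction m generalizing x with
  | zero => simp [Chain.pow]
  | succ m ih =>
    calc ∑ z, C.pow (m + 1) x z * f z = ∑ y, C.K x y * ∑ z, C.pow m y z * f z := by
          simp only [Chain.IsIrreducibleMarkov.pow_succ_apply, Finset.sum_mul, Finset.mul_sum,
            mul_assoc]
          exact Finset.sum_comm
      _ = c ^ m * ∑ y, C.K x y * f y := by
          simp only [ih, Finset.mul_sum]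
          exact Finset.sum_congr rfl fun y _ => by ring
      _ = _ := by rw [h]; ring

lemma sum_H_mul_eigen (h : ∀ x, ∑ z, C.K x z * f z = c * f x) (t : ℝ) (x : C.X) :
    ∑ z, C.H t x z * f z = Real.exp (-t * (1 - c)) * f x := by
  classical
  have h1 := hasSum_sum fun y (_ : y ∈ Finset.univ) =>
    (Chain.hasSum_H (C := C) t x y).mul_right (f y)
  simp only [mul_assoc, ← Finset.mul_sum, sum_pow_mul_eigen h] at h1
  refine h1.unique (hasSum_of_eq ((hasSum_poisson_geometric t c).mul_right (f x)) (fun m => ?_) rfl)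
  ring

/-- An eigenfunction for an eigenvalue other than 1 has stationary mean zero, so testing H_t(x,·) -
π against it isolates the decaying mode. -/
lemma eigen_half_l1 (hC : C.IsIrreducibleMarkov) (h : ∀ x, ∑ z, C.K x z * f z = c * f x)
    (hc : c ≠ 1) (hf : ∀ x, |f x| ≤ 1) (t : ℝ) (x : C.X) :
    Real.exp (-t * (1 - c)) * f x / 2 ≤ C.tv t x := by
  have h0 : ∑ y, C.stat y * f y = 0 := by
    have h1 : ∑ y, C.stat y * f y = c * ∑ y, C.stat y * f y := by
      calc ∑ y, C.stat y * f y = ∑ y, (∑ z, C.stat z * C.K z y) * f y := by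
            simp only [hC.sum_stat_mul_K]
        _ = ∑ z, C.stat z * ∑ y, C.K z y * f y := by
            simp only [Finset.sum_mul, Finset.mul_sum, mul_assoc]
            exact Finset.sum_comm
        _ = _ := by
            simp only [h, Finset.mul_sum]
            exact Finset.sum_congr rfl fun y _ => by ring
    have h2 : (1 - c) * ∑ y, C.stat y * f y = 0 := by linarith
    exact (mul_eq_zero.1 h2).resolve_left (sub_ne_zero.2 hc.symm)
  have h1 : ∑ y, (C.H t x y - C.stat y) * f y = Real.exp (-t * (1 - c)) * f x := by
    simp only [sub_mul, Finset.sum_sub_distrib, h0, sum_H_mul_eigen h, sub_zero]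
  rw [← h1, Chain.tv, tsum_fintype, div_eq_inv_mul, ← one_div]
  gcongr with y
  calc (C.H t x y - C.stat y) * f y ≤ |(C.H t x y - C.stat y) * f y| := le_abs_self _
    _ = |C.H t x y - C.stat y| * |f y| := abs_mul _ _
    _ ≤ _ := mul_le_of_le_one_right (abs_nonneg _) (hf y)

end Eigen

section Path

variable {n : ℕ}

/-- The angles `kπ/(n+1)`. -/
def pathAngle (n k : ℕ) : ℝ := k * Real.pi / (n + 1)

/-- The eigenfunctions of the path. -/
def pathCos (n k : ℕ) (x : ℕ) : ℝ := Real.cos (pathAngle n k * (x + 1 / 2))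

lemma pathAngle_mul (n k : ℕ) : pathAngle n k * (n + 1) = k * Real.pi := by
  rw [pathAngle]
  field_simp

/-- The cosine is even about -1/2 and about n + 1/2, so holding at an end agrees with stepping to
the mirror image outside the path. -/
lemma sum_lazyPath_K_cos (k : ℕ) (x : Fin (n + 1)) :
    ∑ z : Fin (n + 1), (lazyPath n).K x z * pathCos n k z
      = Real.cos (pathAngle n k) * pathCos n k x := by
  rw [sum_lazyPath_K]
  set κ := pathAngle n k with hκ
  have h1 : (if (x : ℕ) < n then pathCos n k (x + 1) else pathCos n k n)
      = Real.cos (κ * ((x : ℕ) + 1 / 2) + κ) := by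
    split_ifs with hx
    · rw [pathCos]
      congr 1
      push_cast
      ring
    · have hx : (x : ℕ) = n := by omega
      have hk := pathAngle_mul n k
      rw [hx, pathCos, ← hκ, show κ * ((n : ℝ) + 1 / 2) = κ * (n + 1) - κ / 2 by ring,
        show κ * (n + 1) - κ / 2 + κ = κ * (n + 1) + κ / 2 by ring, hk, Real.cos_sub,
        Real.cos_add, Real.sin_nat_mul_pi]
      ring
  have h2 : (if 0 < (x : ℕ) then pathCos n k (x - 1) else pathCos n k 0)
      = Real.cos (κ * ((x : ℕ) + 1 / 2) - κ) := by
    split_ifs with hx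
    · rw [pathCos, Nat.cast_sub hx]
      congr 1
      push_cast
      ring
    · have hx : (x : ℕ) = 0 := by omega
      rw [hx, pathCos, ← hκ, ← Real.cos_neg]
      congr 1
      push_cast
      ring
  rw [h1, h2, pathCos, ← hκ, Real.cos_add, Real.cos_sub]
  ring

/-- After multiplication by 2 sin φ the sum telescopes; the bounds on m give 0 < φ < π, so that sin
φ can be divided out. -/
lemma sum_cos_pathAngle {m : ℕ} (hm : 0 < m) (hm2 : m < 2 * (n + 1)) :
    ∑ k ∈ Finset.range n, Real.cos (pathAngle n (k + 1) * m) = -((-1) ^ m + 1) / 2 := by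
  set φ : ℝ := m * Real.pi / (n + 1) / 2 with hφ
  have hn : (0 : ℝ) < n + 1 := by positivity
  have hm' : (0 : ℝ) < m := by exact_mod_cast hm
  have hφ0 : 0 < φ := by have := Real.pi_pos; positivity
  have hφ1 : φ < Real.pi := by
    have : (m : ℝ) < 2 * (n + 1) := by exact_mod_cast hm2
    rw [hφ, div_div, div_lt_iff₀ (by positivity), mul_comm]
    nlinarith [Real.pi_pos]
  have hs := Real.sin_pos_of_pos_of_lt_pi hφ0 hφ1
  have htel : ∀ N : ℕ, 2 * Real.sin φ * ∑ k ∈ Finset.range N, Real.cos (pathAngle n (k + 1) * m)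
      = Real.sin ((2 * N + 1) * φ) - Real.sin φ := by
    intro N
    induction N with
    | zero => simp
    | succ N ih =>
      rw [Finset.sum_range_succ, mul_add, ih]
      have e1 : pathAngle n (N + 1) * m = 2 * (N + 1) * φ := by
        rw [pathAngle, hφ]
        push_cast
        field_simp
      have e2 : (2 * ((N + 1 : ℕ) : ℝ) + 1) * φ = 2 * (N + 1) * φ + φ := by push_cast; ring
      have e3 : (2 * (N : ℝ) + 1) * φ = 2 * (N + 1) * φ - φ := by ring
      rw [e1, e2, e3, Real.sin_add, Real.sin_sub]
      ring
  have h := htel n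
  have e : (2 * (n : ℝ) + 1) * φ = m * Real.pi - φ := by
    rw [hφ]
    field_simp
    ring
  rw [e, Real.sin_sub, Real.sin_nat_mul_pi, Real.cos_nat_mul_pi] at h
  have h2 : 2 * Real.sin φ * (∑ k ∈ Finset.range n, Real.cos (pathAngle n (k + 1) * m)
      - -((-1) ^ m + 1) / 2) = 0 := by linear_combination h
  have h3 := (mul_eq_zero.1 h2).resolve_left (by positivity)
  linarith

/-- Completeness of the eigenbasis. The product formula leaves cosine sums of frequencies y - x and
x + y + 1; these have opposite parity, so for x ≠ y the two sums add up to -1. -/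
lemma sum_pathCos_mul (x y : Fin (n + 1)) :
    1 / ((n : ℝ) + 1) * (1 + 2 * ∑ k ∈ Finset.range n, pathCos n (k + 1) x * pathCos n (k + 1) y)
      = if x = y then 1 else 0 := by
  wlog hxy : (x : ℕ) ≤ y generalizing x y
  · have := this y x (by omega)
    simp only [mul_comm (pathCos n _ x), eq_comm (a := x)]
    exact this
  obtain ⟨d, hd⟩ := Nat.exists_eq_add_of_le hxy
  have hprod : ∀ k, pathCos n (k + 1) x * pathCos n (k + 1) y
      = (Real.cos (pathAngle n (k + 1) * d) +
        Real.cos (pathAngle n (k + 1) * ((x + y + 1 : ℕ) : ℝ))) / 2 := by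
    intro k
    set κ := pathAngle n (k + 1) with hκ
    have e1 : κ * (d : ℝ) = κ * ((y : ℕ) + 1 / 2) - κ * ((x : ℕ) + 1 / 2) := by
      rw [hd]; push_cast; ring
    have e2 : κ * ((x + y + 1 : ℕ) : ℝ) = κ * ((y : ℕ) + 1 / 2) + κ * ((x : ℕ) + 1 / 2) := by
      push_cast; ring
    rw [e1, e2, Real.cos_add, Real.cos_sub, pathCos, pathCos, ← hκ]
    ring
  have hn : (0 : ℝ) < n + 1 := by positivity
  rw [Finset.sum_congr rfl fun k _ => hprod k, ← Finset.sum_div, Finset.sum_add_distrib,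
    sum_cos_pathAngle (m := x + y + 1) (by omega) (by omega)]
  rcases Nat.eq_zero_or_pos d with h0 | h0
  · have hxy : x = y := Fin.ext (by omega)
    subst h0 hxy
    have : ((-1 : ℝ)) ^ ((x : ℕ) + x + 1) = -1 := by
      rw [pow_succ, ← two_mul, pow_mul]; norm_num
    rw [if_pos rfl, this]
    simp
    field_simp
    ring
  · have hne : x ≠ y := fun h => by rw [h] at hd; omega
    rw [if_neg hne, sum_cos_pathAngle h0 (by omega)]
    have : ((-1 : ℝ)) ^ ((x : ℕ) + y + 1) = -(-1) ^ d := by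
      rw [hd, pow_succ, ← add_assoc, ← two_mul, pow_add, pow_mul]; norm_num
    rw [this]
    ring

instance lazyPathFintype : Fintype (lazyPath n).X := inferInstanceAs (Fintype (Fin (n + 1)))

instance lazyPathDecidableEq : DecidableEq (lazyPath n).X :=
  inferInstanceAs (DecidableEq (Fin (n + 1)))

lemma pow_lazyPath (m : ℕ) (x y : Fin (n + 1)) :
    (lazyPath n).pow m x y = 1 / ((n : ℝ) + 1) * (1 + 2 * ∑ k ∈ Finset.range n,
      Real.cos (pathAngle n (k + 1)) ^ m * (pathCos n (k + 1) x * pathCos n (k + 1) y)) := by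
  induction m generalizing x with
  | zero =>
    simp only [pow_zero, one_mul]
    rw [sum_pathCos_mul]
    simp only [Chain.pow]
    congr
  | succ m ih =>
    obtain ⟨κ, h, h1, h2⟩ : ∃ κ : Fin (n + 1) → ℝ,
        (lazyPath n).pow (m + 1) x y = ∑ z, κ z * (lazyPath n).pow m z y ∧ ∑ z, κ z = 1 ∧
        ∀ k, ∑ z, κ z * pathCos n k z = Real.cos (pathAngle n k) * pathCos n k x :=
      ⟨(lazyPath n).K x, tsum_fintype _, (lazyPath_isIrreducibleMarkov n).sum_K x,
        fun k => sum_lazyPath_K_cos k x⟩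
    rw [h]
    simp only [ih]
    have e : ∀ z : Fin (n + 1), κ z * (1 / ((n : ℝ) + 1) * (1 + 2 *
        ∑ k ∈ Finset.range n, Real.cos (pathAngle n (k + 1)) ^ m *
          (pathCos n (k + 1) z * pathCos n (k + 1) y)))
        = 1 / ((n : ℝ) + 1) * (κ z + 2 * ∑ k ∈ Finset.range n,
          Real.cos (pathAngle n (k + 1)) ^ m * pathCos n (k + 1) y *
            (κ z * pathCos n (k + 1) z)) := by
      intro z
      rw [mul_left_comm, mul_add, mul_one, mul_left_comm _ (2 : ℝ), Finset.mul_sum]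
      congr 3
      exact Finset.sum_congr rfl fun k _ => by ring
    rw [Finset.sum_congr rfl fun z _ => e z, ← Finset.mul_sum, Finset.sum_add_distrib, h1,
      ← Finset.mul_sum, Finset.sum_comm]
    congr 3
    refine Finset.sum_congr rfl fun k _ => ?_
    rw [← Finset.mul_sum, h2]
    ring

lemma H_lazyPath (t : ℝ) (x y : Fin (n + 1)) :
    (lazyPath n).H t x y = 1 / ((n : ℝ) + 1) * (1 + 2 * ∑ k ∈ Finset.range n,
      Real.exp (-t * (1 - Real.cos (pathAngle n (k + 1)))) *
        (pathCos n (k + 1) x * pathCos n (k + 1) y)) := by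
  have h1 := Chain.hasSum_H (C := lazyPath n) t x y
  have h2 := hasSum_sum fun k (_ : k ∈ Finset.range n) =>
    (hasSum_poisson_geometric t (Real.cos (pathAngle n (k + 1)))).mul_right
      (pathCos n (k + 1) x * pathCos n (k + 1) y)
  refine h1.unique (hasSum_of_eq (((hasSum_poisson t).add (h2.mul_left 2)).mul_left
    (1 / ((n : ℝ) + 1))) (fun m => ?_) rfl)
  have e : ∑ k ∈ Finset.range n, Real.exp (-t) * t ^ m / m.factorial *
      Real.cos (pathAngle n (k + 1)) ^ m * (pathCos n (k + 1) x * pathCos n (k + 1) y)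
      = Real.exp (-t) * t ^ m / m.factorial * ∑ k ∈ Finset.range n,
        Real.cos (pathAngle n (k + 1)) ^ m * (pathCos n (k + 1) x * pathCos n (k + 1) y) := by
    rw [Finset.mul_sum]
    exact Finset.sum_congr rfl fun k _ => by ring
  rw [pow_lazyPath, e]
  ring

lemma abs_pathCos_le_one (n k x : ℕ) : |pathCos n k x| ≤ 1 := Real.abs_cos_le_one _

/-- From cos θ ≤ 1 - 2θ²/π² the gap is at least quadratic in k + 1. Weakening it to a linear bound
makes the spectral sum geometric. -/
lemma le_one_sub_cos_pathAngle {k : ℕ} (hk : k < n) :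
    (k + 1) * (2 / ((n : ℝ) + 1) ^ 2) ≤ 1 - Real.cos (pathAngle n (k + 1)) := by
  have hn : (0 : ℝ) < n + 1 := by positivity
  have hk' : ((k + 1 : ℕ) : ℝ) ≤ n + 1 := by exact_mod_cast (by omega : k + 1 ≤ n + 1)
  have hk1 : (1 : ℝ) ≤ ((k + 1 : ℕ) : ℝ) := by exact_mod_cast (by omega : 1 ≤ k + 1)
  have hp := Real.pi_pos
  have h0 : 0 ≤ pathAngle n (k + 1) := by rw [pathAngle]; positivity
  have h1 : pathAngle n (k + 1) ≤ Real.pi := by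
    rw [pathAngle, div_le_iff₀ hn, mul_comm]
    gcongr
  have h2 := Real.cos_le_one_sub_mul_cos_sq (abs_le.2 ⟨by linarith, h1⟩)
  have h3 : 2 / Real.pi ^ 2 * pathAngle n (k + 1) ^ 2
      = ((k + 1 : ℕ) : ℝ) ^ 2 * (2 / ((n : ℝ) + 1) ^ 2) := by
    rw [pathAngle]
    field_simp
  have h4 : ((k + 1 : ℕ) : ℝ) * (2 / ((n : ℝ) + 1) ^ 2)
      ≤ ((k + 1 : ℕ) : ℝ) ^ 2 * (2 / ((n : ℝ) + 1) ^ 2) := by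
    gcongr
    nlinarith
  push_cast at h3 h4
  linarith

lemma sum_exp_neg_mul_le {z : ℝ} (hz : 0 < z) (n : ℕ) :
    ∑ k ∈ Finset.range n, Real.exp (-((k + 1) * z)) ≤ 1 / z := by
  set q := Real.exp (-z) with hq
  have hq0 : 0 < q := Real.exp_pos _
  have h1 : q * (1 + z) ≤ 1 := by
    calc q * (1 + z) ≤ q * Real.exp z := by
          gcongr
          linarith [Real.add_one_le_exp z]
      _ = 1 := by rw [hq, ← Real.exp_add]; simp
  have hq1 : q < 1 := by nlinarith
  have h2 : ∀ k : ℕ, Real.exp (-((k + 1) * z)) = q * q ^ k := by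
    intro k
    rw [hq, ← Real.exp_nat_mul, ← Real.exp_add]
    congr 1
    ring
  have h3 := mul_neg_geom_sum q n
  rw [Finset.sum_congr rfl fun k _ => h2 k, ← Finset.mul_sum, le_div_iff₀ hz]
  have h4 : 0 < q ^ n := by positivity
  have h5 : 0 ≤ ∑ i ∈ Finset.range n, q ^ i := Finset.sum_nonneg fun i _ => by positivity
  nlinarith

lemma tv_lazyPath_le {t : ℝ} (ht : 0 < t) (x : (lazyPath n).X) :
    (lazyPath n).tv t x ≤ ((n : ℝ) + 1) ^ 2 / (2 * t) := by
  have hn : (0 : ℝ) < n + 1 := by positivity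
  have h : (lazyPath n).tv t x
      = 1 / 2 * ∑ y : Fin (n + 1), |(lazyPath n).H t x y - 1 / ((n : ℝ) + 1)| := by
    rw [Chain.tv, tsum_fintype]
    rfl
  set z : ℝ := 2 * t / ((n : ℝ) + 1) ^ 2 with hz
  have hb : ∀ y : Fin (n + 1), |(lazyPath n).H t x y - 1 / ((n : ℝ) + 1)|
      ≤ 2 / ((n : ℝ) + 1) * (1 / z) := by
    intro y
    have e := H_lazyPath (n := n) t x y
    rw [e, mul_add, mul_one, add_sub_cancel_left, ← mul_assoc, one_div_mul_eq_div, abs_mul,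
      abs_of_nonneg (by positivity)]
    gcongr
    refine (Finset.abs_sum_le_sum_abs _ _).trans
      (le_trans (Finset.sum_le_sum fun k hk => ?_) (sum_exp_neg_mul_le (by positivity) n))
    have h1 := le_one_sub_cos_pathAngle (n := n) (Finset.mem_range.1 hk)
    rw [abs_mul, abs_of_pos (Real.exp_pos _)]
    refine (mul_le_of_le_one_right (Real.exp_pos _).le ?_).trans (Real.exp_le_exp.2 ?_)
    · rw [abs_mul]
      exact mul_le_one₀ (abs_pathCos_le_one _ _ _) (abs_nonneg _) (abs_pathCos_le_one _ _ _)
    · have h2 := mul_le_mul_of_nonneg_left h1 ht.le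
      have h3 : t * ((k + 1) * (2 / ((n : ℝ) + 1) ^ 2)) = (k + 1) * z := by rw [hz]; ring
      linarith
  rw [h]
  calc _ ≤ 1 / 2 * ∑ _y : Fin (n + 1), 2 / ((n : ℝ) + 1) * (1 / z) := by
        gcongr with y
        exact hb y
    _ = _ := by
        rw [Finset.sum_const, Finset.card_univ, Fintype.card_fin, nsmul_eq_mul, hz]
        push_cast
        field_simp

lemma exists_le_tv_lazyPath (hn : 1 ≤ n) {t : ℝ} (ht : 0 ≤ t) :
    ∃ x, Real.exp (-(5 * t / ((n : ℝ) + 1) ^ 2)) / 4 ≤ (lazyPath n).tv t x := by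
  have hn' : (2 : ℝ) ≤ n + 1 := by
    have : (1 : ℝ) ≤ n := by exact_mod_cast hn
    linarith
  have hp := Real.pi_pos
  have hp2 : Real.pi ^ 2 ≤ 10 := by nlinarith [Real.pi_lt_d2]
  set θ := pathAngle n 1 with hθ
  have hθ0 : 0 < θ := by
    rw [hθ, pathAngle]
    positivity
  have hθsq : θ ^ 2 ≤ 10 / ((n : ℝ) + 1) ^ 2 := by
    rw [hθ, pathAngle, Nat.cast_one, one_mul, div_pow]
    gcongr
  have h4 : (10 : ℝ) / ((n : ℝ) + 1) ^ 2 ≤ 10 / 2 ^ 2 := by gcongr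
  have hθπ : θ ≤ Real.pi := by
    rw [hθ, pathAngle, Nat.cast_one, one_mul]
    exact div_le_self hp.le (by linarith)
  have hc1 : Real.cos θ ≠ 1 := by
    have := Real.cos_lt_cos_of_nonneg_of_le_pi le_rfl hθπ hθ0
    rw [Real.cos_zero] at this
    exact this.ne
  refine ⟨(0 : Fin (n + 1)), ?_⟩
  -- The slowest mode, started at the end 0, where the eigenfunction is at least 1/2; the other
  -- factor 1/2 comes from `eigen_half_l1`. The rate is at most θ²/2 ≤ 5/(n+1)², using π² ≤ 10.
  have h := eigen_half_l1 (C := lazyPath n) (f := fun x : Fin (n + 1) => pathCos n 1 x)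
    (lazyPath_isIrreducibleMarkov n) (fun x => sum_lazyPath_K_cos 1 x) hc1
    (fun x => abs_pathCos_le_one _ _ _) t (0 : Fin (n + 1))
  refine le_trans ?_ h
  have hcos := Real.one_sub_sq_div_two_le_cos (x := θ)
  have hcos2 := Real.one_sub_sq_div_two_le_cos (x := θ * (((0 : Fin (n + 1)) : ℕ) + 1 / 2))
  have e1 : (1 : ℝ) / 2 ≤ pathCos n 1 ((0 : Fin (n + 1)) : ℕ) := by
    refine le_trans ?_ hcos2
    simp only [Fin.val_zero, Nat.cast_zero, zero_add]
    nlinarith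
  have e2 : Real.exp (-(5 * t / ((n : ℝ) + 1) ^ 2)) ≤ Real.exp (-t * (1 - Real.cos θ)) := by
    apply Real.exp_le_exp.2
    have : 1 - Real.cos θ ≤ 5 / ((n : ℝ) + 1) ^ 2 := by
      have : (5 : ℝ) / ((n : ℝ) + 1) ^ 2 = 10 / ((n : ℝ) + 1) ^ 2 / 2 := by ring
      linarith
    have := mul_le_mul_of_nonneg_left this ht
    rw [mul_div_assoc', mul_comm t 5] at this
    linarith
  have e3 := Real.exp_pos (-(5 * t / ((n : ℝ) + 1) ^ 2))
  nlinarith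

end Path

end
end ProductCutoff

namespace ProductCutoff
noncomputable section

/-! ### First counterexample: Ehrenfest chains mixed with paths. -/

section Mixed

lemma mixedFamily_even (j : ℕ) : mixedFamily (2 * j) = ehrenfest (j + 1) := by
  rw [mixedFamily, if_pos (even_two_mul j), Nat.mul_div_cancel_left j two_pos]

lemma mixedFamily_odd (j : ℕ) : mixedFamily (2 * j + 1) = lazyPath (j + 1) := by
  rw [mixedFamily, if_neg (by simp), show (2 * j + 1) / 2 = j by omega]

lemma mixedWeights_even (r : ℝ) (j : ℕ) : mixedWeights r (2 * j) = r ^ j := by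
  rw [mixedWeights, if_pos (even_two_mul j), Nat.mul_div_cancel_left j two_pos]

lemma mixedWeights_odd (r : ℝ) (j : ℕ) : mixedWeights r (2 * j + 1) = 1 := by
  rw [mixedWeights, if_neg (by simp)]

lemma mixedFamily_isIrreducibleMarkov (k : ℕ) : (mixedFamily k).IsIrreducibleMarkov := by
  rw [mixedFamily]
  split_ifs
  · exact ehrenfest_isIrreducibleMarkov (by omega)
  · exact lazyPath_isIrreducibleMarkov _

lemma lazyPath_hasLaws (n : ℕ) : (lazyPath n).HasLaws :=
  (lazyPath_isIrreducibleMarkov n).hasLaws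

lemma mixedFamily_hasLaws (k : ℕ) : (mixedFamily k).HasLaws := by
  rw [mixedFamily]
  split_ifs
  · exact ehrenfest_hasLaws (by omega)
  · exact lazyPath_hasLaws _

lemma mixedWeights_pos {r : ℝ} (hr : 0 < r) (k : ℕ) : 0 < mixedWeights r k := by
  rw [mixedWeights]
  split_ifs <;> positivity

lemma Chain.HasLaws.tv_le_sqrt_minAff {C : Chain} (h : C.HasLaws) {t : ℝ} (ht : 0 ≤ t) (x : C.X) :
    C.tv t x ≤ √(1 - C.minAff t ^ 2) := by
  refine (h.tv_le_sqrt ht x).trans (Real.sqrt_le_sqrt ?_)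
  have := h.minAff_le t x
  have := h.minAff_nonneg t
  gcongr

lemma not_cutoffAff_mixedFamily : ¬ CutoffAff mixedFamily := by
  rintro ⟨t, ht, h1, h0⟩
  have hsub : Tendsto (fun j : ℕ => 2 * j + 1) atTop atTop :=
    tendsto_atTop_mono (fun j => by omega : ∀ j : ℕ, j ≤ 2 * j + 1) tendsto_id
  have h1' := (h1 2 one_lt_two).comp hsub
  have h0' := (h0 (1 / 2) (by norm_num) (by norm_num)).comp hsub
  have h2 := ((h1'.pow 2).const_sub 1).sqrt
  norm_num at h2
  -- If the affinity at s/2 is below 1/2, the upper bound M/s on the distance there forces s < 2M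
  -- with M = (n+1)². At time 2s the lower bound is then at least e^(-20)/4, too large for an
  -- affinity tending to 1.
  have hpos : 0 < Real.exp (-20) / 4 := by positivity
  have hev := (h2.eventually_lt_const hpos).and (h0'.eventually_lt_const (one_half_pos (α := ℝ)))
  obtain ⟨j, hj1, hj2⟩ := hev.exists
  simp only [Function.comp] at hj1 hj2
  rw [mixedFamily_odd] at hj1 hj2
  set s := t (2 * j + 1) with hs
  have hs0 : 0 < s := ht _
  obtain ⟨x, hx⟩ := exists_le_tv_lazyPath (n := j + 1) (by omega) (t := 2 * s) (by positivity)
  have h3 := (lazyPath_hasLaws (j + 1)).tv_le_sqrt_minAff (t := 2 * s) (by positivity) x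
  have h4 := (lazyPath_hasLaws (j + 1)).one_sub_le_minAff (t := 1 / 2 * s) (by positivity)
    (fun x => tv_lazyPath_le (by positivity) x)
  set M : ℝ := (((j + 1 : ℕ) : ℝ) + 1) ^ 2 with hM
  have hM0 : 0 < M := by positivity
  have h5 : 1 / 2 < M / s := by
    have : 2 * (1 / 2 * s) = s := by ring
    rw [this] at h4
    linarith
  rw [lt_div_iff₀ hs0] at h5
  have h6 : Real.exp (-20) ≤ Real.exp (-(5 * (2 * s) / M)) := by
    apply Real.exp_le_exp.2
    rw [neg_le_neg_iff, div_le_iff₀ hM0]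
    linarith
  linarith

lemma sum_range_two_mul (f : ℕ → ℝ) (M : ℕ) :
    ∑ k ∈ Finset.range (2 * M), f k = ∑ j ∈ Finset.range M, (f (2 * j) + f (2 * j + 1)) := by
  induction M with
  | zero => simp
  | succ M ih =>
    rw [Finset.sum_range_succ, ← ih, show 2 * (M + 1) = 2 * M + 1 + 1 by ring,
      Finset.sum_range_succ, Finset.sum_range_succ, add_assoc]

/-- The cutoff time of the last Ehrenfest chain in the product of `mixedFamily`, in units in which
a chain of weight one jumps at rate one. -/
def mixedTime (r : ℝ) (m : ℕ) : ℝ := (r ^ m)⁻¹ * ((m + 1) / 4 * Real.log (m + 2))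

variable {r : ℝ}

lemma log_add_two_ge (m : ℕ) : Real.log 2 ≤ Real.log ((m : ℝ) + 2) :=
  Real.log_le_log two_pos (by have : (0 : ℝ) ≤ m := Nat.cast_nonneg m; linarith)

lemma mixedTime_pos (hr : 0 < r) (m : ℕ) : 0 < mixedTime r m := by
  have h1 := Real.log_pos one_lt_two
  have h2 := log_add_two_ge m
  have : 0 < Real.log ((m : ℝ) + 2) := by linarith
  rw [mixedTime]
  positivity

/-- All factors are at most 1, so keeping a single one suffices. The last Ehrenfest chain has index
`2 * (N / 2)`, the largest even number up to N. -/
lemma minAff_prod_mixed_le (hr : 0 < r) (N : ℕ) {s : ℝ} (hs : 0 ≤ s) :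
    ∏ k ∈ Finset.range (N + 1), (mixedFamily k).minAff (mixedWeights r k * s)
      ≤ (ehrenfest (N / 2 + 1)).minAff (r ^ (N / 2) * s) := by
  have hk : 2 * (N / 2) ∈ Finset.range (N + 1) := Finset.mem_range.2 (by omega)
  rw [← Finset.mul_prod_erase _ _ hk, mixedFamily_even, mixedWeights_even]
  have h1 : ∏ k ∈ (Finset.range (N + 1)).erase (2 * (N / 2)),
      (mixedFamily k).minAff (mixedWeights r k * s) ≤ 1 :=
    Finset.prod_le_one (fun k _ => (mixedFamily_hasLaws k).minAff_nonneg _)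
      fun k _ => (mixedFamily_hasLaws k).minAff_le_one (mul_nonneg (mixedWeights_pos hr k).le hs)
  exact mul_le_of_le_one_right ((ehrenfest_hasLaws (by omega)).minAff_nonneg _) h1

lemma one_sub_sum_le_prod_mixed (hr : 0 < r) (N : ℕ) {s : ℝ} (hs : 0 < s) :
    1 - ∑ j ∈ Finset.range (N / 2 + 1),
      (((j + 1 : ℕ) : ℝ) * Real.exp (-4 * (r ^ j * s / ((j + 1 : ℕ) : ℝ)))
        + (((j + 1 : ℕ) : ℝ) + 1) ^ 2 / (2 * s))
      ≤ ∏ k ∈ Finset.range (N + 1), (mixedFamily k).minAff (mixedWeights r k * s) := by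
  have hs' : ∀ k, 0 ≤ mixedWeights r k * s := fun k => by
    have := mixedWeights_pos hr k
    positivity
  have h1 := one_sub_sum_le_prod (Finset.range (N + 1))
    (fun k => (mixedFamily k).minAff (mixedWeights r k * s))
    (fun k => 1 - (mixedFamily k).minAff (mixedWeights r k * s))
    (fun k _ => (mixedFamily_hasLaws k).minAff_nonneg _)
    (fun k _ => (mixedFamily_hasLaws k).minAff_le_one (hs' k)) (fun k _ => by simp)
  refine le_trans (sub_le_sub_left ?_ 1) h1
  -- Completing the range to whole pairs (Ehrenfest, path) adds only nonnegative deficits.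
  have h2 : Finset.range (N + 1) ⊆ Finset.range (2 * (N / 2 + 1)) :=
    Finset.range_subset_range.2 (by omega)
  refine (Finset.sum_le_sum_of_subset_of_nonneg h2 fun k _ _ =>
    sub_nonneg.2 ((mixedFamily_hasLaws k).minAff_le_one (hs' k))).trans ?_
  rw [sum_range_two_mul]
  refine Finset.sum_le_sum fun j _ => add_le_add ?_ ?_
  · rw [mixedFamily_even, mixedWeights_even]
    have := le_minAff_ehrenfest (n := j + 1) (by omega) (t := r ^ j * s) (by positivity)
    linarith
  · rw [mixedFamily_odd, mixedWeights_odd, one_mul]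
    have := (lazyPath_hasLaws (j + 1)).one_sub_le_minAff hs.le fun x => tv_lazyPath_le hs x
    linarith

/-- The chain i places before the last one is faster by a factor of at least r^(-i) ≥ 1 + iδ. Its
exponent is thus at least aL + iδ log 2; the part L cancels the prefactor j + 1 ≤ e^L, and a
geometric series in i remains. -/
lemma sum_ehrenfest_bound (hr : 0 < r) (hr1 : r < 1) {a : ℝ} (ha : 1 < a) (m : ℕ) :
    ∑ j ∈ Finset.range (m + 1),
      ((j + 1 : ℕ) : ℝ) * Real.exp (-4 * (r ^ j * (a * mixedTime r m) / ((j + 1 : ℕ) : ℝ)))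
      ≤ Real.exp (-(a - 1) * Real.log (m + 2))
        * (1 - Real.exp (-((r⁻¹ - 1) * Real.log 2)))⁻¹ := by
  set L := Real.log ((m : ℝ) + 2) with hL
  have hl2 := Real.log_pos one_lt_two
  have hLl : Real.log 2 ≤ L := log_add_two_ge m
  have hδ : 0 < r⁻¹ - 1 := sub_pos.2 ((one_lt_inv₀ hr).2 hr1)
  set δ := r⁻¹ - 1 with hδ'
  set q := Real.exp (-(δ * Real.log 2)) with hq
  have hq0 : 0 < q := Real.exp_pos _
  have hq1 : q < 1 := Real.exp_lt_one_iff.2 (by have := mul_pos hδ hl2; linarith)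
  have hterm : ∀ j ∈ Finset.range (m + 1),
      ((j + 1 : ℕ) : ℝ) * Real.exp (-4 * (r ^ j * (a * mixedTime r m) / ((j + 1 : ℕ) : ℝ)))
      ≤ Real.exp (-(a - 1) * L) * q ^ (m - j) := by
    intro j hj
    have hjm : j ≤ m := Nat.lt_succ_iff.1 (Finset.mem_range.1 hj)
    obtain ⟨i, rfl⟩ := Nat.exists_eq_add_of_le hjm
    rw [Nat.add_sub_cancel_left]
    have hj1 : (0 : ℝ) < ((j + 1 : ℕ) : ℝ) := by positivity
    have e1 : ((j + 1 : ℕ) : ℝ) ≤ Real.exp L := by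
      rw [hL, Real.exp_log (by positivity)]
      push_cast
      have : (0 : ℝ) ≤ i := Nat.cast_nonneg i
      linarith
    have e2 : 1 + i * δ ≤ (r ^ i)⁻¹ := by
      have := one_add_mul_le_pow (a := δ) (by linarith) i
      rwa [hδ', add_sub_cancel, inv_pow] at this
    have e3 : a * L + i * (δ * Real.log 2)
        ≤ 4 * (r ^ j * (a * mixedTime r (j + i)) / ((j + 1 : ℕ) : ℝ)) := by
      have e4 : 4 * (r ^ j * (a * mixedTime r (j + i)) / ((j + 1 : ℕ) : ℝ))
          = ((((j + i : ℕ) : ℝ) + 1) / ((j + 1 : ℕ) : ℝ)) * ((r ^ i)⁻¹ * (a * L)) := by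
        rw [mixedTime, ← hL, pow_add]
        field_simp
      have e5 : (1 : ℝ) ≤ (((j + i : ℕ) : ℝ) + 1) / ((j + 1 : ℕ) : ℝ) := by
        rw [le_div_iff₀ hj1]
        push_cast
        have : (0 : ℝ) ≤ i := Nat.cast_nonneg i
        linarith
      have haL : Real.log 2 ≤ a * L := by nlinarith
      have hi : 0 ≤ i * δ := by positivity
      have e6 : a * L + i * (δ * Real.log 2) ≤ (r ^ i)⁻¹ * (a * L) := by nlinarith
      rw [e4]
      have e7 : 0 ≤ (r ^ i)⁻¹ * (a * L) := by
        have : 0 < a * L := by linarith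
        positivity
      nlinarith
    calc _ ≤ Real.exp L * Real.exp (-(a * L + i * (δ * Real.log 2))) := by
          gcongr
          linarith
      _ = _ := by
          rw [hq, ← Real.exp_nat_mul, ← Real.exp_add, ← Real.exp_add]
          congr 1
          ring
  refine (Finset.sum_le_sum hterm).trans ?_
  rw [← Finset.mul_sum]
  gcongr
  have h1 := Finset.sum_range_reflect (fun i => q ^ i) (m + 1)
  have h2 : ∑ j ∈ Finset.range (m + 1), q ^ (m - j) = ∑ i ∈ Finset.range (m + 1), q ^ i := by
    rw [← h1]
    exact Finset.sum_congr rfl fun j _ => by simp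
  rw [h2, ← tsum_geometric_of_lt_one hq0.le hq1]
  exact (summable_geometric_of_lt_one hq0.le hq1).sum_le_tsum _ fun i _ => by positivity

/-- Each of the m + 1 paths has distance of order m² over the time, and the factor (m+1)/4 in
`mixedTime` cancels the number of paths. -/
lemma sum_path_bound (hr : 0 < r) {a : ℝ} (ha : 1 < a) (m : ℕ) :
    ∑ j ∈ Finset.range (m + 1), (((j + 1 : ℕ) : ℝ) + 1) ^ 2 / (2 * (a * mixedTime r m))
      ≤ 2 / Real.log 2 * (((m + 2 : ℕ) : ℝ) ^ 2 * r ^ m) := by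
  have hl2 := Real.log_pos one_lt_two
  have hLl := log_add_two_ge m
  have hτ := mixedTime_pos hr m
  have hterm : ∀ j ∈ Finset.range (m + 1),
      (((j + 1 : ℕ) : ℝ) + 1) ^ 2 / (2 * (a * mixedTime r m))
        ≤ ((m + 2 : ℕ) : ℝ) ^ 2 / (2 * mixedTime r m) := by
    intro j hj
    have hj' : (j : ℝ) ≤ m := by exact_mod_cast Nat.lt_succ_iff.1 (Finset.mem_range.1 hj)
    have e : (((j + 1 : ℕ) : ℝ) + 1) ≤ ((m + 2 : ℕ) : ℝ) := by push_cast; linarith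
    have e' : mixedTime r m ≤ a * mixedTime r m := by nlinarith
    gcongr
  refine (Finset.sum_le_sum hterm).trans ?_
  rw [Finset.sum_const, Finset.card_range, nsmul_eq_mul]
  have hL : 0 < Real.log ((m : ℝ) + 2) := by linarith
  have e : ((m + 1 : ℕ) : ℝ) * (((m + 2 : ℕ) : ℝ) ^ 2 / (2 * mixedTime r m))
      = 2 / Real.log (m + 2) * (((m + 2 : ℕ) : ℝ) ^ 2 * r ^ m) := by
    rw [mixedTime]
    push_cast
    field_simp
    ring
  rw [e]
  gcongr

lemma tendsto_log_add_two : Tendsto (fun m : ℕ => Real.log ((m : ℝ) + 2)) atTop atTop :=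
  Real.tendsto_log_atTop.comp
    (tendsto_atTop_add_const_right _ 2 tendsto_natCast_atTop_atTop)

lemma tendsto_div_two : Tendsto (fun N : ℕ => N / 2) atTop atTop :=
  Nat.tendsto_div_const_atTop two_ne_zero

lemma cutoffAff_prod_mixed (hr : 0 < r) (hr1 : r < 1) :
    CutoffAff (prodFamily mixedFamily (mixedWeights r)) := by
  have hw := mixedWeights_pos hr
  have hQ : ∀ N, 0 < ∑ j ∈ Finset.range (N + 1), mixedWeights r j := fun N =>
    Finset.sum_pos (fun j _ => hw j) (by simp)
  have hform : ∀ (a : ℝ) (N : ℕ), 0 < a →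
      (prodFamily mixedFamily (mixedWeights r) N).minAff
        (a * ((∑ j ∈ Finset.range (N + 1), mixedWeights r j) * mixedTime r (N / 2)))
      = ∏ k ∈ Finset.range (N + 1),
        (mixedFamily k).minAff (mixedWeights r k * (a * mixedTime r (N / 2))) := by
    intro a N ha
    have h1 := hQ N
    have h2 := mixedTime_pos hr (N / 2)
    rw [minAff_prodFamily mixedFamily_hasLaws hw N (by positivity)]
    refine Finset.prod_congr rfl fun k _ => ?_
    rw [mul_left_comm, mul_div_cancel_left₀ _ h1.ne']
  -- The total weight undoes the normalisation of the product, so that chain k runs exactly up to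
  -- its weight times a multiple of `mixedTime`.
  refine ⟨fun N => (∑ j ∈ Finset.range (N + 1), mixedWeights r j) * mixedTime r (N / 2),
    fun N => mul_pos (hQ N) (mixedTime_pos hr _), fun a ha => ?_, fun a ha0 ha1 => ?_⟩
  · simp only [hform a _ (by linarith)]
    have hB1 : Tendsto (fun m : ℕ => Real.exp (-(a - 1) * Real.log (m + 2))
        * (1 - Real.exp (-((r⁻¹ - 1) * Real.log 2)))⁻¹) atTop (𝓝 0) := by
      rw [← zero_mul ((1 - Real.exp (-((r⁻¹ - 1) * Real.log 2)))⁻¹)]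
      refine (Real.tendsto_exp_atBot.comp ?_).mul_const _
      exact tendsto_log_add_two.const_mul_atTop_of_neg (by linarith)
    have hB2 : Tendsto (fun m : ℕ => 2 / Real.log 2 * (((m + 2 : ℕ) : ℝ) ^ 2 * r ^ m)) atTop
        (𝓝 0) := by
      have h := (tendsto_pow_const_mul_const_pow_of_lt_one 2 hr.le hr1).comp
        (tendsto_add_atTop_nat 2)
      have h2 := h.const_mul (2 / Real.log 2 * (r ^ 2)⁻¹)
      rw [mul_zero] at h2
      refine h2.congr fun m => ?_
      simp only [Function.comp]
      rw [pow_add]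
      field_simp
    have hB := (((hB1.add hB2).const_sub 1).comp tendsto_div_two)
    simp only [add_zero, sub_zero] at hB
    refine tendsto_of_tendsto_of_tendsto_of_le_of_le hB tendsto_const_nhds (fun N => ?_) fun N => ?_
    · have hτ := mixedTime_pos hr (N / 2)
      refine le_trans ?_ (one_sub_sum_le_prod_mixed hr N (s := a * mixedTime r (N / 2))
        (by positivity))
      rw [Finset.sum_add_distrib]
      exact sub_le_sub_left (add_le_add (sum_ehrenfest_bound hr hr1 ha _)
        (sum_path_bound hr ha _)) 1
    · have hτ := mixedTime_pos hr (N / 2)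
      exact Finset.prod_le_one (fun k _ => (mixedFamily_hasLaws k).minAff_nonneg _)
        fun k _ => (mixedFamily_hasLaws k).minAff_le_one (by have := hw k; positivity)
  · simp only [hform a _ ha0]
    -- The exponent (m+1)/4 · e^(-aL) with e^L = m + 2 is at least e^((1-a)L)/8, because 2(m+1) ≥ m
    -- + 2.
    have hB : Tendsto (fun m : ℕ =>
        √(Real.exp (-(1 / 8 * Real.exp ((1 - a) * Real.log ((m : ℝ) + 2)))))) atTop (𝓝 0) := by
      rw [← Real.sqrt_zero]
      refine (Real.tendsto_exp_atBot.comp (tendsto_neg_atTop_atBot.comp ?_)).sqrt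
      refine (Real.tendsto_exp_atTop.comp ?_).const_mul_atTop (by norm_num)
      exact tendsto_log_add_two.const_mul_atTop (by linarith)
    refine tendsto_of_tendsto_of_tendsto_of_le_of_le tendsto_const_nhds (hB.comp tendsto_div_two)
      (fun N => Finset.prod_nonneg fun k _ => (mixedFamily_hasLaws k).minAff_nonneg _) fun N => ?_
    have hτ := mixedTime_pos hr (N / 2)
    refine (minAff_prod_mixed_le hr N (s := a * mixedTime r (N / 2)) (by positivity)).trans ?_
    apply Real.le_sqrt_of_sq_le
    refine (minAff_ehrenfest_sq_le (by omega) (by positivity)).trans (Real.exp_le_exp.2 ?_)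
    rw [neg_le_neg_iff]
    set m := N / 2
    have hm2 : (0 : ℝ) < (m : ℝ) + 2 := by positivity
    have e1 : -4 * (r ^ m * (a * mixedTime r m) / ((m + 1 : ℕ) : ℝ))
        = -a * Real.log ((m : ℝ) + 2) := by
      rw [mixedTime]
      push_cast
      field_simp
    rw [e1, sub_mul, one_mul, sub_eq_add_neg, Real.exp_add, Real.exp_log hm2, ← neg_mul]
    have h3 := Real.exp_pos (-a * Real.log ((m : ℝ) + 2))
    have h4 : (0 : ℝ) ≤ m := Nat.cast_nonneg m
    push_cast
    nlinarith

end Mixed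

end
end ProductCutoff

namespace ProductCutoff
noncomputable section

/-! ### Affinity in terms of the mass of a single state. -/

namespace Chain.IsIrreducibleMarkov

variable {C : Chain} (h : C.IsIrreducibleMarkov) [Fintype C.X]
include h

lemma sum_erase_H [DecidableEq C.X] (t : ℝ) (x z : C.X) :
    ∑ y ∈ Finset.univ.erase z, C.H t x y = 1 - C.H t x z := by
  rw [← h.sum_H t x, ← Finset.add_sum_erase _ _ (Finset.mem_univ z), add_sub_cancel_left]

lemma sum_erase_stat [DecidableEq C.X] (z : C.X) :
    ∑ y ∈ Finset.univ.erase z, C.stat y = 1 - C.stat z := by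
  rw [← h.sum_stat, ← Finset.add_sum_erase _ _ (Finset.mem_univ z), add_sub_cancel_left]

/-- The bound is linear in 1 - H_t(x,z), which matters when n losses of order 1/n are multiplied.
Off z, √H √π ≤ H/4 + π; at z, √H √π ≤ (1 + H)/2. -/
lemma aff_le_one_sub {t : ℝ} (ht : 0 ≤ t) (x z : C.X) :
    C.aff t x ≤ 1 - (1 - C.H t x z) / 4 + (1 - C.stat z) := by
  classical
  have h1 : ∑ y ∈ Finset.univ.erase z, √(C.H t x y) * √(C.stat y)
      ≤ ∑ y ∈ Finset.univ.erase z, (C.H t x y / 4 + C.stat y) := by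
    refine Finset.sum_le_sum fun y _ => ?_
    have e1 := Real.sq_sqrt (h.H_nonneg ht x y)
    have e2 := Real.sq_sqrt (h.stat_nonneg y)
    nlinarith [sq_nonneg (√(C.H t x y) / 2 - √(C.stat y))]
  rw [Finset.sum_add_distrib, ← Finset.sum_div, h.sum_erase_H, h.sum_erase_stat] at h1
  have h2 : √(C.H t x z) * √(C.stat z) ≤ (1 + C.H t x z) / 2 := by
    have e1 := Real.sq_sqrt (h.H_nonneg ht x z)
    have e2 : √(C.stat z) ≤ 1 := Real.sqrt_le_iff.2 ⟨zero_le_one, by simpa using h.stat_le_one z⟩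
    have e3 := Real.sqrt_nonneg (C.H t x z)
    nlinarith [sq_nonneg (√(C.H t x z) - 1)]
  rw [aff, tsum_fintype, ← Finset.add_sum_erase _ _ (Finset.mem_univ z)]
  linarith

/-- Cauchy–Schwarz off z; meant for a state that carries almost all of π but has hardly been
reached. -/
lemma aff_le_sqrt_add_sqrt {t : ℝ} (ht : 0 ≤ t) (x z : C.X) :
    C.aff t x ≤ √(C.H t x z) + √(1 - C.stat z) := by
  classical
  have h1 := Real.sum_sqrt_mul_sqrt_le (Finset.univ.erase z) (fun y => h.H_nonneg ht x y)
    h.stat_nonneg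
  rw [h.sum_erase_H, h.sum_erase_stat] at h1
  have h2 : √(1 - C.H t x z) ≤ 1 :=
    Real.sqrt_le_iff.2 ⟨zero_le_one, by linarith [h.H_nonneg ht x z]⟩
  have h3 : √(C.stat z) ≤ 1 := Real.sqrt_le_iff.2 ⟨zero_le_one, by simpa using h.stat_le_one z⟩
  have h4 := Real.sqrt_nonneg (C.H t x z)
  have h5 := Real.sqrt_nonneg (1 - C.stat z)
  rw [aff, tsum_fintype, ← Finset.add_sum_erase _ _ (Finset.mem_univ z)]
  nlinarith

end Chain.IsIrreducibleMarkov

/-! ### Passage from 0 to 2n for a Lacoin chain. -/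

section Lacoin

variable {n : ℕ} {a b : ℝ}

instance lacoinFintype : Fintype (lacoin n a b).X := inferInstanceAs (Fintype (Fin (2 * n + 1)))

/-- The state `2n` of a Lacoin chain. -/
def lacoinTop (n : ℕ) (a b : ℝ) : (lacoin n a b).X := (Fin.last (2 * n) : Fin (2 * n + 1))

/-- The state `0` of a Lacoin chain. -/
def lacoinBot (n : ℕ) (a b : ℝ) : (lacoin n a b).X := (0 : Fin (2 * n + 1))

/-- The probability that a Lacoin chain started from `j` is at `2n` after `k` steps. -/
def lacoinHit (n : ℕ) (a b : ℝ) (k j : ℕ) : ℝ :=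
  if h : j < 2 * n + 1 then
    (lacoin n a b).pow k ((⟨j, h⟩ : Fin (2 * n + 1)) : (lacoin n a b).X) (lacoinTop n a b)
  else 0

lemma pow_eq_lacoinHit (k : ℕ) (x : Fin (2 * n + 1)) :
    (lacoin n a b).pow k x (lacoinTop n a b) = lacoinHit n a b k x := by
  rw [lacoinHit, dif_pos x.2]

lemma lacoinHit_zero {j : ℕ} (hj : j ≤ 2 * n) :
    lacoinHit n a b 0 j = if j = 2 * n then 1 else 0 := by
  rw [lacoinHit, dif_pos (by omega)]
  have h : (⟨j, by omega⟩ : Fin (2 * n + 1)) = lacoinTop n a b ↔ j = 2 * n := Fin.ext_iff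
  rw [Chain.pow]
  by_cases hj2 : j = 2 * n
  · rw [if_pos hj2]
    exact if_pos (h.2 hj2)
  · rw [if_neg hj2]
    exact if_neg (mt h.1 hj2)

lemma lacoinHit_succ (hn : 1 ≤ n) (k : ℕ) {j : ℕ} (hj : j ≤ 2 * n) :
    lacoinHit n a b (k + 1) j
      = (if j ≠ n ∧ j ≠ 2 * n then (1 - a) * lacoinHit n a b k (j + 1) else 0)
      + (if 0 < j then a * lacoinHit n a b k (j - 1) else 0)
      + (if j = 0 then a * lacoinHit n a b k 0 else 0)
      + (if j = n then b * lacoinHit n a b k (n + 1) else 0)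
      + (if j = n then (1 - a - b) * lacoinHit n a b k (2 * n) else 0)
      + (if j = 2 * n then lacoinC n a b * lacoinHit n a b k n else 0)
      + (if j = 2 * n then (1 - a - lacoinC n a b) * lacoinHit n a b k (2 * n) else 0) := by
  have h := sum_lacoin_K (a := a) (b := b) hn ⟨j, by omega⟩ (lacoinHit n a b k)
  rw [← h, lacoinHit, dif_pos (by omega)]
  refine Eq.trans (tsum_fintype (L := SummationFilter.unconditional (Fin (2 * n + 1))) _)
    (Finset.sum_congr rfl fun z _ => ?_)
  exact congrArg _ (pow_eq_lacoinHit k z)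

/-- At `j = 0` the truncated `j - 1 = 0` is exactly the loop, so 0 needs no special treatment. -/
lemma lacoinHit_succ_of_ne (hn : 1 ≤ n) (k : ℕ) {j : ℕ} (hj : j < 2 * n) (hjn : j ≠ n) :
    lacoinHit n a b (k + 1) j
      = (1 - a) * lacoinHit n a b k (j + 1) + a * lacoinHit n a b k (j - 1) := by
  rw [lacoinHit_succ hn k hj.le, if_pos ⟨hjn, hj.ne⟩, if_neg hjn, if_neg hjn, if_neg hj.ne,
    if_neg hj.ne]
  rcases Nat.eq_zero_or_pos j with h | h
  · subst h; simp
  · rw [if_pos h, if_neg h.ne']; ring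

lemma lacoinHit_succ_mid (hn : 1 ≤ n) (k : ℕ) :
    lacoinHit n a b (k + 1) n = a * lacoinHit n a b k (n - 1) + b * lacoinHit n a b k (n + 1)
      + (1 - a - b) * lacoinHit n a b k (2 * n) := by
  rw [lacoinHit_succ hn k (by omega), if_neg (by omega), if_pos (by omega), if_neg (by omega),
    if_pos rfl, if_pos rfl, if_neg (by omega), if_neg (by omega)]
  ring

namespace LacoinParams

variable (h : LacoinParams a b)
include h

lemma lacoinHit_nonneg (hn : 1 ≤ n) (k j : ℕ) : 0 ≤ lacoinHit n a b k j := by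
  rw [lacoinHit]
  split_ifs
  · exact (h.isIrreducibleMarkov hn).pow_nonneg _ _ _
  · exact le_rfl

lemma lacoinHit_le_one (hn : 1 ≤ n) (k j : ℕ) : lacoinHit n a b k j ≤ 1 := by
  rw [lacoinHit]
  split_ifs
  · exact (h.isIrreducibleMarkov hn).pow_le_one _ _ _
  · exact zero_le_one

/-- Each step to the right multiplies the weight by (1-a)/a > 3, except for the step from n, where
the factor b/a merely exceeds 1. The domination lost there is regained at n + 2, which is at most 2n
because n ≥ 2. -/
lemma sum_lacoinWeight_le (hn : 2 ≤ n) :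
    ∑ i ∈ Finset.range (2 * n), lacoinWeight n a b i ≤ 4 * a * lacoinWeight n a b (2 * n) := by
  have ha := h.a_pos
  have hb := h.b_pos
  have hab := h.a_lt_b
  have ha4 := h.a_lt_quarter
  have hW := h.lacoinWeight_pos n
  have h1 : ∀ j ≤ n, ∑ i ∈ Finset.range j, lacoinWeight n a b i ≤ 2 * a * lacoinWeight n a b j := by
    intro j
    induction j with
    | zero => intro _; simpa using by have := hW 0; positivity
    | succ j ih =>
      intro hj
      have e1 := ih (by omega)
      have e2 := h.lacoinWeight_succ (n := n) (j := j) (by omega)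
      rw [Finset.sum_range_succ]
      have e3 : (2 * a + 1) * lacoinWeight n a b j ≤ 2 * (lacoinWeight n a b j * (1 - a)) := by
        nlinarith [hW j]
      rw [← e2] at e3
      linarith
  have h2 : ∑ i ∈ Finset.range (n + 1), lacoinWeight n a b i ≤ 2 * lacoinWeight n a b (n + 1) := by
    have e1 := h1 n le_rfl
    have e2 := h.lacoinWeight_succ_mid (n := n)
    rw [Finset.sum_range_succ]
    have e3 : lacoinWeight n a b n ≤ lacoinWeight n a b (n + 1) := by
      have := hW (n + 1)
      nlinarith
    nlinarith [hW n]
  have h3 : ∀ i, ∑ i ∈ Finset.range (n + 2 + i), lacoinWeight n a b i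
      ≤ 4 * a * lacoinWeight n a b (n + 2 + i) := by
    intro i
    induction i with
    | zero =>
      have e2 := h.lacoinWeight_succ (n := n) (j := n + 1) (by omega)
      rw [add_zero, Finset.sum_range_succ]
      nlinarith [hW (n + 1)]
    | succ i ih =>
      have e2 := h.lacoinWeight_succ (n := n) (j := n + 2 + i) (by omega)
      rw [← add_assoc, Finset.sum_range_succ]
      nlinarith [hW (n + 2 + i)]
  have := h3 (n - 2)
  rwa [show n + 2 + (n - 2) = 2 * n by omega] at this

lemma one_sub_stat_le (hn : 2 ≤ n) :
    1 - 4 * a ≤ (lacoin n a b).stat (lacoinTop n a b) := by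
  have h1 := h.sum_lacoinWeight_le hn
  have hW := h.lacoinWeight_pos n
  have ha := h.a_pos
  have e : (lacoin n a b).stat (lacoinTop n a b)
      = lacoinWeight n a b (2 * n) / ∑ i ∈ Finset.range (2 * n + 1), lacoinWeight n a b i := rfl
  have h0 : 0 ≤ ∑ i ∈ Finset.range (2 * n), lacoinWeight n a b i :=
    Finset.sum_nonneg fun i _ => (hW i).le
  have h2 := hW (2 * n)
  rw [e, Finset.sum_range_succ, le_div_iff₀ (by linarith)]
  nlinarith

/-- For a walk stepping right with probability 1 - a and left with probability a, exp(l · distance)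
is multiplied on average by ρ in each step. The parameter l stays free for a later Chernoff bound,
and η accounts for leaving 2n again. -/
lemma one_sub_lacoinHit_le (hn : 1 ≤ n) {l η : ℝ} (hl : 0 ≤ l)
    (hη : ∀ k, 1 - lacoinHit n a b k (2 * n) ≤ η) (k : ℕ) {j : ℕ} (hj : j ≤ 2 * n) :
    1 - lacoinHit n a b k j
      ≤ Real.exp (l * n) * ((1 - a) * Real.exp (-l) + a * Real.exp l) ^ k + a * k
        + 2 * (b + η) := by
  have ha := h.a_pos
  have hb := h.b_pos
  have ha4 := h.a_lt_quarter
  have hw0 := h.lacoinHit_nonneg hn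
  have hw1 := h.lacoinHit_le_one hn
  have hη0 : 0 ≤ η := (sub_nonneg.2 (hw1 0 (2 * n))).trans (hη 0)
  have hE := Real.exp_pos l
  have hE' := Real.exp_pos (-l)
  set ρ := (1 - a) * Real.exp (-l) + a * Real.exp l with hρ
  have hρ0 : 0 < ρ := by
    have : 0 < 1 - a := by linarith
    positivity
  have hdist : ∀ d : ℕ, Real.exp (l * (d + 1)) * ρ
      = (1 - a) * Real.exp (l * d) + a * Real.exp (l * (d + 2)) := by
    intro d
    rw [hρ, mul_add, mul_left_comm, mul_left_comm _ a, ← Real.exp_add, ← Real.exp_add]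
    congr 3 <;> ring_nf
  have hone : ∀ d : ℕ, 1 ≤ Real.exp (l * d) := fun d => Real.one_le_exp (by positivity)
  -- On 0, …, n, with d the distance to n. At n the chain fails to reach 2n at once or to be there
  -- later at a cost of at most b + η, and a step back to n - 1 costs a · 2(b + η) ≤ b + η: hence
  -- the factor 2.
  have hstep1 : ∀ k d, d ≤ n →
      1 - lacoinHit n a b k (n - d) ≤ Real.exp (l * d) * ρ ^ k + 2 * (b + η) := by
    intro k
    induction k with
    | zero =>
      intro d _
      have := hw0 0 (n - d)
      have := hone d
      rw [pow_zero, mul_one]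
      linarith
    | succ k ih =>
      intro d hd
      have hρk : 0 < ρ ^ k := by positivity
      rcases Nat.eq_zero_or_pos d with h0 | h0
      · subst h0
        have e1 := ih 1 hn
        have e2 := hw0 k (n + 1)
        have e3 := hη k
        rw [Nat.sub_zero, lacoinHit_succ_mid hn k, pow_succ', Nat.cast_zero, mul_zero,
          Real.exp_zero, one_mul, hρ]
        rw [Nat.cast_one, mul_one] at e1
        have e4 : 0 < Real.exp (-l) * ρ ^ k := by positivity
        have e5 : 0 ≤ (1 - a) * (Real.exp (-l) * ρ ^ k) := mul_nonneg (by linarith) e4.le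
        have e6 : (1 - a - b) * (1 - lacoinHit n a b k (2 * n)) ≤ η := by
          have : 1 - a - b ≤ 1 := by linarith
          have : 0 ≤ 1 - a - b := by linarith [h.add_lt]
          nlinarith [hw1 k (2 * n)]
        nlinarith
      · obtain ⟨i, rfl⟩ := Nat.exists_eq_add_of_le' h0
        have e1 := ih i (by omega)
        rw [lacoinHit_succ_of_ne hn k (by omega) (by omega),
          show n - (i + 1) + 1 = n - i by omega, pow_succ', ← mul_assoc]
        push_cast
        rw [hdist i, add_mul]
        have e2 : 1 - lacoinHit n a b k (n - (i + 1) - 1)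
            ≤ Real.exp (l * (i + 2)) * ρ ^ k + 2 * (b + η) := by
          by_cases hi : i + 2 ≤ n
          · have := ih (i + 2) hi
            rw [show n - (i + 1) - 1 = n - (i + 2) by omega]
            push_cast at this
            exact this
          -- At state 0 the step to the left is the loop.
          · have := ih (i + 1) hd
            rw [show n - (i + 1) - 1 = n - (i + 1) by omega]
            refine this.trans (add_le_add_left (mul_le_mul_of_nonneg_right
              (Real.exp_le_exp.2 (mul_le_mul_of_nonneg_left ?_ hl)) hρk.le) _)
            push_cast
            linarith
        have e3 : 0 ≤ 1 - a := by linarith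
        have e4 := mul_le_mul_of_nonneg_left e1 e3
        have e5 := mul_le_mul_of_nonneg_left e2 ha.le
        linarith
  -- On the detour, with d the distance to 2n. Falling back from n + 1 to n is counted as failure;
  -- it has probability at most a in each step, which produces the term a k.
  have hstep2 : ∀ k d, d < n →
      1 - lacoinHit n a b k (2 * n - d) ≤ Real.exp (l * d) * ρ ^ k + a * k + η := by
    intro k
    induction k with
    | zero =>
      intro d _
      have := hw0 0 (2 * n - d)
      have := hone d
      rw [pow_zero, mul_one, Nat.cast_zero]
      linarith
    | succ k ih =>
      intro d hd
      have hρk : 0 < ρ ^ k := by positivity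
      rcases Nat.eq_zero_or_pos d with h0 | h0
      · subst h0
        rw [Nat.sub_zero]
        have := hη (k + 1)
        have : 0 ≤ Real.exp (l * (0 : ℕ)) * ρ ^ (k + 1) + a * ((k + 1 : ℕ) : ℝ) := by positivity
        linarith
      · obtain ⟨i, rfl⟩ := Nat.exists_eq_add_of_le' h0
        have e1 := ih i (by omega)
        rw [lacoinHit_succ_of_ne hn k (by omega) (by omega),
          show 2 * n - (i + 1) + 1 = 2 * n - i by omega, pow_succ', ← mul_assoc]
        push_cast
        rw [hdist i, add_mul]
        have e3 : 0 ≤ 1 - a := by linarith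
        have e4 := mul_le_mul_of_nonneg_left e1 e3
        have hak : 0 ≤ a * (k : ℝ) := by positivity
        by_cases hi : i + 2 < n
        · have e2 := ih (i + 2) hi
          rw [show 2 * n - (i + 1) - 1 = 2 * n - (i + 2) by omega]
          push_cast at e2
          have e5 := mul_le_mul_of_nonneg_left e2 ha.le
          linarith
        · have e2 : 1 - lacoinHit n a b k (2 * n - (i + 1) - 1) ≤ 1 := by
            linarith [hw0 k (2 * n - (i + 1) - 1)]
          have e5 := mul_le_mul_of_nonneg_left e2 ha.le
          have e6 : 0 ≤ a * Real.exp (l * (i + 2)) * ρ ^ k := by positivity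
          nlinarith
  have hak : 0 ≤ a * (k : ℝ) := by positivity
  have hmono : ∀ d : ℕ, d ≤ n → Real.exp (l * d) * ρ ^ k ≤ Real.exp (l * n) * ρ ^ k := by
    intro d hd
    have : (d : ℝ) ≤ n := by exact_mod_cast hd
    gcongr
  rcases le_or_gt j n with hjn | hjn
  · have e1 := hstep1 k (n - j) (by omega)
    rw [show n - (n - j) = j by omega] at e1
    have e2 := hmono (n - j) (by omega)
    linarith
  · have e1 := hstep2 k (2 * n - j) (by omega)
    rw [show 2 * n - (2 * n - j) = j by omega] at e1
    have e2 := hmono (2 * n - j) (by omega)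
    linarith

/-- One step reduces the distance to n by at most 1, so the bound e^(-l(n-j)) grows at most by the
factor e^l. In this exponential form it can be averaged over the Poisson number of steps. -/
lemma lacoinHit_le_exp (hn : 1 ≤ n) {l : ℝ} (hl : 0 ≤ l) (k : ℕ) {j : ℕ} (hj : j ≤ n) :
    lacoinHit n a b k j ≤ Real.exp (-(l * (n - j))) * Real.exp l ^ k := by
  have ha := h.a_pos
  have ha4 := h.a_lt_quarter
  have hw1 := h.lacoinHit_le_one hn
  induction k generalizing j with
  | zero =>
    rw [lacoinHit_zero (by omega), if_neg (by omega)]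
    positivity
  | succ k ih =>
    rcases hj.eq_or_lt with rfl | hj
    · refine (hw1 _ _).trans ?_
      rw [sub_self, mul_zero, neg_zero, Real.exp_zero, one_mul]
      exact one_le_pow₀ (Real.one_le_exp hl)
    · have e1 := ih (j := j + 1) hj
      have e2 := ih (j := j - 1) (by omega)
      have e3 : Real.exp (-(l * (n - (j + 1 : ℕ)))) * Real.exp l ^ k
          = Real.exp (-(l * (n - j))) * Real.exp l ^ (k + 1) := by
        rw [pow_succ', ← mul_assoc, ← Real.exp_add]
        congr 2
        push_cast
        ring
      have e4 : Real.exp (-(l * (n - (j - 1 : ℕ)))) ≤ Real.exp (-(l * (n - (j + 1 : ℕ)))) := by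
        apply Real.exp_le_exp.2
        have : ((j - 1 : ℕ) : ℝ) ≤ ((j + 1 : ℕ) : ℝ) := by exact_mod_cast (by omega)
        nlinarith
      have e5 : Real.exp (-(l * (n - (j - 1 : ℕ)))) * Real.exp l ^ k
          ≤ Real.exp (-(l * (n - (j + 1 : ℕ)))) * Real.exp l ^ k := by gcongr
      rw [lacoinHit_succ_of_ne hn k (by omega) hj.ne, ← e3]
      have e6 : 0 ≤ 1 - a := by linarith
      nlinarith

/-- From n the detour is entered with probability b, and along it the whole distance up to 2n must
be walked. Left steps on the detour, which could give another chance to jump, cost at most a each.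
-/
lemma lacoinHit_le_slow (hn : 1 ≤ n) {l : ℝ} (hl : 0 ≤ l) (k : ℕ) {j : ℕ} (hj : j ≤ 2 * n) :
    lacoinHit n a b k j ≤ (if j ≤ n then 1 - b else 0)
      + Real.exp (-(l * (2 * n - j))) * Real.exp l ^ k + a * k := by
  have ha := h.a_pos
  have hb := h.b_pos
  have hab := h.add_lt
  have ha4 := h.a_lt_quarter
  have hw1 := h.lacoinHit_le_one hn
  have h1b : 0 ≤ 1 - b := by linarith
  induction k generalizing j with
  | zero =>
    rw [lacoinHit_zero (by omega), pow_zero, mul_one, Nat.cast_zero, mul_zero, add_zero]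
    have h0 := Real.exp_pos (-(l * (2 * n - j)))
    split_ifs with h1 h2 h2
    · omega
    · rw [h1]; simp
    · linarith
    · linarith
  | succ k ih =>
    have hak : 0 ≤ a * (k : ℝ) := by positivity
    have hk : 0 < Real.exp l ^ k := by positivity
    rcases hj.eq_or_lt with rfl | hj
    · refine (hw1 _ _).trans ?_
      have : 1 ≤ Real.exp l ^ (k + 1) := one_le_pow₀ (Real.one_le_exp hl)
      have e : Real.exp (-(l * (2 * n - ((2 * n : ℕ) : ℝ)))) = 1 := by
        push_cast
        simp
      rw [e, if_neg (by omega)]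
      push_cast
      linarith
    · have e3 : Real.exp (-(l * (2 * n - (j + 1 : ℕ)))) * Real.exp l ^ k
          = Real.exp (-(l * (2 * n - j))) * Real.exp l ^ (k + 1) := by
        rw [pow_succ', ← mul_assoc, ← Real.exp_add]
        congr 2
        push_cast
        ring
      have e5 : Real.exp (-(l * (2 * n - (j - 1 : ℕ)))) * Real.exp l ^ k
          ≤ Real.exp (-(l * (2 * n - (j + 1 : ℕ)))) * Real.exp l ^ k := by
        gcongr
        omega
      have e7 : 0 < Real.exp (-(l * (2 * n - (j + 1 : ℕ)))) * Real.exp l ^ k := by positivity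
      have e1 := ih (j := j + 1) hj
      rcases eq_or_ne j n with rfl | hjn
      · have e2 := ih (j := j - 1) (by omega)
        rw [if_pos (by omega)] at e2
        rw [if_neg (by omega)] at e1
        rw [lacoinHit_succ_mid hn k, if_pos le_rfl, ← e3]
        have e8 := hw1 k (2 * j)
        set X := Real.exp (-(l * (2 * j - (j + 1 : ℕ)))) * Real.exp l ^ k
        push_cast
        have f1 : a * lacoinHit j a b k (j - 1) ≤ a * (1 - b + X + a * k) :=
          mul_le_mul_of_nonneg_left (by linarith) ha.le
        have f2 : b * lacoinHit j a b k (j + 1) ≤ b * (X + a * k) :=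
          mul_le_mul_of_nonneg_left (by linarith) hb.le
        have f3 : (1 - a - b) * lacoinHit j a b k (2 * j) ≤ 1 - a - b :=
          mul_le_of_le_one_right (by linarith) e8
        have f4 : (a + b) * (X + a * k) ≤ X + a * k :=
          mul_le_of_le_one_left (by positivity) (by linarith)
        nlinarith
      · rw [lacoinHit_succ_of_ne hn k hj hjn, ← e3]
        set X := Real.exp (-(l * (2 * n - (j + 1 : ℕ)))) * Real.exp l ^ k
        have h1a : 0 ≤ 1 - a := by linarith
        have f0 : (if j + 1 ≤ n then 1 - b else 0) = if j ≤ n then 1 - b else 0 := by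
          congr 1
          simp only [eq_iff_iff]
          omega
        rw [f0] at e1
        have f1 := mul_le_mul_of_nonneg_left e1 h1a
        push_cast
        by_cases hle : j ≤ n
        · have e2 := ih (j := j - 1) (by omega)
          rw [if_pos (by omega)] at e2
          rw [if_pos hle] at f1 ⊢
          have f2 : a * lacoinHit n a b k (j - 1) ≤ a * (1 - b + X + a * k) :=
            mul_le_mul_of_nonneg_left (by linarith) ha.le
          nlinarith
        · rw [if_neg hle] at f1 ⊢
          have f2 : a * lacoinHit n a b k (j - 1) ≤ a * 1 :=
            mul_le_mul_of_nonneg_left (hw1 _ _) ha.le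
          nlinarith

lemma one_sub_H_lacoin_le (hn : 2 ≤ n) (ha : a ≤ 1 / 8) {l t : ℝ} (hl : 0 ≤ l) (ht : 0 ≤ t)
    (x : (lacoin n a b).X) :
    1 - (lacoin n a b).H t x (lacoinTop n a b)
      ≤ Real.exp (l * n - t * (1 - ((1 - a) * Real.exp (-l) + a * Real.exp l))) + a * t
        + 2 * b + 16 * a := by
  have hM := h.isIrreducibleMarkov (n := n) (by omega)
  have hs := h.one_sub_stat_le hn
  -- 2n has stationary mass at least 1 - 4a, so stationarity bounds the failure to be at 2n when
  -- started there by twice 4a; a ≤ 1/8 keeps 4a below 1/2.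
  have h1 : ∀ k, 1 - lacoinHit n a b k (2 * n) ≤ 8 * a := by
    intro k
    have e := hM.one_sub_pow_self_le k (z := lacoinTop n a b) (δ := 4 * a) (by linarith) hs
    have e2 : (lacoin n a b).pow k (lacoinTop n a b) (lacoinTop n a b) = lacoinHit n a b k (2 * n) :=
      pow_eq_lacoinHit k (Fin.last (2 * n))
    rw [e2] at e
    linarith
  have h2 := Chain.IsIrreducibleMarkov.one_sub_H_le_of_pow ht (x := x) (y := lacoinTop n a b)
    (α := Real.exp (l * n)) (ρ := (1 - a) * Real.exp (-l) + a * Real.exp l) (β := a)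
    (γ := 2 * (b + 8 * a)) fun k => ?_
  · rw [← Real.exp_add, neg_mul, ← sub_eq_add_neg] at h2
    linarith
  · have e : (lacoin n a b).pow k x (lacoinTop n a b)
        = lacoinHit n a b k (Fin.val (n := 2 * n + 1) x) := pow_eq_lacoinHit k x
    rw [e]
    exact h.one_sub_lacoinHit_le (by omega) hl h1 k
      (Nat.lt_succ_iff.1 (Fin.is_lt (n := 2 * n + 1) x))

lemma H_lacoin_bot_le (hn : 1 ≤ n) {l t : ℝ} (hl : 0 ≤ l) (ht : 0 ≤ t) :
    (lacoin n a b).H t (lacoinBot n a b) (lacoinTop n a b)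
      ≤ Real.exp (t * (Real.exp l - 1) - l * n) := by
  have h1 := Chain.IsIrreducibleMarkov.H_le_of_pow_le (C := lacoin n a b) (x := lacoinBot n a b)
    (y := lacoinTop n a b) (α := Real.exp (-(l * n))) (ρ := Real.exp l) (β := 0) (γ := 0) ht ?_
  · rw [← Real.exp_add, zero_mul, add_zero, add_zero] at h1
    refine h1.trans_eq ?_
    congr 1
    ring
  · intro k
    have e : (lacoin n a b).pow k (lacoinBot n a b) (lacoinTop n a b) = lacoinHit n a b k 0 :=
      pow_eq_lacoinHit k 0
    have := h.lacoinHit_le_exp hn hl k (Nat.zero_le n)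
    rw [Nat.cast_zero, sub_zero] at this
    rw [e]
    linarith

lemma H_lacoin_bot_le_slow (hn : 1 ≤ n) {l t : ℝ} (hl : 0 ≤ l) (ht : 0 ≤ t) :
    (lacoin n a b).H t (lacoinBot n a b) (lacoinTop n a b)
      ≤ 1 - b + Real.exp (t * (Real.exp l - 1) - l * (2 * n)) + a * t := by
  have h1 := Chain.IsIrreducibleMarkov.H_le_of_pow_le (C := lacoin n a b) (x := lacoinBot n a b)
    (y := lacoinTop n a b) (α := Real.exp (-(l * (2 * n)))) (ρ := Real.exp l) (β := a)
    (γ := 1 - b) ht ?_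
  · rw [← Real.exp_add, show -(l * (2 * n)) + -t * (1 - Real.exp l)
      = t * (Real.exp l - 1) - l * (2 * n) by ring] at h1
    linarith
  · intro k
    have e : (lacoin n a b).pow k (lacoinBot n a b) (lacoinTop n a b) = lacoinHit n a b k 0 :=
      pow_eq_lacoinHit k 0
    have := h.lacoinHit_le_slow hn hl k (Nat.zero_le (2 * n))
    rw [Nat.cast_zero, sub_zero, if_pos (Nat.zero_le n)] at this
    rw [e]
    linarith

end LacoinParams

end Lacoin

end
end ProductCutoff

namespace ProductCutoff
noncomputable section

/-! ### Row by row enumeration of a triangular array. -/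

section Triangle

lemma triangle_succ (m : ℕ) : (m + 1) * (m + 1 + 1) / 2 = m * (m + 1) / 2 + (m + 1) := by
  rw [show (m + 1) * (m + 1 + 1) = m * (m + 1) + (m + 1) * 2 by ring,
    Nat.add_mul_div_right _ _ two_pos]

lemma triangle_mono : Monotone fun m : ℕ => m * (m + 1) / 2 :=
  monotone_nat_of_le_succ fun m => by
    have := triangle_succ m
    omega

lemma exists_eq_triangle_add (k : ℕ) : ∃ m i, i ≤ m ∧ k = m * (m + 1) / 2 + i := by
  set m := Nat.findGreatest (fun n => n * (n + 1) / 2 ≤ k) k with hm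
  have h1 : m * (m + 1) / 2 ≤ k :=
    Nat.findGreatest_spec (P := fun n => n * (n + 1) / 2 ≤ k) (Nat.zero_le k) (by simp)
  have h2 : k < (m + 1) * (m + 1 + 1) / 2 := by
    by_cases hk : m + 1 ≤ k
    · exact not_le.1 (Nat.findGreatest_is_greatest (P := fun n => n * (n + 1) / 2 ≤ k)
        (Nat.lt_succ_self m) hk)
    · rw [triangle_succ]
      omega
  rw [triangle_succ] at h2
  exact ⟨m, k - m * (m + 1) / 2, by omega, by omega⟩

lemma triRow_triangle_add {m i : ℕ} (hi : i ≤ m) : triRow (m * (m + 1) / 2 + i) = m + 1 := by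
  rw [triRow, Nat.add_right_cancel_iff, Nat.findGreatest_eq_iff]
  refine ⟨?_, fun _ => Nat.le_add_right _ _, fun n hn _ => ?_⟩
  · have : ∀ m : ℕ, m ≤ m * (m + 1) / 2 := by
      intro m
      rcases Nat.eq_zero_or_pos m with rfl | h
      · simp
      · rw [Nat.le_div_iff_mul_le two_pos]
        exact Nat.mul_le_mul_left m (by omega)
    have := this m
    omega
  · have h1 := triangle_mono (show m + 1 ≤ n from hn)
    simp only at h1
    rw [triangle_succ] at h1
    omega

lemma triCol_triangle_add {m i : ℕ} (hi : i ≤ m) : triCol (m * (m + 1) / 2 + i) = i + 1 := by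
  rw [triCol, triRow_triangle_add hi, Nat.add_sub_cancel, Nat.add_sub_cancel_left]

lemma triCol_mem (k : ℕ) : 1 ≤ triCol k ∧ triCol k ≤ triRow k := by
  obtain ⟨m, i, hi, rfl⟩ := exists_eq_triangle_add k
  rw [triRow_triangle_add hi, triCol_triangle_add hi]
  omega

lemma one_le_triRow (k : ℕ) : 1 ≤ triRow k := (triCol_mem k).1.trans (triCol_mem k).2

lemma tendsto_triRow : Tendsto triRow atTop atTop := by
  rw [tendsto_atTop]
  intro M
  filter_upwards [eventually_ge_atTop (M * (M + 1) / 2)] with k hk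
  obtain ⟨m, i, hi, rfl⟩ := exists_eq_triangle_add k
  rw [triRow_triangle_add hi]
  by_contra hlt
  have h1 := triangle_mono (show m + 1 ≤ M by omega)
  simp only at h1
  rw [triangle_succ] at h1
  omega

lemma prod_range_triangle (f : ℕ → ℝ) (M : ℕ) :
    ∏ k ∈ Finset.range (M * (M + 1) / 2), f k
      = ∏ m ∈ Finset.range M, ∏ i ∈ Finset.range (m + 1), f (m * (m + 1) / 2 + i) := by
  induction M with
  | zero => simp
  | succ M ih =>
    rw [triangle_succ, Finset.prod_range_add, ih,
      Finset.prod_range_succ fun m => ∏ i ∈ Finset.range (m + 1), f (m * (m + 1) / 2 + i)]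

lemma rowSum_eq_sum_range (p : ℕ → ℕ → ℝ) (n : ℕ) :
    rowSum p n = ∑ i ∈ Finset.range n, p n (i + 1) := by
  rw [rowSum, Finset.range_eq_Ico, Finset.sum_Ico_add' (fun i => p n i) 0 n 1]
  rfl

lemma rowMin_le (p : ℕ → ℕ → ℝ) {n i : ℕ} (h1 : 1 ≤ i) (h2 : i ≤ n) : rowMin p n ≤ p n i :=
  csInf_le ((Set.finite_Icc 1 n).image _).bddBelow ⟨i, ⟨h1, h2⟩, rfl⟩

lemma le_rowMax (p : ℕ → ℕ → ℝ) {n i : ℕ} (h1 : 1 ≤ i) (h2 : i ≤ n) : p n i ≤ rowMax p n :=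
  le_csSup ((Set.finite_Icc 1 n).image _).bddAbove ⟨i, ⟨h1, h2⟩, rfl⟩

end Triangle

/-! ### Cutoff of the single Lacoin chains. -/

namespace LacoinArrays

variable {a b p : ℕ → ℕ → ℝ} (h : LacoinArrays a b p)
include h

lemma params {n i : ℕ} (h1 : 1 ≤ i) (h2 : i ≤ n) : LacoinParams (a n i) (b n i) :=
  ⟨h.a_pos n i h1 h2, h.a_lt_b n i h1 h2, h.a_add_b n i h1 h2⟩

lemma isIrreducibleMarkov {n i : ℕ} (h1 : 1 ≤ i) (h2 : i ≤ n) :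
    (lacoin n (a n i) (b n i)).IsIrreducibleMarkov :=
  (h.params h1 h2).isIrreducibleMarkov (h1.trans h2)

lemma hasLaws {n i : ℕ} (h1 : 1 ≤ i) (h2 : i ≤ n) : (lacoin n (a n i) (b n i)).HasLaws :=
  (h.isIrreducibleMarkov h1 h2).hasLaws

lemma family_isIrreducibleMarkov (k : ℕ) : (lacoinFamily a b k).IsIrreducibleMarkov :=
  h.isIrreducibleMarkov (triCol_mem k).1 (triCol_mem k).2

lemma family_hasLaws (k : ℕ) : (lacoinFamily a b k).HasLaws :=
  h.hasLaws (triCol_mem k).1 (triCol_mem k).2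

lemma rowMin_pos {n : ℕ} (hn : 1 ≤ n) : 0 < rowMin p n := by
  have hne : (p n '' Set.Icc 1 n).Nonempty := ⟨_, 1, ⟨le_rfl, hn⟩, rfl⟩
  obtain ⟨i, hi, he⟩ := hne.csInf_mem ((Set.finite_Icc 1 n).image _)
  rw [rowMin, ← he]
  exact h.p_pos n i hi.1 hi.2

lemma rowSum_pos {n : ℕ} (hn : 1 ≤ n) : 0 < rowSum p n :=
  Finset.sum_pos (fun i hi => h.p_pos n i (Finset.mem_Icc.1 hi).1 (Finset.mem_Icc.1 hi).2)
    ⟨1, Finset.mem_Icc.2 ⟨le_rfl, hn⟩⟩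

/-- The row sum cancels. Up to a ratio p/min p close to 1, the chains of row n run for time n · s
e^(-n^α), so they reach their cutoff time n when s is about e^(n^α). -/
lemma weights_triangle_add (α : ℝ) {m i : ℕ} (hi : i ≤ m) :
    lacoinWeights p α (m * (m + 1) / 2 + i)
      = p (m + 1) (i + 1) / rowMin p (m + 1)
        * (((m + 1 : ℕ) : ℝ) * Real.exp (-((m + 1 : ℕ) : ℝ) ^ α)) := by
  have h1 := h.rowMin_pos (n := m + 1) (by omega)
  have h2 := h.rowSum_pos (n := m + 1) (by omega)
  rw [lacoinWeights, triRow_triangle_add hi, triCol_triangle_add hi, lacoinR]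
  field_simp

lemma weights_pos (α : ℝ) (k : ℕ) : 0 < lacoinWeights p α k := by
  obtain ⟨m, i, hi, rfl⟩ := exists_eq_triangle_add k
  have h1 := h.rowMin_pos (n := m + 1) (by omega)
  have h2 := h.p_pos (m + 1) (i + 1) (by omega) (by omega)
  rw [h.weights_triangle_add α hi]
  positivity

lemma exists_a_le : ∃ D, 0 < D ∧ ∀ n i, 1 ≤ i → i ≤ n → a n i ≤ D / (n : ℝ) ^ 2 := by
  obtain ⟨D, hD⟩ := h.a_bound
  refine ⟨D, ?_, hD⟩
  have h1 := hD 1 1 le_rfl le_rfl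
  have h2 := h.a_pos 1 1 le_rfl le_rfl
  norm_num at h1
  linarith

/-- From every state, the chains of row `n` are at `2n` at times `A * n` with probability
`1 - O(1/n)`, if `A > 1`. -/
lemma exists_one_sub_H_le {A : ℝ} (hA : 1 < A) :
    ∃ D, 0 < D ∧ ∀ n i, 1 ≤ i → i ≤ n → ∀ x,
      1 - (lacoin n (a n i) (b n i)).H (A * n) x (lacoinTop n (a n i) (b n i)) ≤ D / n := by
  obtain ⟨Ca, hCa0, hCa⟩ := h.exists_a_le
  obtain ⟨Cb, hCb1, hCb⟩ := h.b_bound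
  set l : ℝ := (1 - A⁻¹) / 2 with hl
  have hA0 : 0 < A := by linarith
  have hAi : A⁻¹ < 1 := inv_lt_one_of_one_lt₀ hA
  have hAi0 : 0 < A⁻¹ := by positivity
  have hl0 : 0 < l := by rw [hl]; linarith
  have hl1 : l ≤ 1 := by rw [hl]; linarith
  have hexp : Real.exp (-l) ≤ 1 - l + l ^ 2 := by
    have := (abs_le.1 (Real.abs_exp_sub_one_sub_id_le (x := -l)
      (by rw [abs_neg, abs_of_pos hl0]; exact hl1))).2
    rw [neg_sq] at this
    linarith
  set γ : ℝ := A * (1 - Real.exp (-l)) - l with hγ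
  have hγ0 : 0 < γ := by
    have h1 : A * (l - l ^ 2) ≤ A * (1 - Real.exp (-l)) :=
      mul_le_mul_of_nonneg_left (by linarith) hA0.le
    have h2 : A * (1 - l) = (A + 1) / 2 := by
      rw [hl]
      field_simp
      ring
    have h3 : A * (l - l ^ 2) = l * ((A + 1) / 2) := by rw [← h2]; ring
    have h4 : l < l * ((A + 1) / 2) := lt_mul_of_one_lt_right hl0 (by linarith)
    rw [hγ]
    linarith
  set K : ℝ := A * Ca * Real.exp l with hK
  have hK0 : 0 < K := by positivity
  -- Below N the claim is trivial, since the final constant exceeds N; from N on, n ≥ 2 and a ≤ 1/8.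
  set N : ℝ := 8 * Ca + 2 with hN
  refine ⟨Real.exp K / γ + A * Ca + 2 * Cb + 16 * Ca + N, by positivity, fun n i h1 h2 x => ?_⟩
  have hP := h.params h1 h2
  have hn : (1 : ℝ) ≤ n := by exact_mod_cast h1.trans h2
  have hn0 : (0 : ℝ) < n := by linarith
  have ha := hCa n i h1 h2
  have hb := (hCb n i h1 h2).2
  have hapos := hP.a_pos
  rw [le_div_iff₀ hn0]
  rcases lt_or_ge (n : ℝ) N with hnN | hnN
  · have h3 := (h.isIrreducibleMarkov h1 h2).H_nonneg (t := A * n) (by positivity) x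
      (lacoinTop n (a n i) (b n i))
    have h4 : 0 < Real.exp K / γ + A * Ca + 2 * Cb + 16 * Ca := by positivity
    nlinarith
  · have hn2 : 2 ≤ n := by
      have : (2 : ℝ) ≤ n := by linarith
      exact_mod_cast this
    have han : a n i * n ≤ Ca / n := by
      calc a n i * n ≤ Ca / (n : ℝ) ^ 2 * n := by gcongr
        _ = Ca / n := by field_simp
    have han' : a n i * n * n ≤ Ca := by
      rwa [le_div_iff₀ hn0] at han
    have ha8 : a n i ≤ 1 / 8 := by
      have : a n i * n ≤ a n i * n * n := le_mul_of_one_le_right (by positivity) hn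
      nlinarith
    have h3 := hP.one_sub_H_lacoin_le hn2 ha8 (t := A * n) hl0.le (by positivity) x
    set E := Real.exp (l * n - A * n * (1 - ((1 - a n i) * Real.exp (-l) + a n i * Real.exp l)))
      with hE
    have hEle : E ≤ Real.exp K * Real.exp (-(γ * n)) := by
      rw [hE, ← Real.exp_add]
      apply Real.exp_le_exp.2
      have e1 : a n i * n * (A * Real.exp l) ≤ Ca * (A * Real.exp l) := by
        gcongr
        exact (le_mul_of_one_le_right (by positivity) hn).trans han'
      have e2 : 0 < a n i * Real.exp (-l) * (A * n) := by positivity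
      rw [hγ, hK]
      nlinarith
    have hEn : E * n ≤ Real.exp K / γ := by
      rw [le_div_iff₀ hγ0]
      have e1 : γ * n * Real.exp (-(γ * n)) ≤ 1 := by
        rw [Real.exp_neg, ← div_eq_mul_inv, div_le_one (Real.exp_pos _)]
        linarith [Real.add_one_le_exp (γ * n)]
      have e3 : 0 ≤ γ * n := by positivity
      calc E * n * γ = E * (γ * n) := by ring
        _ ≤ Real.exp K * Real.exp (-(γ * n)) * (γ * n) := by gcongr
        _ = Real.exp K * (γ * n * Real.exp (-(γ * n))) := by ring
        _ ≤ Real.exp K := mul_le_of_le_one_right (Real.exp_pos _).le e1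
    have hbn : b n i * n ≤ Cb := by rwa [le_div_iff₀ hn0] at hb
    have han1 : a n i * n ≤ Ca := (le_mul_of_one_le_right (by positivity) hn).trans han'
    have hfin := mul_le_mul_of_nonneg_right h3 hn0.le
    have e4 : A * (a n i * n * n) ≤ A * Ca := by gcongr
    have e5 : 0 < N := by positivity
    nlinarith

lemma exists_concentration {A : ℝ} (hA : 1 < A) :
    ∃ D, 0 < D ∧ ∀ n i, 1 ≤ i → i ≤ n → ∀ x,
      1 - (lacoin n (a n i) (b n i)).H (A * n) x (lacoinTop n (a n i) (b n i)) ≤ D / n ∧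
      (lacoin n (a n i) (b n i)).tv (A * n) x ≤ D / n := by
  obtain ⟨D, hD0, hD⟩ := h.exists_one_sub_H_le hA
  obtain ⟨Ca, hCa0, hCa⟩ := h.exists_a_le
  -- The summand 1 makes the bound trivial for n = 1, where no estimate of the stationary mass at 2n
  -- is available.
  refine ⟨D + 4 * Ca + 1, by positivity, fun n i h1 h2 x => ?_⟩
  have hn : (1 : ℝ) ≤ n := by exact_mod_cast h1.trans h2
  have hn0 : (0 : ℝ) < n := by linarith
  have h3 := hD n i h1 h2 x
  have hAn : 0 ≤ A * n := by positivity
  refine ⟨h3.trans (by gcongr; linarith), ?_⟩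
  rcases lt_or_ge n 2 with hn2 | hn2
  · have hn1 : n = 1 := by
      have := h1.trans h2
      omega
    refine ((h.isIrreducibleMarkov h1 h2).tv_le_one hAn x).trans ?_
    rw [le_div_iff₀ hn0, hn1, Nat.cast_one]
    linarith
  · refine ((h.isIrreducibleMarkov h1 h2).tv_le_of_concentrated hAn _ x (sub_le_comm.1 h3)
      ((h.params h1 h2).one_sub_stat_le hn2)).trans ?_
    have h4 : a n i ≤ Ca / n := (hCa n i h1 h2).trans (by
      gcongr
      nlinarith)
    rw [add_div, add_div]
    have h5 : 4 * a n i ≤ 4 * Ca / n := by rw [mul_div_assoc]; gcongr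
    have h6 : 0 < 1 / (n : ℝ) := by positivity
    linarith

lemma exists_minAff_le {A : ℝ} (hA0 : 0 < A) (hA : A < 1) :
    ∃ D γ, 0 < γ ∧ ∀ n i, 1 ≤ i → i ≤ n → 2 ≤ n →
      (lacoin n (a n i) (b n i)).minAff (A * n) ≤ √(Real.exp (-(γ * n))) + √(D / n) := by
  obtain ⟨Ca, hCa0, hCa⟩ := h.exists_a_le
  -- Then A(e^l - 1) ≤ (1-l)(l + l²) = l(1 - l²) < l, so the Chernoff exponent is negative.
  set l : ℝ := 1 - A with hl
  have hl0 : 0 < l := by rw [hl]; linarith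
  have hl1 : l ≤ 1 := by rw [hl]; linarith
  have hexp : Real.exp l - 1 ≤ l + l ^ 2 := by
    have := (abs_le.1 (Real.abs_exp_sub_one_sub_id_le (x := l)
      (by rw [abs_of_pos hl0]; exact hl1))).2
    linarith
  refine ⟨4 * Ca, l - A * (Real.exp l - 1), ?_, fun n i h1 h2 hn2 => ?_⟩
  · have e1 : A * (Real.exp l - 1) ≤ A * (l + l ^ 2) := by gcongr
    have e2 : A * (l + l ^ 2) = l * (1 - l ^ 2) := by
      rw [show A = 1 - l by rw [hl]; ring]
      ring
    have e3 : l * (1 - l ^ 2) < l := mul_lt_of_lt_one_right hl0 (by nlinarith)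
    linarith
  · have hn : (1 : ℝ) ≤ n := by exact_mod_cast h1.trans h2
    have hn0 : (0 : ℝ) < n := by linarith
    have hAn : 0 ≤ A * n := by positivity
    have hP := h.params h1 h2
    refine ((h.hasLaws h1 h2).minAff_le _ (lacoinBot n (a n i) (b n i))).trans
      (((h.isIrreducibleMarkov h1 h2).aff_le_sqrt_add_sqrt hAn _
        (lacoinTop n (a n i) (b n i))).trans (add_le_add (Real.sqrt_le_sqrt ?_)
          (Real.sqrt_le_sqrt ?_)))
    · refine (hP.H_lacoin_bot_le (h1.trans h2) hl0.le hAn).trans_eq ?_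
      congr 1
      ring
    · have e1 := hP.one_sub_stat_le hn2
      have h4 : a n i ≤ Ca / n := (hCa n i h1 h2).trans (by
        gcongr
        nlinarith)
      rw [mul_div_assoc]
      linarith

lemma cutoffAff_family : CutoffAff (lacoinFamily a b) := by
  have hrow : Tendsto (fun k => (triRow k : ℝ)) atTop atTop :=
    tendsto_natCast_atTop_atTop.comp tendsto_triRow
  refine ⟨fun k => triRow k, fun k => Nat.cast_pos.2 (one_le_triRow k), fun A hA => ?_,
    fun A hA0 hA => ?_⟩
  · obtain ⟨D, _, hD⟩ := h.exists_concentration hA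
    have hB := (hrow.const_div_atTop D).const_sub 1
    rw [sub_zero] at hB
    refine tendsto_of_tendsto_of_tendsto_of_le_of_le hB tendsto_const_nhds (fun k => ?_) fun k => ?_
    · exact (h.family_hasLaws k).one_sub_le_minAff (by positivity)
        fun x => (hD _ _ (triCol_mem k).1 (triCol_mem k).2 x).2
    · exact (h.family_hasLaws k).minAff_le_one (by positivity)
  · obtain ⟨D, γ, hγ, hD⟩ := h.exists_minAff_le hA0 hA
    have hB1 : Tendsto (fun k => √(Real.exp (-(γ * triRow k)))) atTop (𝓝 0) := by
      rw [← Real.sqrt_zero]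
      exact (Real.tendsto_exp_atBot.comp
        (tendsto_neg_atTop_atBot.comp (hrow.const_mul_atTop hγ))).sqrt
    have hB2 : Tendsto (fun k => √(D / triRow k)) atTop (𝓝 0) := by
      rw [← Real.sqrt_zero]
      exact (hrow.const_div_atTop D).sqrt
    have hB := hB1.add hB2
    rw [add_zero] at hB
    refine tendsto_of_tendsto_of_tendsto_of_le_of_le' tendsto_const_nhds hB
      (Eventually.of_forall fun k => (h.family_hasLaws k).minAff_nonneg _) ?_
    filter_upwards [tendsto_triRow.eventually_ge_atTop 2] with k hk
    exact hD _ _ (triCol_mem k).1 (triCol_mem k).2 hk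

end LacoinArrays

end
end ProductCutoff

/-! ### Second counterexample: products of Lacoin chains. -/

namespace ProductCutoff
noncomputable section

lemma exp_neg_two_mul_le {x : ℝ} (h0 : 0 ≤ x) (h1 : x ≤ 1 / 2) : Real.exp (-(2 * x)) ≤ 1 - x := by
  rw [Real.exp_neg, inv_le_iff_one_le_mul₀ (Real.exp_pos _)]
  have := Real.add_one_le_exp (2 * x)
  nlinarith

lemma sub_le_rpow_sub_rpow {α x y : ℝ} (hα : 1 ≤ α) (hx : 1 ≤ x) (hxy : x ≤ y) :
    y - x ≤ y ^ α - x ^ α := by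
  have hx0 : 0 < x := by linarith
  have hy0 : 0 < y := by linarith
  have e : ∀ z : ℝ, 0 < z → z ^ α = z * z ^ (α - 1) := fun z hz => by
    rw [← Real.rpow_one_add' hz.le (by linarith)]
    congr 1
    ring
  have h1 : 1 ≤ x ^ (α - 1) := Real.one_le_rpow hx (by linarith)
  have h2 : x ^ (α - 1) ≤ y ^ (α - 1) := Real.rpow_le_rpow hx0.le hxy (by linarith)
  rw [e x hx0, e y hy0]
  nlinarith

namespace LacoinArrays

variable {a b p : ℕ → ℕ → ℝ} (h : LacoinArrays a b p)
include h

/-- The time available to a chain of row n is at least 6/5 n e^(M^α - n^α), and M^α - n^α ≥ M - n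
because α ≥ 1. This leaves room for M - n + 1 rounds of length 6/5 n. -/
lemma le_weights_mul {α : ℝ} (hα : 1 ≤ α) {k M : ℕ} (hM : triRow k ≤ M) {s : ℝ}
    (hs : 6 / 5 * Real.exp ((M : ℝ) ^ α) ≤ s) :
    6 / 5 * (triRow k : ℝ) * ((M - triRow k : ℕ) + 1) ≤ lacoinWeights p α k * s := by
  obtain ⟨m, i, hi, rfl⟩ := exists_eq_triangle_add k
  rw [h.weights_triangle_add α hi]
  rw [triRow_triangle_add hi] at hM ⊢
  have hmin := h.rowMin_pos (n := m + 1) (by omega)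
  have hp : 1 ≤ p (m + 1) (i + 1) / rowMin p (m + 1) :=
    (one_le_div hmin).2 (rowMin_le p (by omega) (by omega))
  have h1 : (1 : ℝ) ≤ (m + 1 : ℕ) := by exact_mod_cast Nat.succ_pos m
  have hM' : ((m + 1 : ℕ) : ℝ) ≤ M := by exact_mod_cast hM
  have h2 := sub_le_rpow_sub_rpow hα h1 hM'
  have h3 := Real.add_one_le_exp ((M : ℝ) ^ α - ((m + 1 : ℕ) : ℝ) ^ α)
  rw [Nat.cast_sub hM]
  generalize ((m + 1 : ℕ) : ℝ) = n at *
  calc 6 / 5 * n * ((M : ℝ) - n + 1)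
      ≤ 6 / 5 * n * Real.exp ((M : ℝ) ^ α - n ^ α) := by
        gcongr
        linarith
    _ = 1 * (n * Real.exp (-n ^ α)) * (6 / 5 * Real.exp ((M : ℝ) ^ α)) := by
        rw [sub_eq_add_neg, Real.exp_add]
        ring
    _ ≤ _ := by gcongr

/-- After one round of length 6/5 n every start is at 2n up to D/n, so each further round contracts
the total variation distance by the factor D/n. -/
lemma exists_one_sub_pow_le_minAff :
    ∃ D, 0 < D ∧ ∀ k d t, 6 / 5 * (triRow k : ℝ) * ((d : ℕ) + 1) ≤ t →
      1 - (D / triRow k) ^ (d + 1) ≤ (lacoinFamily a b k).minAff t := by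
  obtain ⟨D, hD0, hD⟩ := h.exists_concentration (A := 6 / 5) (by norm_num)
  refine ⟨D, hD0, fun k d t ht => ?_⟩
  have hM := h.family_isIrreducibleMarkov k
  have : Fintype (lacoinFamily a b k).X := inferInstanceAs (Fintype (Fin (2 * triRow k + 1)))
  have hs : 0 ≤ 6 / 5 * (triRow k : ℝ) := by positivity
  refine (h.family_hasLaws k).one_sub_le_minAff ((by positivity : (0 : ℝ) ≤ _).trans ht)
    fun x => ?_
  have hDk := hD _ _ (triCol_mem k).1 (triCol_mem k).2
  have h1 := hM.tv_add_mul_le (t := 6 / 5 * (triRow k : ℝ)) (lacoinTop _ _ _) x hs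
    (η := D / triRow k) (by positivity) (fun w => sub_le_comm.1 (hDk w).1) d
  refine (hM.tv_antitone (le_trans (le_of_eq ?_) ht) x).trans (h1.trans ?_)
  · ring
  · rw [pow_succ]
    exact mul_le_mul_of_nonneg_left (hDk x).2 (by positivity)

lemma exists_le_prod_minAff {α : ℝ} (hα : 1 ≤ α) :
    ∃ δ, 0 < δ ∧ ∀ᶠ M : ℕ in atTop, ∀ s, 6 / 5 * Real.exp ((M : ℝ) ^ α) ≤ s →
      δ ≤ ∏ k ∈ Finset.range (M * (M + 1) / 2),
        (lacoinFamily a b k).minAff (lacoinWeights p α k * s) := by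
  obtain ⟨D, hD0, hD⟩ := h.exists_one_sub_pow_le_minAff
  -- Beyond row M₀ the contraction factor D/n is at most 1/2. The finitely many earlier chains are
  -- handled one by one: for M large each has affinity at least 1/2.
  obtain ⟨M₀, hM₀⟩ := exists_nat_ge (2 * D)
  have hT : ∀ k, ∃ T, ∀ t, T ≤ t → 1 / 2 ≤ (lacoinFamily a b k).minAff t := fun k => by
    have : Fintype (lacoinFamily a b k).X := inferInstanceAs (Fintype (Fin (2 * triRow k + 1)))
    obtain ⟨T, hT0, hT⟩ :=
      (h.family_isIrreducibleMarkov k).exists_tv_le (ε := 1 / 2) (by norm_num)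
    refine ⟨T, fun t ht => ?_⟩
    have := (h.family_hasLaws k).one_sub_le_minAff (hT0.trans ht) (hT t ht)
    linarith
  choose T hT using hT
  have hev : ∀ᶠ M : ℕ in atTop, ∀ k ∈ Finset.range (M₀ * (M₀ + 1) / 2),
      triRow k ≤ M ∧ T k + triRow k ≤ M := by
    rw [Finset.eventually_all]
    intro k _
    exact (eventually_ge_atTop _).and (tendsto_natCast_atTop_atTop.eventually_ge_atTop _)
  refine ⟨(1 / 2) ^ (M₀ * (M₀ + 1) / 2) * Real.exp (-(4 * D)), by positivity, ?_⟩
  filter_upwards [hev, eventually_ge_atTop M₀] with M hM hMM₀ s hs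
  have hs0 : 0 ≤ s := (by positivity : (0 : ℝ) ≤ _).trans hs
  rw [prod_range_triangle, ← Finset.prod_range_mul_prod_Ico _ hMM₀, ← prod_range_triangle
    fun k => (lacoinFamily a b k).minAff (lacoinWeights p α k * s)]
  refine mul_le_mul ?_ ?_ (by positivity)
    (Finset.prod_nonneg fun k _ => (h.family_hasLaws k).minAff_nonneg _)
  · rw [← Finset.card_range (M₀ * (M₀ + 1) / 2), ← Finset.prod_const, Finset.card_range]
    refine Finset.prod_le_prod (fun _ _ => by norm_num) fun k hk => hT k _ ?_
    have h1 := h.le_weights_mul hα (hM k hk).1 hs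
    have h2 : (1 : ℝ) ≤ triRow k := by exact_mod_cast one_le_triRow k
    rw [Nat.cast_sub (hM k hk).1] at h1
    have h3 : (triRow k : ℝ) ≤ M := by exact_mod_cast (hM k hk).1
    have h4 := (hM k hk).2
    nlinarith
  -- Row m + 1 has m + 1 factors, each at least exp(-2 (D/(m+1))^(d+1)), where d counts the rows
  -- after it. One power of D/(m+1) pays for the number of factors, and 2^(-d) sums to at most 2
  -- over the rows.
  · have hrow : ∀ m ∈ Finset.Ico M₀ M, Real.exp (-(2 * D) * (1 / 2) ^ (M - 1 - m))
        ≤ ∏ i ∈ Finset.range (m + 1), (lacoinFamily a b (m * (m + 1) / 2 + i)).minAff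
          (lacoinWeights p α (m * (m + 1) / 2 + i) * s) := by
      intro m hm
      obtain ⟨hm1, hm2⟩ := Finset.mem_Ico.1 hm
      have hm0 : (0 : ℝ) < (m + 1 : ℕ) := by positivity
      have hq : D / (m + 1 : ℕ) ≤ 1 / 2 := by
        rw [div_le_iff₀ hm0]
        have : (M₀ : ℝ) ≤ (m + 1 : ℕ) := by exact_mod_cast hm1.trans (Nat.le_succ m)
        linarith
      have hq0 : 0 ≤ D / (m + 1 : ℕ) := by positivity
      set d := M - 1 - m with hd
      set x := (D / (m + 1 : ℕ)) ^ (d + 1) with hx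
      have hx0 : 0 ≤ x := by positivity
      have hx1 : x ≤ 1 / 2 :=
        (pow_le_of_le_one hq0 (hq.trans (by norm_num)) (Nat.succ_ne_zero d)).trans hq
      calc Real.exp (-(2 * D) * (1 / 2) ^ d)
          ≤ Real.exp (((m + 1 : ℕ) : ℝ) * -(2 * x)) := by
            apply Real.exp_le_exp.2
            have e1 : ((m + 1 : ℕ) : ℝ) * x = D * (D / (m + 1 : ℕ)) ^ d := by
              rw [hx, pow_succ]
              field_simp
            have e2 : D * (D / (m + 1 : ℕ)) ^ d ≤ D * (1 / 2) ^ d := by gcongr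
            linarith
        _ = ∏ _i ∈ Finset.range (m + 1), Real.exp (-(2 * x)) := by
            rw [Finset.prod_const, Finset.card_range, Real.exp_nat_mul]
        _ ≤ _ := by
            refine Finset.prod_le_prod (fun _ _ => (Real.exp_pos _).le) fun i hi => ?_
            have hi' : i ≤ m := Nat.lt_succ_iff.1 (Finset.mem_range.1 hi)
            have hr := triRow_triangle_add hi'
            have h1 := h.le_weights_mul hα (k := m * (m + 1) / 2 + i) (M := M)
              (by rw [hr]; exact hm2) hs
            rw [hr, show M - (m + 1) = d by omega, ← hr] at h1
            have h2 := hD _ d _ h1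
            rw [hr] at h2
            exact (exp_neg_two_mul_le hx0 hx1).trans h2
    refine le_trans ?_ (Finset.prod_le_prod (fun _ _ => (Real.exp_pos _).le) hrow)
    rw [← Real.exp_sum, ← Finset.mul_sum]
    apply Real.exp_le_exp.2
    have h1 : ∑ m ∈ Finset.Ico M₀ M, (1 / 2 : ℝ) ^ (M - 1 - m) ≤ 2 := by
      calc ∑ m ∈ Finset.Ico M₀ M, (1 / 2 : ℝ) ^ (M - 1 - m)
          ≤ ∑ m ∈ Finset.range M, (1 / 2 : ℝ) ^ (M - 1 - m) :=
            Finset.sum_le_sum_of_subset_of_nonneg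
              (fun m hm => Finset.mem_range.2 (Finset.mem_Ico.1 hm).2) fun _ _ _ => by positivity
        _ = ∑ m ∈ Finset.range M, (1 / 2 : ℝ) ^ m :=
            Finset.sum_range_reflect (fun m => (1 / 2 : ℝ) ^ m) M
        _ ≤ 2 := sum_geometric_two_le M
    nlinarith

lemma minAff_le_exp {n i : ℕ} (h1 : 1 ≤ i) (h2 : i ≤ n) (hn : 2 ≤ n) {t : ℝ} (ht0 : 0 ≤ t)
    (ht : t ≤ 19 / 10 * n) :
    (lacoin n (a n i) (b n i)).minAff t
      ≤ Real.exp (-(b n i / 4) + Real.exp (-(n / 4000 : ℝ)) + 5 * (n * a n i)) := by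
  have hP := h.params h1 h2
  have hn' : (2 : ℝ) ≤ n := by exact_mod_cast hn
  have ha := hP.a_pos
  -- With l = 1/20 the exponent is at most (19/10 · 21/400 - 1/10) n = -n/4000; a time of 19/10 n is
  -- short enough that the detour is rarely completed.
  have hl : Real.exp (1 / 20) - 1 ≤ 21 / 400 := by
    have := (abs_le.1 (Real.abs_exp_sub_one_sub_id_le (x := 1 / 20)
      (by rw [abs_of_pos] <;> norm_num))).2
    linarith
  have e1 : Real.exp (t * (Real.exp (1 / 20) - 1) - 1 / 20 * (2 * n))
      ≤ Real.exp (-(n / 4000 : ℝ)) := by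
    apply Real.exp_le_exp.2
    have : t * (Real.exp (1 / 20) - 1) ≤ 19 / 10 * n * (21 / 400) := by
      gcongr
      linarith [Real.add_one_le_exp (1 / 20)]
    linarith
  have e2 : a n i * t ≤ a n i * (19 / 10 * n) := by gcongr
  have h3 := hP.H_lacoin_bot_le_slow (h1.trans h2) (l := 1 / 20) (by norm_num) ht0
  have h4 := hP.one_sub_stat_le hn
  have h5 := (h.isIrreducibleMarkov h1 h2).aff_le_one_sub ht0 (lacoinBot n (a n i) (b n i))
    (lacoinTop n (a n i) (b n i))
  have h6 := (h.hasLaws h1 h2).minAff_le t (lacoinBot n (a n i) (b n i))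
  have h7 := Real.exp_pos (-(n / 4000 : ℝ))
  refine le_trans ?_ (Real.add_one_le_exp _)
  nlinarith

lemma exists_prod_minAff_le {α : ℝ} :
    ∃ δ, 0 < δ ∧ ∀ᶠ M : ℕ in atTop, ∀ s, 0 ≤ s → s ≤ 9 / 5 * Real.exp ((M : ℝ) ^ α) →
      ∏ k ∈ Finset.range (M * (M + 1) / 2),
        (lacoinFamily a b k).minAff (lacoinWeights p α k * s) ≤ 1 - δ := by
  obtain ⟨C, hC1, hC⟩ := h.b_bound
  have hC0 : 0 < C := by linarith
  have hδ : Real.exp (-(1 / (8 * C))) < 1 := Real.exp_lt_one_iff.2 (by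
    have : 0 < 1 / (8 * C) := by positivity
    linarith)
  refine ⟨1 - Real.exp (-(1 / (8 * C))), by linarith, ?_⟩
  have hexp : Tendsto (fun n : ℕ => (n : ℝ) * Real.exp (-(n / 4000 : ℝ))) atTop (𝓝 0) := by
    have h1 := (Real.tendsto_pow_mul_exp_neg_atTop_nhds_zero 1).comp
      ((tendsto_natCast_atTop_atTop (R := ℝ)).atTop_div_const (r := 4000) (by norm_num))
    have h2 := h1.const_mul 4000
    rw [mul_zero] at h2
    refine h2.congr fun n => ?_
    simp only [Function.comp, pow_one]
    ring
  have herr := hexp.add (h.a_sum.const_mul 5)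
  rw [mul_zero, add_zero] at herr
  have hq : (0 : ℝ) < 1 / (8 * C) := by positivity
  -- Only the last row is used. Its n factors gain at least n · 1/(4Cn) = 2/(8C) in the exponent,
  -- and the errors are kept below 1/(8C). The ratio 19/18 turns the time limit 9/5 into 19/10.
  filter_upwards [herr.eventually_le_const hq,
    h.p_ratio.eventually_le_const (show (1 : ℝ) < 19 / 18 by norm_num),
    eventually_ge_atTop 2] with M hM1 hM2 hM3 s hs0 hs
  obtain ⟨m, rfl⟩ : ∃ m, M = m + 1 := ⟨M - 1, by omega⟩
  have hnn := fun k => (h.family_hasLaws k).minAff_nonneg (lacoinWeights p α k * s)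
  have hmin := h.rowMin_pos (n := m + 1) (by omega)
  rw [triangle_succ, Finset.prod_range_add, sub_sub_cancel]
  refine (mul_le_of_le_one_left (Finset.prod_nonneg fun k _ => hnn _)
    (Finset.prod_le_one (fun k _ => hnn _) fun k _ => (h.family_hasLaws k).minAff_le_one
      (mul_nonneg (h.weights_pos α k).le hs0))).trans ?_
  have hfac : ∀ i ∈ Finset.range (m + 1),
      (lacoinFamily a b (m * (m + 1) / 2 + i)).minAff
          (lacoinWeights p α (m * (m + 1) / 2 + i) * s)
        ≤ Real.exp (-(1 / (C * (m + 1 : ℕ)) / 4) + Real.exp (-((m + 1 : ℕ) / 4000 : ℝ))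
          + 5 * ((m + 1 : ℕ) * a (m + 1) (i + 1))) := by
    intro i hi
    have hi' : i ≤ m := Nat.lt_succ_iff.1 (Finset.mem_range.1 hi)
    have ht : lacoinWeights p α (m * (m + 1) / 2 + i) * s ≤ 19 / 10 * (m + 1 : ℕ) := by
      rw [h.weights_triangle_add α hi']
      have hp : p (m + 1) (i + 1) / rowMin p (m + 1) ≤ 19 / 18 :=
        (div_le_div_of_nonneg_right (le_rowMax p (by omega) (by omega)) hmin.le).trans hM2
      have hn0 : (0 : ℝ) ≤ (m + 1 : ℕ) := Nat.cast_nonneg _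
      generalize ((m + 1 : ℕ) : ℝ) = n at *
      calc p (m + 1) (i + 1) / rowMin p (m + 1) * (n * Real.exp (-n ^ α)) * s
          ≤ 19 / 18 * (n * Real.exp (-n ^ α)) * (9 / 5 * Real.exp (n ^ α)) := by gcongr
        _ = 19 / 10 * n * (Real.exp (-n ^ α) * Real.exp (n ^ α)) := by ring
        _ = 19 / 10 * n := by rw [← Real.exp_add, neg_add_cancel, Real.exp_zero, mul_one]
    have h1 := h.minAff_le_exp (n := m + 1) (i := i + 1) (by omega) (by omega) hM3
      (mul_nonneg (h.weights_pos α (m * (m + 1) / 2 + i)).le hs0) ht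
    rw [lacoinFamily, triRow_triangle_add hi', triCol_triangle_add hi']
    refine h1.trans (Real.exp_le_exp.2 ?_)
    have := (hC (m + 1) (i + 1) (by omega) (by omega)).1
    linarith
  refine (Finset.prod_le_prod (fun i _ => hnn _) hfac).trans ?_
  rw [← Real.exp_sum]
  apply Real.exp_le_exp.2
  rw [Finset.sum_add_distrib, ← Finset.mul_sum, ← Finset.mul_sum, ← rowSum_eq_sum_range,
    Finset.sum_const, Finset.card_range, nsmul_eq_mul]
  have e : ((m + 1 : ℕ) : ℝ) * (1 / (C * (m + 1 : ℕ)) / 4) = 2 * (1 / (8 * C)) := by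
    field_simp
    norm_num
  linarith

lemma not_cutoffAff_prod {α : ℝ} (hα : 1 ≤ α) :
    ¬ CutoffAff (prodFamily (lacoinFamily a b) (lacoinWeights p α)) := by
  rintro ⟨t, ht0, ht1, ht2⟩
  obtain ⟨δ, hδ, hlow⟩ := h.exists_le_prod_minAff hα
  obtain ⟨ε, hε, hup⟩ := h.exists_prod_minAff_le (α := α)
  -- With indices starting at 0, N n is the last chain of row n + 1, so the product consists of
  -- complete rows.
  set N : ℕ → ℕ := fun n => n * (n + 1) / 2 + n with hN
  have hNsucc : ∀ n, N n + 1 = (n + 1) * (n + 1 + 1) / 2 := fun n => by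
    rw [triangle_succ]
    rfl
  have hNtop : Tendsto N atTop atTop :=
    tendsto_atTop_mono (fun n => Nat.le_add_left _ _) tendsto_id
  have e1 := ((ht1 (6 / 5) (by norm_num)).comp hNtop).eventually_const_lt
    (show 1 - ε < 1 by linarith)
  have e2 := ((ht2 (4 / 5) (by norm_num) (by norm_num)).comp hNtop).eventually_lt_const hδ
  obtain ⟨n, h1, h2, h3, h4⟩ := (e1.and (e2.and
    (((tendsto_add_atTop_nat 1).eventually hlow).and
      ((tendsto_add_atTop_nat 1).eventually hup)))).exists
  set σ := t (N n) / ∑ j ∈ Finset.range (N n + 1), lacoinWeights p α j with hσ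
  have hσ0 : 0 ≤ σ := div_nonneg (ht0 _).le (Finset.sum_nonneg fun j _ => (h.weights_pos α j).le)
  have hprod : ∀ A, 0 ≤ A → (prodFamily (lacoinFamily a b) (lacoinWeights p α) (N n)).minAff
      (A * t (N n)) = ∏ k ∈ Finset.range ((n + 1) * (n + 1 + 1) / 2),
        (lacoinFamily a b k).minAff (lacoinWeights p α k * (A * σ)) := fun A hA => by
    rw [minAff_prodFamily h.family_hasLaws (h.weights_pos α) _ (mul_nonneg hA (ht0 _).le),
      ← hNsucc, hσ]
    simp only [mul_div_assoc]
  simp only [Function.comp] at h1 h2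
  rw [hprod _ (by norm_num)] at h1 h2
  have hexp := Real.exp_pos (((n + 1 : ℕ) : ℝ) ^ α)
  -- The threshold 3/2 fits both windows: 4/5 · 3/2 = 6/5 and 6/5 · 3/2 = 9/5. Either the affinity
  -- at 4/5 of the alleged cutoff time is not small, or at 6/5 of it is not close to 1.
  rcases le_total (3 / 2 * Real.exp (((n + 1 : ℕ) : ℝ) ^ α)) σ with hc | hc
  · exact absurd (h3 (4 / 5 * σ) (by linarith)) (not_le.2 h2)
  · exact absurd (h4 (6 / 5 * σ) (by positivity) (by linarith)) (not_le.2 h1)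

end LacoinArrays

end
end ProductCutoff

/-! ### Existence of admissible arrays and conclusion. -/

namespace ProductCutoff
noncomputable section

lemma rowMax_one {n : ℕ} (hn : 1 ≤ n) : rowMax (fun _ _ => 1) n = 1 := by
  rw [rowMax, Set.Nonempty.image_const ⟨1, Set.mem_Icc.2 ⟨le_rfl, hn⟩⟩, csSup_singleton]

lemma rowMin_one {n : ℕ} (hn : 1 ≤ n) : rowMin (fun _ _ => 1) n = 1 := by
  rw [rowMin, Set.Nonempty.image_const ⟨1, Set.mem_Icc.2 ⟨le_rfl, hn⟩⟩, csInf_singleton]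

lemma lacoinArrays_exist :
    LacoinArrays (fun n _ => 1 / (8 * (n : ℝ) ^ 3)) (fun n _ => 1 / (4 * (n : ℝ)))
      (fun _ _ => 1) where
  p_pos _ _ _ _ := one_pos
  a_pos n i h1 h2 := by
    have : (0 : ℝ) < n := by exact_mod_cast h1.trans h2
    positivity
  a_lt_b n i h1 h2 := by
    have hn : (1 : ℝ) ≤ n := by exact_mod_cast h1.trans h2
    have : (n : ℝ) ≤ n ^ 3 := le_self_pow₀ hn (by norm_num)
    exact one_div_lt_one_div_of_lt (by linarith) (by linarith)
  a_add_b n i h1 h2 := by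
    have hn : (1 : ℝ) ≤ n := by exact_mod_cast h1.trans h2
    have h3 : (1 : ℝ) ≤ n ^ 3 := one_le_pow₀ hn
    have h4 : 1 / (8 * (n : ℝ) ^ 3) ≤ 1 / 8 := one_div_le_one_div_of_le (by norm_num) (by linarith)
    have h5 : 1 / (4 * (n : ℝ)) ≤ 1 / 4 := one_div_le_one_div_of_le (by norm_num) (by linarith)
    linarith
  a_bound := by
    refine ⟨1, fun n i h1 h2 => ?_⟩
    have hn : (1 : ℝ) ≤ n := by exact_mod_cast h1.trans h2
    have : (n : ℝ) ^ 2 ≤ n ^ 3 := pow_le_pow_right₀ hn (by norm_num)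
    exact one_div_le_one_div_of_le (by positivity) (by nlinarith [sq_nonneg (n : ℝ)])
  a_sum := by
    refine (tendsto_const_div_atTop_nhds_zero_nat (1 / 8)).congr' ?_
    filter_upwards [eventually_ge_atTop 1] with n hn
    have hn0 : (n : ℝ) ≠ 0 := by exact_mod_cast (by omega : n ≠ 0)
    rw [rowSum, Finset.sum_const, Nat.card_Icc, nsmul_eq_mul, Nat.add_sub_cancel]
    field_simp
  b_bound := by
    refine ⟨4, by norm_num, fun n i h1 h2 => ⟨le_rfl, ?_⟩⟩
    have hn : (1 : ℝ) ≤ n := by exact_mod_cast h1.trans h2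
    exact div_le_div₀ (by norm_num) (by norm_num) (by linarith) (by linarith)
  p_ratio := by
    refine tendsto_const_nhds.congr' ?_
    filter_upwards [eventually_ge_atTop 1] with n hn
    rw [rowMax_one hn, rowMin_one hn, div_one]

lemma cutoffTV_prodFamily_iff {F : ℕ → Chain} {p : ℕ → ℝ} (hF : ∀ k, (F k).HasLaws)
    (hp : ∀ k, 0 < p k) : CutoffTV (prodFamily F p) ↔ CutoffAff (prodFamily F p) :=
  cutoffTV_iff (hasLaws_prodFamily hF hp)

lemma cutoffH_prodFamily_iff {F : ℕ → Chain} {p : ℕ → ℝ} (hF : ∀ k, (F k).HasLaws)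
    (hp : ∀ k, 0 < p k) : CutoffH (prodFamily F p) ↔ CutoffAff (prodFamily F p) :=
  cutoffH_iff (hasLaws_prodFamily hF hp)

lemma mixed_cutoffs {r : ℝ} (hr : 0 < r) (hr1 : r < 1) :
    ¬ CutoffTV mixedFamily ∧ CutoffTV (prodFamily mixedFamily (mixedWeights r)) ∧
      ¬ CutoffH mixedFamily ∧ CutoffH (prodFamily mixedFamily (mixedWeights r)) := by
  rw [cutoffTV_iff mixedFamily_hasLaws, cutoffH_iff mixedFamily_hasLaws,
    cutoffTV_prodFamily_iff mixedFamily_hasLaws (mixedWeights_pos hr),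
    cutoffH_prodFamily_iff mixedFamily_hasLaws (mixedWeights_pos hr)]
  have h1 := not_cutoffAff_mixedFamily
  have h2 := cutoffAff_prod_mixed hr hr1
  exact ⟨h1, h2, h1, h2⟩

lemma LacoinArrays.cutoffs {a b p : ℕ → ℕ → ℝ} (h : LacoinArrays a b p) {α : ℝ} (hα : 1 ≤ α) :
    CutoffTV (lacoinFamily a b) ∧
      ¬ CutoffTV (prodFamily (lacoinFamily a b) (lacoinWeights p α)) ∧
      CutoffH (lacoinFamily a b) ∧
      ¬ CutoffH (prodFamily (lacoinFamily a b) (lacoinWeights p α)) := by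
  rw [cutoffTV_iff h.family_hasLaws, cutoffH_iff h.family_hasLaws,
    cutoffTV_prodFamily_iff h.family_hasLaws (h.weights_pos α),
    cutoffH_prodFamily_iff h.family_hasLaws (h.weights_pos α)]
  have h1 := h.cutoffAff_family
  have h2 := h.not_cutoffAff_prod hα
  exact ⟨h1, h2, h1, h2⟩

end
end ProductCutoff

open ProductCutoff in
theorem theorem1p4 :
    -- in total variation, neither cutoff implies the other
    (¬ ∀ (F : ℕ → Chain) (P : ℕ → ℝ), (∀ n, (F n).IsIrreducibleMarkov) → (∀ n, 0 < P n) →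
        CutoffTV F → CutoffTV (prodFamily F P)) ∧
    (¬ ∀ (F : ℕ → Chain) (P : ℕ → ℝ), (∀ n, (F n).IsIrreducibleMarkov) → (∀ n, 0 < P n) →
        CutoffTV (prodFamily F P) → CutoffTV F) ∧
    -- in the Hellinger distance, neither cutoff implies the other
    (¬ ∀ (F : ℕ → Chain) (P : ℕ → ℝ), (∀ n, (F n).IsIrreducibleMarkov) → (∀ n, 0 < P n) →
        CutoffH F → CutoffH (prodFamily F P)) ∧
    (¬ ∀ (F : ℕ → Chain) (P : ℕ → ℝ), (∀ n, (F n).IsIrreducibleMarkov) → (∀ n, 0 < P n) →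
        CutoffH (prodFamily F P) → CutoffH F) ∧
    -- first counterexample: Ehrenfest chains mixed with paths
    (∀ r : ℝ, 0 < r → r < 1 →
      (∀ n, (mixedFamily n).IsIrreducibleMarkov) ∧ (∀ n, 0 < mixedWeights r n) ∧
      ¬ CutoffTV mixedFamily ∧ CutoffTV (prodFamily mixedFamily (mixedWeights r)) ∧
      ¬ CutoffH mixedFamily ∧ CutoffH (prodFamily mixedFamily (mixedWeights r))) ∧
    -- second counterexample: Lacoin chains listed row by row
    (∃ a b p : ℕ → ℕ → ℝ, LacoinArrays a b p) ∧
    (∀ (a b p : ℕ → ℕ → ℝ) (α : ℝ), LacoinArrays a b p → 1 ≤ α →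
      (∀ n, (lacoinFamily a b n).IsIrreducibleMarkov) ∧ (∀ n, 0 < lacoinWeights p α n) ∧
      CutoffTV (lacoinFamily a b) ∧
      ¬ CutoffTV (prodFamily (lacoinFamily a b) (lacoinWeights p α)) ∧
      CutoffH (lacoinFamily a b) ∧
      ¬ CutoffH (prodFamily (lacoinFamily a b) (lacoinWeights p α))) := by
  obtain ⟨m1, m2, m3, m4⟩ := mixed_cutoffs (r := 1 / 2) (by norm_num) (by norm_num)
  have mw := mixedWeights_pos (r := 1 / 2) (by norm_num)
  have hl := lacoinArrays_exist
  obtain ⟨l1, l2, l3, l4⟩ := hl.cutoffs le_rfl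
  exact ⟨fun hc => l2 (hc _ _ hl.family_isIrreducibleMarkov (hl.weights_pos 1) l1),
    fun hc => m1 (hc _ _ mixedFamily_isIrreducibleMarkov mw m2),
    fun hc => l4 (hc _ _ hl.family_isIrreducibleMarkov (hl.weights_pos 1) l3),
    fun hc => m3 (hc _ _ mixedFamily_isIrreducibleMarkov mw m4),
    fun r hr hr1 => ⟨mixedFamily_isIrreducibleMarkov, mixedWeights_pos hr, mixed_cutoffs hr hr1⟩,
    ⟨_, _, _, hl⟩,
    fun a b p α h hα => ⟨h.family_isIrreducibleMarkov, h.weights_pos α, h.cutoffs hα⟩⟩
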